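/- **Theorem 2 (explicit form of the denominator in Shimura's conjecture for $\mathrm{Sp}_3$).** Let $p$ be a prime and $n=3$. Put $J=\begin{pmatrix}0&-E_n\\E_n&0\end{pmatrix}$, $\Gamma=\mathrm{Sp}_n(\mathbb Z)$, and let $S_p$ be the group of all $M\in\mathrm{GL}_{2n}(\mathbb Q)$ with entries in $\mathbb Z[1/p]$ such that ${}^tMJM=p^{\delta}J$ for some $\delta\in\mathbb Z$. Let $\mathcal L_p$ be the Hecke algebra of the pair $(\Gamma,S_p)$ with rational coefficients: its elements are the finite rational linear combinations of cosets $\Gamma M$, $M\in S_p$, that are invariant under right multiplication by $\Gamma$, with product $\big(\sum_i a_i(\Gamma M_i)\big)\big(\sum_j b_j(\Gamma N_j)\big)=\sum_{i,j}a_ib_j(\Gamma M_iN_j)$; a double coset $(M)=\Gamma M\Gamma$ is identified with the sum of the finitely many cosets $\Gamma M_i$ it consists of. Put $$\mathbf T(p)=(\mathrm{diag}(1,1,1;p,p,p)),\qquad \mathbf T_1(p^2)=(\mathrm{diag}(1,1,p;p^2,p^2,p)),$$ $$\mathbf T_2(p^2)=(\mathrm{diag}(1,p,p;p^2,p,p)),\qquad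 \mathbf T_3(p^2)=[\mathbf p]_3=(pE_6),$$ and let $\mathcal L_{\mathbb Z}=\mathbb Z[\mathbf T(p),\mathbf T_1(p^2),\mathbf T_2(p^2),\mathbf T_3(p^2)]\subset\mathcal L_p$. Let $\Omega:\mathcal L_p\to\mathbb Q[x_0^{\pm1},x_1^{\pm1},x_2^{\pm1},x_3^{\pm1}]$ be the spherical map, that is, the $\mathbb Q$-linear map given on cosets by $\Omega(\Gamma M)=x_0^{\delta}\prod_{i=1}^{3}(x_ip^{-i})^{d_i}$, where the representative is chosen as $M=\begin{pmatrix}A&B\\0&D\end{pmatrix}$ with ${}^tMJM=p^{\delta}J$ and $D$ upper triangular with diagonal $(p^{d_1},p^{d_2},p^{d_3})$. It is applied to polynomials in $v$ coefficientwise. Then there is exactly one polynomial $\mathbf Q_3(v)\in\mathcal L_p[v]$ such that $$\Omega(\mathbf Q_3)(v)=\prod_{k=0}^{3}\ \prod_{1\le i_1<\dots<i_k\le3}(1-x_0x_{i_1}\cdots x_{i_k}v),$$ and it is $$\begin{aligned} \mathbf Q_3(v)=1&-\mathbf T(p)\,v+p\big(\mathbf T_1(p^2)+(p^2+1)\mathbf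 T_2(p^2)+(p^2+1)^2[\mathbf p]_3\big)v^2-p^3\,\mathbf T(p)\big(\mathbf T_2(p^2)+[\mathbf p]_3\big)v^3\\ &+p^6\big(-2p\,\mathbf T_1(p^2)[\mathbf p]_3+\mathbf T_2(p^2)^2-2(p-1)\mathbf T_2(p^2)[\mathbf p]_3\\ &\qquad-(p^2+2p-1)(p^2-p+1)(p^2+p+1)[\mathbf p]_3^2+[\mathbf p]_3\mathbf T(p)^2\big)v^4\\ &-p^9[\mathbf p]_3\mathbf T(p)\big(\mathbf T_2(p^2)+[\mathbf p]_3\big)v^5+p^{13}[\mathbf p]_3^2\big(\mathbf T_1(p^2)+(p^2+1)\mathbf T_2(p^2)+(p^2+1)^2[\mathbf p]_3\big)v^6\\ &-p^{18}[\mathbf p]_3^3\,\mathbf T(p)\,v^7+p^{24}[\mathbf p]_3^4\,v^8 . \end{aligned}$$ It has degree $8$, and its coefficients lie in $\mathcal L_{\mathbb Z}$. -/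

import Mathlib

open Matrix Polynomial

/-! ## The Hecke algebra of a pair `(Γ, G)`

It is built on the free `ℚ`-module on the cosets `Γ g`: its elements are the finite combinations
`∑ aᵢ (Γ gᵢ)` that are invariant under right translation by `Γ`, with the product
`(∑ aᵢ (Γ gᵢ)) (∑ bⱼ (Γ hⱼ)) = ∑ aᵢ bⱼ (Γ gᵢ hⱼ)`. -/

namespace SpHecke

section Abstract

variable {G : Type*} [Group G] (Γ : Subgroup G)

/-- The set `Γ \ G` of cosets `Γ g`. -/
abbrev Cosets : Type _ := Quotient (QuotientGroup.rightRel Γ)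

/-- The coset `Γ g`. -/
def coset (g : G) : Cosets Γ := Quotient.mk _ g

theorem coset_eq_iff (g h : G) : coset Γ g = coset Γ h ↔ h * g⁻¹ ∈ Γ := by
  unfold coset
  rw [Quotient.eq]
  exact QuotientGroup.rightRel_apply

/-- Right translation `Γ h ↦ Γ h g`. -/
def translate (g : G) : Cosets Γ → Cosets Γ :=
  Quotient.map (fun h => h * g) (by
    intro a b hab
    have hab' := QuotientGroup.rightRel_apply.1 hab
    refine QuotientGroup.rightRel_apply.2 ?_
    simpa [mul_assoc] using hab')

@[simp] theorem translate_coset (g h : G) : translate Γ g (coset Γ h) = coset Γ (h * g) := rfl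

@[simp] theorem coset_out (c : Cosets Γ) : coset Γ c.out = c := Quotient.out_eq c

theorem translate_one : translate Γ 1 = id := by
  funext c
  rw [← coset_out Γ c, translate_coset, mul_one]
  rfl

theorem translate_translate (g h : G) (c : Cosets Γ) :
    translate Γ h (translate Γ g c) = translate Γ (g * h) c := by
  rw [← coset_out Γ c]
  simp only [translate_coset, mul_assoc]

/-- Right translation on finite linear combinations of cosets. -/
noncomputable def act (g : G) : (Cosets Γ →₀ ℚ) →ₗ[ℚ] (Cosets Γ →₀ ℚ) :=
  Finsupp.lmapDomain ℚ ℚ (translate Γ g)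

@[simp] theorem act_single (g : G) (c : Cosets Γ) (a : ℚ) :
    act Γ g (Finsupp.single c a) = Finsupp.single (translate Γ g c) a := by
  simp [act, Finsupp.mapDomain_single]

theorem act_one (t : Cosets Γ →₀ ℚ) : act Γ 1 t = t := by
  simp [act, translate_one]

theorem act_act (g h : G) (t : Cosets Γ →₀ ℚ) : act Γ h (act Γ g t) = act Γ (g * h) t := by
  simp only [act, Finsupp.lmapDomain_apply, ← Finsupp.mapDomain_comp]
  congr 1
  funext c
  exact translate_translate Γ g h c

/-- The combinations of cosets that are invariant under right translation by `Γ`. -/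
noncomputable def invariants : Submodule ℚ (Cosets Γ →₀ ℚ) where
  carrier := {t | ∀ γ ∈ Γ, act Γ γ t = t}
  add_mem' := by
    intro a b ha hb γ hγ
    rw [map_add, ha γ hγ, hb γ hγ]
  zero_mem' := by
    intro γ _
    exact map_zero _
  smul_mem' := by
    intro c a ha γ hγ
    rw [map_smul, ha γ hγ]

/-- The Hecke algebra of the pair `(Γ, G)` with rational coefficients. -/
def HeckeAlgebra : Type _ := invariants Γ

noncomputable instance : AddCommGroup (HeckeAlgebra Γ) :=
  inferInstanceAs (AddCommGroup (invariants Γ))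

noncomputable instance : Module ℚ (HeckeAlgebra Γ) :=
  inferInstanceAs (Module ℚ (invariants Γ))

/-- An element of the Hecke algebra as a combination of cosets. -/
noncomputable def toCosets : HeckeAlgebra Γ →ₗ[ℚ] (Cosets Γ →₀ ℚ) := (invariants Γ).subtype

theorem toCosets_injective : Function.Injective (toCosets Γ) := Subtype.val_injective

theorem act_toCosets (t : HeckeAlgebra Γ) {γ : G} (hγ : γ ∈ Γ) :
    act Γ γ (toCosets Γ t) = toCosets Γ t := t.2 γ hγ

/-- The product `(∑ aᵢ (Γ gᵢ)) (∑ bⱼ (Γ hⱼ)) = ∑ aᵢ bⱼ (Γ gᵢ hⱼ)`, with `hⱼ` a chosen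
representative of its coset; the choice is immaterial when the first factor is invariant
(see `act_eq_of_coset_eq`). -/
noncomputable def cosetMul (t : Cosets Γ →₀ ℚ) : (Cosets Γ →₀ ℚ) →ₗ[ℚ] (Cosets Γ →₀ ℚ) :=
  Finsupp.linearCombination ℚ (fun c => act Γ c.out t)

theorem cosetMul_single (t : Cosets Γ →₀ ℚ) (c : Cosets Γ) (a : ℚ) :
    cosetMul Γ t (Finsupp.single c a) = a • act Γ c.out t := by
  simp [cosetMul, Finsupp.linearCombination_single]

theorem act_eq_of_coset_eq (t : HeckeAlgebra Γ) {g h : G} (hgh : coset Γ g = coset Γ h) :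
    act Γ g (toCosets Γ t) = act Γ h (toCosets Γ t) := by
  have h1 := (coset_eq_iff Γ g h).1 hgh
  have h2 : h = (h * g⁻¹) * g := by simp
  rw [h2, ← act_act, act_toCosets Γ t h1]

theorem act_cosetMul (t : HeckeAlgebra Γ) (u : Cosets Γ →₀ ℚ) (g : G) :
    act Γ g (cosetMul Γ (toCosets Γ t) u) = cosetMul Γ (toCosets Γ t) (act Γ g u) := by
  induction u using Finsupp.induction_linear with
  | zero => simp
  | add a b ha hb => simp only [map_add, ha, hb]
  | single c a =>
    rw [cosetMul_single, act_single, cosetMul_single, map_smul, act_act]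
    congr 1
    refine act_eq_of_coset_eq Γ t ?_
    rw [← translate_coset, coset_out, coset_out]

noncomputable instance : Mul (HeckeAlgebra Γ) where
  mul t u := ⟨cosetMul Γ (toCosets Γ t) (toCosets Γ u), by
    intro γ hγ
    rw [act_cosetMul, act_toCosets Γ u hγ]⟩

theorem toCosets_mul (t u : HeckeAlgebra Γ) :
    toCosets Γ (t * u) = cosetMul Γ (toCosets Γ t) (toCosets Γ u) := rfl

/-- The unit is the coset `Γ`. -/
noncomputable instance : One (HeckeAlgebra Γ) where
  one := ⟨Finsupp.single (coset Γ 1) 1, by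
    intro γ hγ
    rw [act_single, translate_coset]
    congr 1
    rw [coset_eq_iff]
    simpa using hγ⟩

theorem toCosets_one : toCosets Γ 1 = Finsupp.single (coset Γ 1) 1 := rfl

theorem cosetMul_add_left (t t' u : Cosets Γ →₀ ℚ) :
    cosetMul Γ (t + t') u = cosetMul Γ t u + cosetMul Γ t' u := by
  induction u using Finsupp.induction_linear with
  | zero => simp
  | add a b ha hb => rw [map_add, map_add, map_add, ha, hb]; abel
  | single c a => simp only [cosetMul_single, map_add, smul_add]

theorem cosetMul_assoc (t u : HeckeAlgebra Γ) (w : Cosets Γ →₀ ℚ) :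
    cosetMul Γ (toCosets Γ (t * u)) w =
      cosetMul Γ (toCosets Γ t) (cosetMul Γ (toCosets Γ u) w) := by
  induction w using Finsupp.induction_linear with
  | zero => simp
  | add a b ha hb => rw [map_add, map_add, map_add, ha, hb]
  | single c a =>
    rw [cosetMul_single, cosetMul_single, map_smul, toCosets_mul, act_cosetMul]

theorem cosetMul_one_left (u : Cosets Γ →₀ ℚ) :
    cosetMul Γ (Finsupp.single (coset Γ 1) 1) u = u := by
  induction u using Finsupp.induction_linear with
  | zero => simp
  | add a b ha hb => rw [map_add, ha, hb]
  | single c a =>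
    rw [cosetMul_single, act_single, translate_coset, one_mul, coset_out, Finsupp.smul_single,
      smul_eq_mul, mul_one]

noncomputable instance : Ring (HeckeAlgebra Γ) :=
  { (inferInstance : AddCommGroup (HeckeAlgebra Γ)),
    (inferInstance : Mul (HeckeAlgebra Γ)),
    (inferInstance : One (HeckeAlgebra Γ)) with
    left_distrib := fun t u w => toCosets_injective Γ (by
      simp only [toCosets_mul, map_add])
    right_distrib := fun t u w => toCosets_injective Γ (by
      simp only [toCosets_mul, map_add, cosetMul_add_left])
    zero_mul := fun t => toCosets_injective Γ (by
      rw [toCosets_mul, map_zero]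
      have h := cosetMul_add_left Γ 0 0 (toCosets Γ t)
      rw [add_zero] at h
      exact left_eq_add.1 h)
    mul_zero := fun t => toCosets_injective Γ (by
      rw [toCosets_mul, map_zero, map_zero])
    mul_assoc := fun t u w => toCosets_injective Γ (by
      rw [toCosets_mul, cosetMul_assoc, toCosets_mul, toCosets_mul])
    one_mul := fun t => toCosets_injective Γ (by
      rw [toCosets_mul, toCosets_one, cosetMul_one_left])
    mul_one := fun t => toCosets_injective Γ (by
      rw [toCosets_mul, toCosets_one, cosetMul_single, one_smul,
        act_eq_of_coset_eq Γ t (coset_out Γ (coset Γ 1)), act_one])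
    neg_add_cancel := fun t => neg_add_cancel t
    zsmul := fun n t => n • t
    nsmul := fun n t => n • t }

/-- The cosets `Γ M γ`, `γ ∈ Γ`, that make up the double coset `Γ M Γ`. -/
def cosetsIn (M : G) : Set (Cosets Γ) := Set.range (fun γ : Γ => coset Γ (M * γ))

/-- The double coset `(M) = Γ M Γ` as an element of the Hecke algebra: the sum of the cosets it
consists of, when these are finite in number. -/
noncomputable def doubleCoset (M : G) (hM : (cosetsIn Γ M).Finite) : HeckeAlgebra Γ :=
  ⟨∑ c ∈ hM.toFinset, Finsupp.single c 1, by
    intro γ hγ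
    rw [map_sum]
    simp only [act_single]
    refine Finset.sum_bij' (fun c _ => translate Γ γ c) (fun c _ => translate Γ γ⁻¹ c)
      ?_ ?_ ?_ ?_ ?_
    · intro c hc
      rw [Set.Finite.mem_toFinset] at hc ⊢
      obtain ⟨η, rfl⟩ := hc
      exact ⟨η * ⟨γ, hγ⟩, by simp [mul_assoc]⟩
    · intro c hc
      rw [Set.Finite.mem_toFinset] at hc ⊢
      obtain ⟨η, rfl⟩ := hc
      exact ⟨η * ⟨γ, hγ⟩⁻¹, by simp [mul_assoc]⟩
    · intro c _
      rw [translate_translate, mul_inv_cancel, translate_one]; rfl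
    · intro c _
      rw [translate_translate, inv_mul_cancel, translate_one]; rfl
    · intro c _; rfl⟩

end Abstract

/-! ## The symplectic group -/

section Symplectic

variable (n p : ℕ)

/-- The subring `ℤ[1/p]` of `ℚ`. -/
def zInv : Subring ℚ where
  carrier := {x | ∃ (k : ℕ) (a : ℤ), (p : ℚ) ^ k * x = a}
  mul_mem' := by
    rintro x y ⟨k, a, hx⟩ ⟨l, b, hy⟩
    exact ⟨k + l, a * b, by push_cast; rw [← hx, ← hy]; ring⟩
  one_mem' := ⟨0, 1, by simp⟩
  add_mem' := by
    rintro x y ⟨k, a, hx⟩ ⟨l, b, hy⟩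
    exact ⟨k + l, p ^ l * a + p ^ k * b, by push_cast; rw [← hx, ← hy]; ring⟩
  zero_mem' := ⟨0, 0, by simp⟩
  neg_mem' := by
    rintro x ⟨k, a, hx⟩
    exact ⟨k, -a, by push_cast; rw [← hx]; ring⟩

theorem zpow_mem_zInv [hp : Fact p.Prime] (δ : ℤ) : (p : ℚ) ^ δ ∈ zInv p := by
  have hp0 : (p : ℚ) ≠ 0 := by exact_mod_cast hp.out.ne_zero
  obtain ⟨k, rfl | rfl⟩ := δ.eq_nat_or_neg
  · exact ⟨0, p ^ k, by simp⟩
  · exact ⟨k, 1, by simp [hp0]⟩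

/-- `ᵗM J M = μ J`. -/
def IsSimilitude (M : Matrix (Fin n ⊕ Fin n) (Fin n ⊕ Fin n) ℚ) (μ : ℚ) : Prop :=
  Mᵀ * J (Fin n) ℚ * M = μ • J (Fin n) ℚ

variable {n} in
theorem IsSimilitude.mul {M N : Matrix (Fin n ⊕ Fin n) (Fin n ⊕ Fin n) ℚ} {μ ν : ℚ}
    (hM : IsSimilitude n M μ) (hN : IsSimilitude n N ν) : IsSimilitude n (M * N) (μ * ν) := by
  unfold IsSimilitude at *
  rw [transpose_mul]
  calc Nᵀ * Mᵀ * J (Fin n) ℚ * (M * N) = Nᵀ * (Mᵀ * J (Fin n) ℚ * M) * N := by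
        simp only [Matrix.mul_assoc]
    _ = (μ * ν) • J (Fin n) ℚ := by
        rw [hM, Matrix.mul_smul, Matrix.smul_mul, hN, smul_smul]

variable {n} in
theorem IsSimilitude.inv_eq {M : GL (Fin n ⊕ Fin n) ℚ} {μ : ℚ} (hμ : μ ≠ 0)
    (hM : IsSimilitude n M.1 μ) :
    (M⁻¹).1 = μ⁻¹ • (-(J (Fin n) ℚ) * M.1ᵀ * J (Fin n) ℚ) := by
  have h : (μ⁻¹ • (-(J (Fin n) ℚ) * M.1ᵀ * J (Fin n) ℚ)) * M.1 = 1 := by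
    unfold IsSimilitude at hM
    rw [Matrix.smul_mul, Matrix.mul_assoc, Matrix.mul_assoc, ← Matrix.mul_assoc M.1ᵀ, hM,
      Matrix.mul_smul, smul_smul, inv_mul_cancel₀ hμ, one_smul, Matrix.neg_mul, J_squared, neg_neg]
  calc (M⁻¹).1 = (μ⁻¹ • (-(J (Fin n) ℚ) * M.1ᵀ * J (Fin n) ℚ)) * M.1 * (M⁻¹).1 := by
        rw [h, Matrix.one_mul]
    _ = _ := by
        rw [Matrix.mul_assoc, ← Units.val_mul, mul_inv_cancel, Units.val_one, Matrix.mul_one]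

variable {n} in
theorem IsSimilitude.inv {M : GL (Fin n ⊕ Fin n) ℚ} {μ : ℚ} (hμ : μ ≠ 0)
    (hM : IsSimilitude n M.1 μ) : IsSimilitude n (M⁻¹).1 μ⁻¹ := by
  have h1 : M.1 * (M⁻¹).1 = 1 := by rw [← Units.val_mul, mul_inv_cancel, Units.val_one]
  unfold IsSimilitude at *
  have h2 : J (Fin n) ℚ = μ⁻¹ • (M.1ᵀ * J (Fin n) ℚ * M.1) := by
    rw [hM, smul_smul, inv_mul_cancel₀ hμ, one_smul]
  calc (M⁻¹).1ᵀ * J (Fin n) ℚ * (M⁻¹).1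
      = (M⁻¹).1ᵀ * (μ⁻¹ • (M.1ᵀ * J (Fin n) ℚ * M.1)) * (M⁻¹).1 := by rw [← h2]
    _ = μ⁻¹ • ((M.1 * (M⁻¹).1)ᵀ * J (Fin n) ℚ * (M.1 * (M⁻¹).1)) := by
        rw [transpose_mul, Matrix.mul_smul, Matrix.smul_mul]
        simp only [Matrix.mul_assoc]
    _ = μ⁻¹ • J (Fin n) ℚ := by rw [h1]; simp

theorem J_entry_mem (R : Subring ℚ) (i j : Fin n ⊕ Fin n) : J (Fin n) ℚ i j ∈ R := by
  rcases i with i | i <;> rcases j with j | j <;>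
    simp only [J, fromBlocks_apply₁₁, fromBlocks_apply₁₂, fromBlocks_apply₂₁, fromBlocks_apply₂₂,
      Matrix.zero_apply, Matrix.neg_apply, Matrix.one_apply]
  · exact R.zero_mem
  · split_ifs
    · exact R.neg_mem R.one_mem
    · exact R.neg_mem R.zero_mem
  · split_ifs
    · exact R.one_mem
    · exact R.zero_mem
  · exact R.zero_mem

variable {n} in
theorem mul_entry_mem (R : Subring ℚ) {M N : Matrix (Fin n ⊕ Fin n) (Fin n ⊕ Fin n) ℚ}
    (hM : ∀ i j, M i j ∈ R) (hN : ∀ i j, N i j ∈ R) (i j : Fin n ⊕ Fin n) :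
    (M * N) i j ∈ R := by
  rw [Matrix.mul_apply]
  exact R.sum_mem fun k _ => R.mul_mem (hM i k) (hN k j)

variable {n} in
theorem inv_entry_mem (R : Subring ℚ) {M : GL (Fin n ⊕ Fin n) ℚ} {μ : ℚ} (hμ : μ ≠ 0)
    (hR : μ⁻¹ ∈ R) (hM : IsSimilitude n M.1 μ) (h : ∀ i j, M.1 i j ∈ R)
    (i j : Fin n ⊕ Fin n) : (M⁻¹).1 i j ∈ R := by
  rw [hM.inv_eq hμ, Matrix.smul_apply]
  refine R.mul_mem hR (mul_entry_mem R (mul_entry_mem R ?_ ?_) (J_entry_mem n R) i j)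
  · intro a b
    exact R.neg_mem (J_entry_mem n R a b)
  · intro a b
    exact h b a

/-- The `p`-part of the group of positive symplectic similitudes: the matrices `M` with entries
in `ℤ[1/p]` and `ᵗM J M = p ^ δ J` for some `δ ∈ ℤ`. -/
def simGroup [hp : Fact p.Prime] : Subgroup (GL (Fin n ⊕ Fin n) ℚ) where
  carrier := {M | (∀ i j, M.1 i j ∈ zInv p) ∧ ∃ δ : ℤ, IsSimilitude n M.1 ((p : ℚ) ^ δ)}
  mul_mem' := by
    rintro M N ⟨hM, δ, hδ⟩ ⟨hN, ε, hε⟩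
    have hp0 : (p : ℚ) ≠ 0 := by exact_mod_cast hp.out.ne_zero
    refine ⟨mul_entry_mem _ hM hN, δ + ε, ?_⟩
    rw [zpow_add₀ hp0]
    exact hδ.mul hε
  one_mem' := by
    refine ⟨?_, 0, ?_⟩
    · intro i j
      rw [Units.val_one, Matrix.one_apply]
      split_ifs
      · exact (zInv p).one_mem
      · exact (zInv p).zero_mem
    · simp [IsSimilitude]
  inv_mem' := by
    rintro M ⟨hM, δ, hδ⟩
    have hp0 : (p : ℚ) ≠ 0 := by exact_mod_cast hp.out.ne_zero
    have hμ : (p : ℚ) ^ δ ≠ 0 := zpow_ne_zero _ hp0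
    refine ⟨inv_entry_mem _ hμ ?_ hδ hM, -δ, ?_⟩
    · rw [← _root_.zpow_neg]
      exact zpow_mem_zInv p (-δ)
    · rw [_root_.zpow_neg]
      exact hδ.inv hμ

/-- The Siegel modular group `Γ = Sp_n(ℤ)`, as a subgroup of `simGroup n p`. -/
def siegel [hp : Fact p.Prime] : Subgroup (simGroup n p) where
  carrier := {M | ∃ N ∈ symplecticGroup (Fin n) ℤ, M.1.1 = N.map (Int.castRingHom ℚ)}
  mul_mem' := by
    rintro M M' ⟨N, hN, hM⟩ ⟨N', hN', hM'⟩
    refine ⟨N * N', mul_mem hN hN', ?_⟩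
    rw [Subgroup.coe_mul, Units.val_mul, hM, hM', Matrix.map_mul]
  one_mem' := ⟨1, one_mem _, by simp⟩
  inv_mem' := by
    rintro M ⟨N, hN, hM⟩
    refine ⟨((⟨N, hN⟩ : symplecticGroup (Fin n) ℤ)⁻¹ : symplecticGroup (Fin n) ℤ),
      Subtype.property _, ?_⟩
    have h : ((⟨N, hN⟩ : symplecticGroup (Fin n) ℤ)⁻¹ : symplecticGroup (Fin n) ℤ).1 * N = 1 :=
      congrArg Subtype.val (inv_mul_cancel (⟨N, hN⟩ : symplecticGroup (Fin n) ℤ))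
    have h' := congrArg (fun A => A.map (Int.castRingHom ℚ)) h
    simp only [Matrix.map_mul] at h'
    rw [← hM, Matrix.map_one _ (map_zero _) (map_one _)] at h'
    calc (M⁻¹).1.1 = 1 * (M.1⁻¹).1 := by rw [Matrix.one_mul]; rfl
      _ = _ := by
        rw [← h', Matrix.mul_assoc, ← Units.val_mul, mul_inv_cancel, Units.val_one, Matrix.mul_one]

theorem mem_siegel [hp : Fact p.Prime] (M : simGroup n p) (hint : ∀ i j, ∃ a : ℤ, M.1.1 i j = a)
    (hsim : IsSimilitude n M.1.1 1) : M ∈ siegel n p := by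
  choose N hN using hint
  have hM : M.1.1 = (Matrix.of N).map (Int.castRingHom ℚ) := by
    ext i j
    simp [hN]
  refine ⟨Matrix.of N, ?_, hM⟩
  rw [SymplecticGroup.mem_iff']
  unfold IsSimilitude at hsim
  rw [hM, one_smul, ← map_J (Fin n) (Int.castRingHom ℚ), ← transpose_map, ← Matrix.map_mul,
    ← Matrix.map_mul] at hsim
  exact Matrix.map_injective Int.cast_injective hsim

variable {n} in
theorem exists_common_denom {M : Matrix (Fin n ⊕ Fin n) (Fin n ⊕ Fin n) ℚ}
    (hM : ∀ i j, M i j ∈ zInv p) : ∃ K : ℕ, ∀ i j, ∃ a : ℤ, (p : ℚ) ^ K * M i j = a := by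
  choose k a hk using hM
  refine ⟨∑ i, ∑ j, k i j, fun i j => ?_⟩
  have h1 : k i j ≤ ∑ i, ∑ j, k i j :=
    (Finset.single_le_sum (f := fun j => k i j) (fun _ _ => Nat.zero_le _) (Finset.mem_univ j)).trans
      (Finset.single_le_sum (f := fun i => ∑ j, k i j) (fun _ _ => Nat.zero_le _)
        (Finset.mem_univ i))
  obtain ⟨m, hm⟩ := Nat.exists_eq_add_of_le h1
  refine ⟨p ^ m * a i j, ?_⟩
  rw [hm]
  push_cast
  rw [← hk]
  ring

/-- Each double coset of `Γ` is a finite union of cosets. -/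
theorem cosetsIn_finite [hp : Fact p.Prime] (M : simGroup n p) :
    (cosetsIn (siegel n p) M).Finite := by
  have hp0 : (p : ℚ) ≠ 0 := by exact_mod_cast hp.out.ne_zero
  obtain ⟨K, hK⟩ := exists_common_denom p M.2.1
  obtain ⟨L, hL⟩ := exists_common_denom p (M⁻¹).2.1
  obtain ⟨δ, hδ⟩ := M.2.2
  have hNZ : NeZero (p ^ (K + L)) := ⟨pow_ne_zero _ hp.out.ne_zero⟩
  choose N hN hγN using fun γ : siegel n p => γ.2
  let r : siegel n p → Matrix (Fin n ⊕ Fin n) (Fin n ⊕ Fin n) (ZMod (p ^ (K + L))) :=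
    fun γ => (N γ).map (Int.castRingHom _)
  have key : ∀ γ η : siegel n p, r γ = r η →
      coset (siegel n p) (M * γ) = coset (siegel n p) (M * η) := by
    intro γ η h
    have hdvd : ∀ i j, ∃ x : ℤ, N η i j - N γ i j = (p : ℤ) ^ (K + L) * x := by
      intro i j
      have h1 := congrFun (congrFun h i) j
      simp only [r, Matrix.map_apply, eq_intCast] at h1
      rw [ZMod.intCast_eq_intCast_iff_dvd_sub] at h1
      push_cast at h1
      exact h1
    choose X hX using hdvd
    rw [coset_eq_iff]
    have hone : ∀ g : simGroup n p, g.1.1 * (g⁻¹).1.1 = 1 := by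
      intro g
      have h1 := congrArg (fun g : simGroup n p => g.1.1) (mul_inv_cancel g)
      exact h1
    refine mem_siegel n p _ ?_ ?_
    · have hdiff : (η : simGroup n p).1.1 =
          (γ : simGroup n p).1.1 + (p : ℚ) ^ (K + L) • (Matrix.of X).map (Int.castRingHom ℚ) := by
        rw [hγN, hγN]
        ext i j
        have h1 := hX i j
        simp only [Matrix.map_apply, Matrix.add_apply, Matrix.smul_apply, Matrix.of_apply,
          eq_intCast, smul_eq_mul]
        have h2 : (N η i j : ℚ) - N γ i j = (p : ℚ) ^ (K + L) * X i j := by exact_mod_cast h1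
        linarith
      have hval : (M * (η : simGroup n p) * (M * (γ : simGroup n p))⁻¹).1.1 =
          1 + ((p : ℚ) ^ K • M.1.1) * (Matrix.of X).map (Int.castRingHom ℚ) *
            ((γ : simGroup n p)⁻¹).1.1 * ((p : ℚ) ^ L • (M⁻¹).1.1) := by
        have h3 : M * (η : simGroup n p) * (M * (γ : simGroup n p))⁻¹ =
            M * (η * (γ : simGroup n p)⁻¹) * M⁻¹ := by group
        rw [h3]
        change M.1.1 * ((η : simGroup n p).1.1 * ((γ : simGroup n p)⁻¹).1.1) * (M⁻¹).1.1 = _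
        rw [hdiff, Matrix.add_mul, hone, Matrix.mul_add, Matrix.add_mul, Matrix.mul_one, hone]
        simp only [Matrix.smul_mul, Matrix.mul_smul, smul_smul, pow_add, Matrix.mul_assoc]
        rw [mul_comm]
      rw [hval]
      let R := (Int.castRingHom ℚ).range
      obtain ⟨N', -, hN'⟩ := (γ⁻¹).2
      have h4 : ∀ i j, (((p : ℚ) ^ K • M.1.1) * (Matrix.of X).map (Int.castRingHom ℚ) *
            ((γ : simGroup n p)⁻¹).1.1 * ((p : ℚ) ^ L • (M⁻¹).1.1)) i j ∈ R := by
        refine mul_entry_mem R (mul_entry_mem R (mul_entry_mem R ?_ ?_) ?_) ?_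
        · exact fun i j => (hK i j).imp fun _ h => h.symm
        · exact fun i j => ⟨X i j, rfl⟩
        · intro i j
          have h5 : ((γ : simGroup n p)⁻¹).1.1 = N'.map (Int.castRingHom ℚ) := hN'
          rw [h5]
          exact ⟨N' i j, rfl⟩
        · exact fun i j => (hL i j).imp fun _ h => h.symm
      intro i j
      have h6 : (1 : Matrix (Fin n ⊕ Fin n) (Fin n ⊕ Fin n) ℚ) i j ∈ R := by
        rw [Matrix.one_apply]
        split_ifs
        · exact R.one_mem
        · exact R.zero_mem
      exact (R.add_mem h6 (h4 i j)).imp fun _ h => h.symm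
    · have hsim : ∀ γ : siegel n p, IsSimilitude n (γ : simGroup n p).1.1 1 := by
        intro γ
        have h1 := (SymplecticGroup.mem_iff').1 (hN γ)
        have h2 := congrArg (fun A => A.map (Int.castRingHom ℚ)) h1
        simp only [Matrix.map_mul, map_J] at h2
        unfold IsSimilitude
        rw [hγN, one_smul, ← transpose_map]
        exact h2
      have h1 := hδ.mul (hsim η)
      have h2 := IsSimilitude.inv (M := (M * (γ : simGroup n p)).1)
        (mul_ne_zero (zpow_ne_zero δ hp0) one_ne_zero) (hδ.mul (hsim γ))
      have h3 := h1.mul h2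
      rw [mul_inv_cancel₀ (mul_ne_zero (zpow_ne_zero δ hp0) one_ne_zero)] at h3
      exact h3
  refine (Set.finite_range fun x : Set.range r =>
    coset (siegel n p) (M * (x.2.choose : siegel n p))).subset ?_
  rintro _ ⟨γ, rfl⟩
  refine ⟨⟨r γ, γ, rfl⟩, ?_⟩
  exact key _ _ (Exists.choose_spec (⟨γ, rfl⟩ : ∃ η, r η = r γ))

/-- The local Hecke algebra at `p`, spanned by the double cosets `Γ M Γ` with `M` in
`simGroup n p`. -/
abbrev LocalHecke [Fact p.Prime] : Type := HeckeAlgebra (siegel n p)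

/-- The double coset `(M) = Γ M Γ`. -/
noncomputable def double [Fact p.Prime] (M : simGroup n p) : LocalHecke n p :=
  doubleCoset (siegel n p) M (cosetsIn_finite n p M)

/-- `diag(p ^ a₁, …, p ^ aₙ; p ^ (δ - a₁), …, p ^ (δ - aₙ))`. -/
noncomputable def diagElt [hp : Fact p.Prime] (δ : ℤ) (a : Fin n → ℤ) : simGroup n p :=
  have hp0 : (p : ℚ) ≠ 0 := by exact_mod_cast hp.out.ne_zero
  ⟨⟨diagonal (Sum.elim (fun j => (p : ℚ) ^ a j) (fun j => (p : ℚ) ^ (δ - a j))),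
    diagonal (Sum.elim (fun j => (p : ℚ) ^ (-a j)) (fun j => (p : ℚ) ^ (a j - δ))),
    by
      rw [diagonal_mul_diagonal, ← diagonal_one]
      congr 1
      funext i
      rcases i with i | i <;>
        simp only [Sum.elim_inl, Sum.elim_inr, ← zpow_add₀ hp0] <;> simp,
    by
      rw [diagonal_mul_diagonal, ← diagonal_one]
      congr 1
      funext i
      rcases i with i | i <;>
        simp only [Sum.elim_inl, Sum.elim_inr, ← zpow_add₀ hp0] <;> simp⟩,
   by
    refine ⟨?_, δ, ?_⟩
    · intro i j
      change (diagonal _ : Matrix (Fin n ⊕ Fin n) (Fin n ⊕ Fin n) ℚ) i j ∈ _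
      rw [diagonal_apply]
      split_ifs
      · rcases i with i | i
        · exact zpow_mem_zInv p _
        · exact zpow_mem_zInv p _
      · exact (zInv p).zero_mem
    · change IsSimilitude n (diagonal _) _
      unfold IsSimilitude
      ext i j
      rw [diagonal_transpose, mul_diagonal, diagonal_mul, Matrix.smul_apply, smul_eq_mul]
      rcases i with i | i <;> rcases j with j | j <;>
        simp only [J, fromBlocks_apply₁₁, fromBlocks_apply₁₂, fromBlocks_apply₂₁,
          fromBlocks_apply₂₂, Matrix.zero_apply, Matrix.neg_apply, Matrix.one_apply, Sum.elim_inl,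
          Sum.elim_inr, mul_zero, zero_mul]
      · split_ifs with h
        · subst h
          rw [mul_neg_one, neg_mul, ← zpow_add₀ hp0, mul_neg_one]
          congr 2
          ring
        · simp
      · split_ifs with h
        · subst h
          rw [mul_one, ← zpow_add₀ hp0, mul_one]
          congr 1
          ring
        · simp⟩

/-- `T(p) = (diag(1, …, 1; p, …, p))`. -/
noncomputable def heckeT [Fact p.Prime] : LocalHecke n p := double n p (diagElt n p 1 0)

/-- `T_i(p²) = (diag(1, …, 1, p, …, p; p², …, p², p, …, p))`, where `1` and `p²` occur `n - i`
times and `p` occurs `i` times in each half. -/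
noncomputable def heckeTi [Fact p.Prime] (i : ℕ) : LocalHecke n p :=
  double n p (diagElt n p 2 (fun j => if (j : ℕ) + i < n then 0 else 1))

/-- `[p]_n = (p E_{2n})`. -/
noncomputable def bracket [Fact p.Prime] : LocalHecke n p :=
  double n p (diagElt n p 2 (fun _ => 1))

/-- The integral Hecke ring `ℤ[T(p), T_1(p²), …, T_n(p²)]`. -/
noncomputable def integralHecke [Fact p.Prime] : Subring (LocalHecke n p) :=
  Subring.closure ({heckeT n p} ∪ {t | ∃ i, 1 ≤ i ∧ i ≤ n ∧ t = heckeTi n p i})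

/-! ## The spherical map -/

/-- The ring `ℚ[x₀^{±1}, …, xₙ^{±1}]` of Laurent polynomials. -/
abbrev Laurent : Type := AddMonoidAlgebra ℚ (Fin (n + 1) → ℤ)

/-- The variable `xᵢ`. -/
noncomputable def x (i : Fin (n + 1)) : Laurent n := AddMonoidAlgebra.single (Pi.single i 1) 1

/-- `M = (A B; 0 D)` with `ᵗM J M = p ^ δ J` and `D` upper triangular with diagonal
`(p ^ d₁, …, p ^ dₙ)`. -/
def IsTriangular [Fact p.Prime] (M : simGroup n p) (δ : ℤ) (d : Fin n → ℤ) : Prop :=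
  IsSimilitude n M.1.1 ((p : ℚ) ^ δ) ∧
  (∀ i j : Fin n, M.1.1 (Sum.inr i) (Sum.inl j) = 0) ∧
  (∀ i j : Fin n, j < i → M.1.1 (Sum.inr i) (Sum.inr j) = 0) ∧
  (∀ i : Fin n, M.1.1 (Sum.inr i) (Sum.inr i) = (p : ℚ) ^ d i)

open Classical in
/-- The spherical image `x₀ ^ δ ∏ᵢ (xᵢ p ^ (-i)) ^ dᵢ` of a coset `Γ M` with triangular
representative `M` as in `IsTriangular`. (Every coset has such a representative, and `δ`, `d` do
not depend on it, so the default value is never taken.) -/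
noncomputable def cosetMonomial [Fact p.Prime] (c : Cosets (siegel n p)) : Laurent n :=
  if h : ∃ w : ℤ × (Fin n → ℤ), ∃ M : simGroup n p,
      coset (siegel n p) M = c ∧ IsTriangular n p M w.1 w.2 then
    AddMonoidAlgebra.single (Fin.cons h.choose.1 h.choose.2)
      (∏ i : Fin n, ((p : ℚ) ^ (-((i : ℤ) + 1))) ^ h.choose.2 i)
  else 0

/-- The spherical map `Ω`. -/
noncomputable def Omega [Fact p.Prime] : LocalHecke n p →ₗ[ℚ] Laurent n :=
  Finsupp.linearCombination ℚ (cosetMonomial n p) ∘ₗ toCosets (siegel n p)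

/-- The spinor polynomial `∏ (1 - x₀ x_{i₁} ⋯ x_{iₖ} v)`, over all `1 ≤ i₁ < ⋯ < iₖ ≤ n`,
`0 ≤ k ≤ n`. -/
noncomputable def spinor : (Laurent n)[X] :=
  ∏ I : Finset (Fin n), (1 - C (x n 0 * ∏ i ∈ I, x n i.succ) * X)

end Symplectic

end SpHecke

/-! The spherical map is an injective ring homomorphism (`Omega_mul`, `Omega_injective`).
Uniqueness, the formula and the degree are therefore questions about Laurent polynomials: it
suffices to compute the images of the four generators and to check one polynomial identity
(`spinor_identity`). Integrality is visible from the shape of the coefficients.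

Multiplicativity rests on triangular representatives: every coset has one, its diagonal exponents
are unique, and right translation by a triangular matrix multiplies every monomial by a fixed
monomial.

The rest is geometry over `ZMod (p ^ δ)`. An integral similitude with multiplier `p ^ δ` is
determined modulo `Γ` by its row lattice, and that lattice by its reduction, which is a Lagrangian
in the symplectic module of rank 6 (`IsIntCoset.eq_of_lagCoset_eq`). Right multiplication by `Γ`
acts on these Lagrangians, and every transvection comes from `Γ`. The module is built by adding
hyperbolic planes one at a time. A Lagrangian `L` of such an extension of `V` has an exponent
`lastExp L` and a symplectic reduction `red L`, a Lagrangian of `V`. Iterating gives exactly the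
diagonal exponents of the triangular representative (`IsIntSim.lastExp_lag`), so the spherical image
is a generating function of Lagrangians by type.

Injectivity (`Separates.hyp`): an invariant function whose sums over all types vanish is zero. Let
`k` be the exponent of `L`. If `L` is not divisible by `p ^ k`, transvections lower its exponent,
and the function vanishes there by induction. Otherwise `L` is the sum of its reduction and a fixed
piece of the plane, and induction on the number of planes applies. Non-integral elements are first
multiplied by a power of `[p]`, which is invertible as a translation.

Images: modulo `p` all Lagrangians form one orbit, which is `T(p)`. Modulo `p ^ 2` the orbits are
classified by the rank `r`, where `p L` has `p ^ r` elements, and `T_i(p ^ 2)` is the orbit of rank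
`3 - i`. Lagrangians over a given reduction are counted through their generators (`card_over_mul`).
Following the rank through this count (`IsSymplecticModPSq.sum_over`) gives a recursion that is run
three times. -/

namespace SpHecke

set_option linter.unusedSectionVars false

/-! ## Arithmetic in `ZMod (p ^ δ)` -/

section ZModPow

variable {p δ : ℕ} [hp : Fact p.Prime]

instance neZero_pow : NeZero (p ^ δ) := ⟨pow_ne_zero _ hp.out.ne_zero⟩

theorem natCast_pow_self : (p : ZMod (p ^ δ)) ^ δ = 0 := by
  have h := ZMod.natCast_self (p ^ δ)
  push_cast at h
  exact h

/-- Removing the exact power of `p` from a representative leaves a factor prime to `p`, hence a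
unit. This chain ring structure is behind all the divisibility arguments over `ZMod (p ^ δ)`. -/
theorem eq_unit_mul_pow (b : ZMod (p ^ δ)) :
    ∃ j ≤ δ, ∃ u : (ZMod (p ^ δ))ˣ, b = u * (p : ZMod (p ^ δ)) ^ j := by
  by_cases hb : b = 0
  · exact ⟨δ, le_rfl, 1, by rw [hb, natCast_pow_self, mul_zero]⟩
  have hn : b.val ≠ 0 := by rwa [Ne, ZMod.val_eq_zero]
  obtain ⟨j, m, hm, hbj⟩ := Nat.exists_eq_pow_mul_and_not_dvd hn p hp.out.ne_one
  have hj : j ≤ δ := by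
    by_contra h
    have h1 : p ^ δ ∣ b.val := hbj ▸ Dvd.dvd.mul_right (pow_dvd_pow p (by omega)) m
    exact absurd (Nat.le_of_dvd (Nat.pos_of_ne_zero hn) h1) (by simpa using ZMod.val_lt b)
  have hc : Nat.Coprime m (p ^ δ) := ((Nat.Prime.coprime_iff_not_dvd hp.out).2 hm).symm.pow_right δ
  refine ⟨j, hj, ZMod.unitOfCoprime m hc, ?_⟩
  rw [ZMod.coe_unitOfCoprime, ← ZMod.natCast_zmod_val b, hbj]
  push_cast
  ring

theorem pow_eq_zero_iff_le {j : ℕ} : (p : ZMod (p ^ δ)) ^ j = 0 ↔ δ ≤ j := by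
  have h := ZMod.natCast_eq_zero_iff (p ^ j) (p ^ δ)
  push_cast at h
  rw [h, Nat.pow_dvd_pow_iff_le_right hp.out.one_lt]

theorem pow_dvd_pow_iff_le {i j : ℕ} (hi : i ≤ δ) :
    (p : ZMod (p ^ δ)) ^ i ∣ (p : ZMod (p ^ δ)) ^ j ↔ i ≤ j := by
  refine ⟨?_, pow_dvd_pow _⟩
  rintro ⟨c, hc⟩
  have h : (p : ZMod (p ^ δ)) ^ (δ - i + j) = 0 := by
    rw [pow_add, hc, ← mul_assoc, ← pow_add, Nat.sub_add_cancel hi, natCast_pow_self, zero_mul]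
  have := pow_eq_zero_iff_le.1 h
  omega

/-- Annihilators of powers of `p` turn orthogonality in a hyperbolic plane into divisibility. This
is why the exponents `d` and `δ - d` always occur together. -/
theorem pow_mul_eq_zero_iff {j : ℕ} (hj : j ≤ δ) (b : ZMod (p ^ δ)) :
    (p : ZMod (p ^ δ)) ^ j * b = 0 ↔ (p : ZMod (p ^ δ)) ^ (δ - j) ∣ b := by
  constructor
  · intro h
    obtain ⟨i, hi, u, rfl⟩ := eq_unit_mul_pow b
    have h1 : (p : ZMod (p ^ δ)) ^ (j + i) = 0 := by
      rw [pow_add, ← Units.mul_right_eq_zero u, ← h]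
      ring
    have := pow_eq_zero_iff_le.1 h1
    exact Dvd.dvd.mul_left (pow_dvd_pow _ (by omega)) _
  · rintro ⟨c, rfl⟩
    rw [← mul_assoc, ← pow_add, Nat.add_sub_cancel' hj, natCast_pow_self, zero_mul]

theorem isUnit_of_not_dvd {b : ZMod (p ^ δ)} (hb : ¬ (p : ZMod (p ^ δ)) ∣ b) : IsUnit b := by
  obtain ⟨j, -, u, rfl⟩ := eq_unit_mul_pow b
  rcases Nat.eq_zero_or_pos j with rfl | hj
  · simp
  · exact absurd (Dvd.dvd.mul_left (dvd_pow_self _ hj.ne') _) hb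

theorem isUnit_add_of_dvd {a b : ZMod (p ^ δ)} (ha : IsUnit a) (hb : (p : ZMod (p ^ δ)) ∣ b) :
    IsUnit (a + b) := by
  by_contra h
  have h1 : (p : ZMod (p ^ δ)) ∣ a + b := by
    by_contra h2
    exact h (isUnit_of_not_dvd h2)
  have h3 : (p : ZMod (p ^ δ)) ∣ a := (dvd_add_left hb).1 h1
  -- A unit that is nilpotent forces the zero ring, in which everything is a unit; this is the case
  -- `δ = 0`.
  have h4 : IsUnit (p : ZMod (p ^ δ)) := isUnit_of_dvd_unit h3 ha
  have h5 := h4.pow δ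
  rw [natCast_pow_self, isUnit_zero_iff] at h5
  have : Subsingleton (ZMod (p ^ δ)) := subsingleton_of_zero_eq_one h5
  exact h (isUnit_of_subsingleton _)

/-- Each ideal of `ZMod (p ^ δ)` is generated by a power of `p`. -/
theorem exists_pow_generator (I : Ideal (ZMod (p ^ δ))) :
    ∃ j ≤ δ, ∀ b, b ∈ I ↔ (p : ZMod (p ^ δ)) ^ j ∣ b := by
  classical
  have hex : ∃ j, (p : ZMod (p ^ δ)) ^ j ∈ I := ⟨δ, by rw [natCast_pow_self]; exact I.zero_mem⟩
  refine ⟨Nat.find hex, Nat.find_min' hex (by rw [natCast_pow_self]; exact I.zero_mem), ?_⟩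
  intro b
  constructor
  · intro hb
    obtain ⟨i, -, u, rfl⟩ := eq_unit_mul_pow b
    have hi : (p : ZMod (p ^ δ)) ^ i ∈ I := by
      have := I.mul_mem_left (↑u⁻¹) hb
      simpa using this
    exact Dvd.dvd.mul_left (pow_dvd_pow _ (Nat.find_min' hex hi)) _
  · rintro ⟨c, rfl⟩
    exact I.mul_mem_right _ (Nat.find_spec hex)

end ZModPow

/-! ## Lagrangian submodules and transvections -/

section Lagrangian

variable {R V : Type*} [CommRing R] [AddCommGroup V] [Module R V]

/-- A submodule equal to its own orthogonal complement. -/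
def IsLagrangian (ω : LinearMap.BilinForm R V) (L : Submodule R V) : Prop :=
  ∀ v, v ∈ L ↔ ∀ l ∈ L, ω v l = 0

theorem IsLagrangian.apply_eq_zero {ω : LinearMap.BilinForm R V} {L : Submodule R V}
    (hL : IsLagrangian ω L) {v w : V} (hv : v ∈ L) (hw : w ∈ L) : ω v w = 0 := (hL v).1 hv w hw

/-- Orthogonal complements reverse inclusions. Many equalities of Lagrangians are obtained from one
inclusion in this way. -/
theorem IsLagrangian.eq_of_le {ω : LinearMap.BilinForm R V} {L L' : Submodule R V}
    (hL : IsLagrangian ω L) (hL' : IsLagrangian ω L') (h : L ≤ L') : L = L' :=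
  le_antisymm h fun v hv => (hL v).2 fun _ hl => hL'.apply_eq_zero hv (h hl)

/-- The transvection `x ↦ x + c ω(x, w) w`. -/
def transv (ω : LinearMap.BilinForm R V) (w : V) (c : R) : V →ₗ[R] V :=
  LinearMap.id + (c • ω.flip w).smulRight w

theorem transv_apply (ω : LinearMap.BilinForm R V) (w : V) (c : R) (x : V) :
    transv ω w c x = x + (c * ω x w) • w := rfl

theorem transv_transv_neg {ω : LinearMap.BilinForm R V} (hω : ω.IsAlt) (w : V) (c : R) (x : V) :
    transv ω w (-c) (transv ω w c x) = x := by
  simp only [transv_apply, map_add, map_smul, hω w]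
  module

theorem transv_isometry {ω : LinearMap.BilinForm R V} (hω : ω.IsAlt) (w : V) (c : R) (x y : V) :
    ω (transv ω w c x) (transv ω w c y) = ω x y := by
  have h : ω w y = - ω y w := (hω.neg_eq w y).symm ▸ by simp
  simp only [transv_apply, map_add, map_smul, LinearMap.add_apply, LinearMap.smul_apply,
    hω w, smul_eq_mul, h]
  ring

theorem mem_map_transv {ω : LinearMap.BilinForm R V} (hω : ω.IsAlt) (w : V) (c : R)
    (L : Submodule R V) (x : V) : x ∈ L.map (transv ω w c) ↔ transv ω w (-c) x ∈ L := by
  constructor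
  · rintro ⟨y, hy, rfl⟩
    rwa [transv_transv_neg hω]
  · intro h
    refine ⟨_, h, ?_⟩
    have := transv_transv_neg hω w (-c) x
    rwa [neg_neg] at this

theorem IsLagrangian.map_transv {ω : LinearMap.BilinForm R V} (hω : ω.IsAlt) {L : Submodule R V}
    (hL : IsLagrangian ω L) (w : V) (c : R) : IsLagrangian ω (L.map (transv ω w c)) := by
  intro v
  rw [mem_map_transv hω, hL]
  constructor
  · rintro h _ ⟨l, hl, rfl⟩
    rw [← transv_isometry hω w (-c), transv_transv_neg hω]
    exact h l hl
  · intro h l hl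
    have h1 := h _ ⟨l, hl, rfl⟩
    rwa [← transv_isometry hω w (-c), transv_transv_neg hω] at h1

/-- Two submodules are related if a product of transvections carries one to the other. -/
def TransvRel (ω : LinearMap.BilinForm R V) : Submodule R V → Submodule R V → Prop :=
  Relation.ReflTransGen fun L L' => ∃ w c, L' = L.map (transv ω w c)

theorem TransvRel.single (ω : LinearMap.BilinForm R V) (L : Submodule R V) (w : V) (c : R) :
    TransvRel ω L (L.map (transv ω w c)) := Relation.ReflTransGen.single ⟨w, c, rfl⟩

theorem TransvRel.symm {ω : LinearMap.BilinForm R V} (hω : ω.IsAlt) {L L' : Submodule R V}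
    (h : TransvRel ω L L') : TransvRel ω L' L := by
  induction h with
  | refl => exact Relation.ReflTransGen.refl
  | tail _ h ih =>
    obtain ⟨w, c, rfl⟩ := h
    refine Relation.ReflTransGen.trans (Relation.ReflTransGen.single ⟨w, -c, ?_⟩) ih
    ext x
    rw [mem_map_transv hω, mem_map_transv hω, neg_neg, transv_transv_neg hω]

theorem TransvRel.isLagrangian {ω : LinearMap.BilinForm R V} (hω : ω.IsAlt) {L L' : Submodule R V}
    (h : TransvRel ω L L') (hL : IsLagrangian ω L) : IsLagrangian ω L' := by
  induction h with
  | refl => exact hL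
  | tail _ h ih =>
    obtain ⟨w, c, rfl⟩ := h
    exact ih.map_transv hω w c

/-- Two vectors whose pairing is a unit are exchanged by a transvection. -/
theorem exists_transv_eq {ω : LinearMap.BilinForm R V} (hω : ω.IsAlt) {x y : V}
    (h : IsUnit (ω x y)) : ∃ w c, transv ω w c x = y := by
  obtain ⟨u, hu⟩ := h
  -- Since `ω x x = 0`, the pairing of `x` with `y - x` is `ω x y`, so the inverse of this unit as
  -- coefficient adds exactly `y - x`.
  refine ⟨y - x, ↑u⁻¹, ?_⟩
  rw [transv_apply, map_sub, hω x, sub_zero, ← hu, Units.inv_mul, one_smul, add_sub_cancel]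

end Lagrangian

/-! ## Hyperbolic extensions -/

section Hyperbolic

variable {R V : Type*} [CommRing R] [AddCommGroup V] [Module R V]

/-- The orthogonal sum of `(V, ω)` and a hyperbolic plane. -/
def hyp (ω : LinearMap.BilinForm R V) : LinearMap.BilinForm R (R × V × R) :=
  LinearMap.mk₂ R (fun x y => ω x.2.1 y.2.1 + (x.2.2 * y.1 - x.1 * y.2.2))
    (fun x x' y => by simp; ring) (fun c x y => by simp; ring)
    (fun x y y' => by simp; ring) (fun c x y => by simp; ring)

theorem hyp_apply (ω : LinearMap.BilinForm R V) (x y : R × V × R) :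
    hyp ω x y = ω x.2.1 y.2.1 + (x.2.2 * y.1 - x.1 * y.2.2) := rfl

theorem hyp_isAlt {ω : LinearMap.BilinForm R V} (hω : ω.IsAlt) : (hyp ω).IsAlt := by
  intro x
  rw [hyp_apply, hω]
  ring

/-- The vectors `v` with `(0, v, c) ∈ L` for some `c`. -/
def red (L : Submodule R (R × V × R)) : Submodule R V where
  carrier := {v | ∃ c, ((0 : R), v, c) ∈ L}
  add_mem' := by
    rintro v w ⟨c, hc⟩ ⟨d, hd⟩
    exact ⟨c + d, by simpa using L.add_mem hc hd⟩
  zero_mem' := ⟨0, L.zero_mem⟩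
  smul_mem' := by
    rintro a v ⟨c, hc⟩
    exact ⟨a * c, by simpa using L.smul_mem a hc⟩

/-- The orthogonal sum of `L` and `a R ⊕ b R` in the hyperbolic plane. -/
def splitSum (a b : R) (L : Submodule R V) : Submodule R (R × V × R) where
  carrier := {x | a ∣ x.1 ∧ x.2.1 ∈ L ∧ b ∣ x.2.2}
  add_mem' := fun h h' => ⟨dvd_add h.1 h'.1, L.add_mem h.2.1 h'.2.1, dvd_add h.2.2 h'.2.2⟩
  zero_mem' := ⟨dvd_zero _, L.zero_mem, dvd_zero _⟩
  smul_mem' := fun c _ h =>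
    ⟨Dvd.dvd.mul_left h.1 c, L.smul_mem c h.2.1, Dvd.dvd.mul_left h.2.2 c⟩

theorem mem_splitSum {a b : R} {L : Submodule R V} {x : R × V × R} :
    x ∈ splitSum a b L ↔ a ∣ x.1 ∧ x.2.1 ∈ L ∧ b ∣ x.2.2 := Iff.rfl

theorem red_splitSum (a b : R) (L : Submodule R V) : red (splitSum a b L) = L := by
  ext v
  exact ⟨fun ⟨_, h⟩ => h.2.1, fun h => ⟨0, dvd_zero _, h, dvd_zero _⟩⟩

/-- A transvection along `(0, w, 0)` acts on the middle factor only and fixes the hyperbolic plane.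
-/
theorem map_splitSum_transv {ω : LinearMap.BilinForm R V} (hω : ω.IsAlt) (a b : R)
    (L : Submodule R V) (w : V) (c : R) :
    splitSum a b (L.map (transv ω w c)) =
      (splitSum a b L).map (transv (hyp ω) ((0 : R), w, (0 : R)) c) := by
  ext x
  rw [mem_map_transv (hyp_isAlt hω), mem_splitSum, mem_splitSum, mem_map_transv hω]
  simp [transv_apply, hyp_apply]

theorem TransvRel.splitSum {ω : LinearMap.BilinForm R V} (hω : ω.IsAlt) (a b : R)
    {L L' : Submodule R V} (h : TransvRel ω L L') :
    TransvRel (hyp ω) (splitSum a b L) (splitSum a b L') := by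
  induction h with
  | refl => exact Relation.ReflTransGen.refl
  | tail _ h ih =>
    obtain ⟨w, c, rfl⟩ := h
    exact ih.tail ⟨_, c, map_splitSum_transv hω a b _ w c⟩

end Hyperbolic

/-! ## Lagrangians over `ZMod (p ^ δ)` -/

section LocalLagrangian

variable {p δ : ℕ} [hp : Fact p.Prime] {V : Type*} [AddCommGroup V] [Module (ZMod (p ^ δ)) V]

/-- Each vector outside `p V` pairs to a unit with some vector. -/
def IsPerfect (ω : LinearMap.BilinForm (ZMod (p ^ δ)) V) : Prop :=
  ∀ x, (¬ ∃ y, x = (p : ZMod (p ^ δ)) • y) → ∃ z, IsUnit (ω x z)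

theorem IsPerfect.hyp {ω : LinearMap.BilinForm (ZMod (p ^ δ)) V} (h : IsPerfect ω) :
    IsPerfect (hyp ω) := by
  rintro ⟨a, v, b⟩ hx
  by_cases ha : (p : ZMod (p ^ δ)) ∣ a
  · by_cases hb : (p : ZMod (p ^ δ)) ∣ b
    · obtain ⟨z, hz⟩ := h v (by
        rintro ⟨w, rfl⟩
        obtain ⟨a, rfl⟩ := ha
        obtain ⟨b, rfl⟩ := hb
        exact hx ⟨(a, w, b), rfl⟩)
      exact ⟨(0, z, 0), by simpa [hyp_apply] using hz⟩
    · exact ⟨(1, 0, 0), by simpa [hyp_apply] using isUnit_of_not_dvd hb⟩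
  · exact ⟨(0, 0, 1), by simpa [hyp_apply] using isUnit_of_not_dvd ha⟩

/-- Products of transvections act transitively on the vectors outside `p V`. -/
theorem exists_transvRel_mem {ω : LinearMap.BilinForm (ZMod (p ^ δ)) V} (hω : ω.IsAlt)
    {x y : V} (hx : ∃ z, IsUnit (ω x z)) (hy : ∃ z, IsUnit (ω y z)) (a : ZMod (p ^ δ))
    {L : Submodule (ZMod (p ^ δ)) V} (hL : a • x ∈ L) : ∃ L', TransvRel ω L L' ∧ a • y ∈ L' := by
  -- A vector `z` pairing to units with both `x` and `y` allows the passage from `x` to `z` to `y`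
  -- by two transvections. If the given partners of `x` and of `y` both fail, their sum works: each
  -- pairing is then a unit plus a multiple of `p`.
  have hz : ∃ z, IsUnit (ω x z) ∧ IsUnit (ω z y) := by
    have hneg : ∀ z, ω z y = - ω y z := fun z => (hω.neg_eq y z).symm
    obtain ⟨z₁, h₁⟩ := hx
    obtain ⟨z₂, h₂⟩ := hy
    have h₂' : IsUnit (ω z₂ y) := by rw [hneg]; exact h₂.neg
    by_cases h₃ : IsUnit (ω z₁ y)
    · exact ⟨z₁, h₁, h₃⟩
    by_cases h₄ : IsUnit (ω x z₂)
    · exact ⟨z₂, h₄, h₂'⟩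
    refine ⟨z₁ + z₂, ?_, ?_⟩
    · rw [map_add]
      exact isUnit_add_of_dvd h₁ (by_contra fun h => h₄ (isUnit_of_not_dvd h))
    · rw [map_add, LinearMap.add_apply, add_comm]
      exact isUnit_add_of_dvd h₂' (by_contra fun h => h₃ (isUnit_of_not_dvd h))
  obtain ⟨z, h₁, h₂⟩ := hz
  obtain ⟨w₁, c₁, e₁⟩ := exists_transv_eq hω h₁
  obtain ⟨w₂, c₂, e₂⟩ := exists_transv_eq hω h₂
  refine ⟨(L.map (transv ω w₁ c₁)).map (transv ω w₂ c₂),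
    (TransvRel.single ω L w₁ c₁).trans (TransvRel.single ω _ w₂ c₂), ?_⟩
  refine ⟨a • z, ⟨a • x, hL, ?_⟩, ?_⟩
  · rw [map_smul, e₁]
  · rw [map_smul, e₂]

/-- The least `k` with `(0, 0, p ^ k) ∈ L`. -/
noncomputable def lastExp (L : Submodule (ZMod (p ^ δ)) (ZMod (p ^ δ) × V × ZMod (p ^ δ))) : ℕ :=
  sInf {k | ((0 : ZMod (p ^ δ)), (0 : V), (p : ZMod (p ^ δ)) ^ k) ∈ L}

variable {L : Submodule (ZMod (p ^ δ)) (ZMod (p ^ δ) × V × ZMod (p ^ δ))}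

theorem lastExp_spec (L : Submodule (ZMod (p ^ δ)) (ZMod (p ^ δ) × V × ZMod (p ^ δ))) :
    ((0 : ZMod (p ^ δ)), (0 : V), (p : ZMod (p ^ δ)) ^ lastExp L) ∈ L :=
  Nat.sInf_mem (s := {k | ((0 : ZMod (p ^ δ)), (0 : V), (p : ZMod (p ^ δ)) ^ k) ∈ L})
    -- Since `p ^ δ = 0`, the exponent `δ` is admissible, so the infimum is attained and is not a
    -- default value.
    ⟨δ, by simp only [Set.mem_ofPred_eq, natCast_pow_self]; exact L.zero_mem⟩

theorem lastExp_le_of_mem {k : ℕ}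
    (h : ((0 : ZMod (p ^ δ)), (0 : V), (p : ZMod (p ^ δ)) ^ k) ∈ L) : lastExp L ≤ k :=
  Nat.sInf_le h

theorem lastExp_le (L : Submodule (ZMod (p ^ δ)) (ZMod (p ^ δ) × V × ZMod (p ^ δ))) :
    lastExp L ≤ δ :=
  lastExp_le_of_mem (by rw [natCast_pow_self]; exact L.zero_mem)

theorem lastExp_eq {d : ℕ} (hd : d ≤ δ)
    (h : ∀ b, ((0 : ZMod (p ^ δ)), (0 : V), b) ∈ L ↔ (p : ZMod (p ^ δ)) ^ d ∣ b) :
    lastExp L = d := by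
  refine le_antisymm (lastExp_le_of_mem ((h _).2 dvd_rfl)) ?_
  exact (pow_dvd_pow_iff_le hd).1 ((h _).1 (lastExp_spec L))

theorem mem_iff_lastExp (L : Submodule (ZMod (p ^ δ)) (ZMod (p ^ δ) × V × ZMod (p ^ δ)))
    (b : ZMod (p ^ δ)) :
    ((0 : ZMod (p ^ δ)), (0 : V), b) ∈ L ↔ (p : ZMod (p ^ δ)) ^ lastExp L ∣ b := by
  obtain ⟨j, hj, h⟩ := exists_pow_generator (p := p) (δ := δ)
    (L.comap ((LinearMap.inr _ (ZMod (p ^ δ)) (V × ZMod (p ^ δ))).comp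
      (LinearMap.inr _ V (ZMod (p ^ δ)))))
  have hmem : ∀ b, ((0 : ZMod (p ^ δ)), (0 : V), b) ∈ L ↔ (p : ZMod (p ^ δ)) ^ j ∣ b := h
  rw [lastExp_eq hj hmem, hmem]

/-- A Lagrangian `L` contains some `(p ^ (δ - d), u, b)`, `d = lastExp L`, and `p ^ (δ - d)`
divides the first coordinates of its elements. -/
theorem exists_generator {ω : LinearMap.BilinForm (ZMod (p ^ δ)) V}
    (hL : IsLagrangian (hyp ω) L) :
    (∃ u b, ((p : ZMod (p ^ δ)) ^ (δ - lastExp L), u, b) ∈ L) ∧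
      ∀ x ∈ L, (p : ZMod (p ^ δ)) ^ (δ - lastExp L) ∣ x.1 := by
  obtain ⟨j, hj, h⟩ := exists_pow_generator (p := p) (δ := δ)
    (L.map (LinearMap.fst (ZMod (p ^ δ)) (ZMod (p ^ δ)) (V × ZMod (p ^ δ))))
  have hdvd : ∀ x ∈ L, (p : ZMod (p ^ δ)) ^ j ∣ x.1 := fun x hx => (h _).1 ⟨x, hx, rfl⟩
  obtain ⟨⟨a, u, b⟩, hg, ha⟩ := (h _).2 (dvd_refl ((p : ZMod (p ^ δ)) ^ j))
  obtain rfl : a = (p : ZMod (p ^ δ)) ^ j := ha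
  -- The form pairs the last coordinate with the first, and the first coordinates of `L` form the
  -- ideal of `p ^ j`. So `(0, 0, b')` is orthogonal to `L` exactly when `p ^ j` kills `b'`.
  have hd : lastExp L = δ - j := by
    refine lastExp_eq (Nat.sub_le _ _) fun b' => ?_
    rw [hL, ← pow_mul_eq_zero_iff hj]
    constructor
    · intro h1
      have := h1 _ hg
      simpa [hyp_apply, mul_comm] using this
    · rintro h1 ⟨a, v, c⟩ hx
      obtain ⟨s, rfl⟩ := hdvd _ hx
      simp only [hyp_apply, map_zero, LinearMap.zero_apply, zero_mul, zero_add, sub_zero]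
      rw [mul_left_comm, ← mul_assoc, h1, zero_mul]
  rw [hd, Nat.sub_sub_self hj]
  exact ⟨⟨u, b, hg⟩, hdvd⟩

/-- This is symplectic reduction. For `v` orthogonal to the reduction, a last coordinate must be
found that makes the lift orthogonal to one generator `(p ^ j, u, b)`, i.e. `p ^ j` must divide `ω v
u`. It does, because `p ^ (δ - j) • u` lies in the reduction and so pairs to zero with `v`. -/
theorem IsLagrangian.red {ω : LinearMap.BilinForm (ZMod (p ^ δ)) V}
    (hL : IsLagrangian (hyp ω) L) : IsLagrangian ω (red L) := by
  intro v
  constructor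
  · rintro ⟨c, hc⟩ l ⟨e, he⟩
    have := hL.apply_eq_zero hc he
    simpa [hyp_apply] using this
  · intro h
    obtain ⟨⟨u, b, hg⟩, hdvd⟩ := exists_generator hL
    set j := δ - lastExp L with hj
    have hjδ : j ≤ δ := Nat.sub_le _ _
    have h1 : (p : ZMod (p ^ δ)) ^ j ∣ ω v u := by
      have h2 := (pow_mul_eq_zero_iff (Nat.sub_le δ j) (ω v u)).1 (by
        have h3 := h ((p : ZMod (p ^ δ)) ^ (δ - j) • u) ⟨(p : ZMod (p ^ δ)) ^ (δ - j) * b, by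
          have h4 := L.smul_mem ((p : ZMod (p ^ δ)) ^ (δ - j)) hg
          simpa [← pow_add, Nat.sub_add_cancel hjδ, natCast_pow_self] using h4⟩
        rwa [map_smul, smul_eq_mul] at h3)
      rwa [Nat.sub_sub_self hjδ] at h2
    obtain ⟨c, hc⟩ := h1
    refine ⟨-c, (hL _).2 ?_⟩
    rintro ⟨a, l, e⟩ hx
    obtain ⟨s, hs⟩ := hdvd _ hx
    simp only at hs
    subst hs
    have h2 : ((0 : ZMod (p ^ δ)), l - s • u, e - s * b) ∈ L := by
      have h3 := L.sub_mem hx (L.smul_mem s hg)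
      simpa [mul_comm] using h3
    have h4 := h _ ⟨_, h2⟩
    rw [map_sub, map_smul, smul_eq_mul, hc] at h4
    simp only [hyp_apply, zero_mul, sub_zero]
    linear_combination h4

theorem splitSum_isLagrangian {ω : LinearMap.BilinForm (ZMod (p ^ δ)) V}
    {L : Submodule (ZMod (p ^ δ)) V} (hL : IsLagrangian ω L) {k : ℕ} (hk : k ≤ δ) :
    IsLagrangian (hyp ω)
      (splitSum ((p : ZMod (p ^ δ)) ^ (δ - k)) ((p : ZMod (p ^ δ)) ^ k) L) := by
  have hz : (p : ZMod (p ^ δ)) ^ (δ - k) * (p : ZMod (p ^ δ)) ^ k = 0 := by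
    rw [← pow_add, Nat.sub_add_cancel hk, natCast_pow_self]
  intro x
  constructor
  · rintro ⟨⟨a, ha⟩, hv, ⟨b, hb⟩⟩ y ⟨⟨a', ha'⟩, hv', ⟨b', hb'⟩⟩
    rw [hyp_apply, hL.apply_eq_zero hv hv', ha, hb, ha', hb']
    linear_combination (b * a' - a * b') * hz
  · intro h
    refine ⟨?_, (hL _).2 fun l hl => ?_, ?_⟩
    · have h1 := h (0, 0, (p : ZMod (p ^ δ)) ^ k) ⟨dvd_zero _, L.zero_mem, dvd_rfl⟩
      rw [← pow_mul_eq_zero_iff hk]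
      simpa [hyp_apply, mul_comm] using h1
    · simpa [hyp_apply] using h (0, l, 0) ⟨dvd_zero _, hl, dvd_zero _⟩
    · have h1 := h ((p : ZMod (p ^ δ)) ^ (δ - k), 0, 0) ⟨dvd_rfl, L.zero_mem, dvd_zero _⟩
      rw [← Nat.sub_sub_self hk, ← pow_mul_eq_zero_iff (Nat.sub_le _ _)]
      simpa [hyp_apply, mul_comm] using h1

theorem lastExp_splitSum {L : Submodule (ZMod (p ^ δ)) V} {k : ℕ} (hk : k ≤ δ) :
    lastExp (splitSum ((p : ZMod (p ^ δ)) ^ (δ - k)) ((p : ZMod (p ^ δ)) ^ k) L) = k :=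
  lastExp_eq hk fun b => by simp [mem_splitSum]

/-- A Lagrangian contained in `p ^ k H` that contains `(0, 0, p ^ k)` splits. -/
theorem eq_splitSum {ω : LinearMap.BilinForm (ZMod (p ^ δ)) V}
    (hL : IsLagrangian (hyp ω) L) {k : ℕ} (hk : k ≤ δ)
    (hmem : ((0 : ZMod (p ^ δ)), (0 : V), (p : ZMod (p ^ δ)) ^ k) ∈ L)
    (hle : ∀ x ∈ L, ∃ y, x = (p : ZMod (p ^ δ)) ^ k • y) :
    L = splitSum ((p : ZMod (p ^ δ)) ^ (δ - k)) ((p : ZMod (p ^ δ)) ^ k) (red L) := by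
  refine hL.eq_of_le (splitSum_isLagrangian hL.red hk) ?_
  have hz : (p : ZMod (p ^ δ)) ^ (δ - k) * (p : ZMod (p ^ δ)) ^ k = 0 := by
    rw [← pow_add, Nat.sub_add_cancel hk, natCast_pow_self]
  -- All vectors of `L` are divisible by `p ^ k`, so the vector `(p ^ (δ - k), 0, 0)` is orthogonal
  -- to `L` and can be used to clear first coordinates.
  have he : ((p : ZMod (p ^ δ)) ^ (δ - k), (0 : V), (0 : ZMod (p ^ δ))) ∈ L := by
    rw [hL]
    intro l hl
    obtain ⟨y, rfl⟩ := hle l hl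
    simp only [hyp_apply, map_zero, LinearMap.zero_apply, zero_mul, zero_add, zero_sub,
      Prod.smul_snd, smul_eq_mul]
    linear_combination (-y.2.2) * hz
  intro x hx
  have ha : (p : ZMod (p ^ δ)) ^ (δ - k) ∣ x.1 := by
    rw [← pow_mul_eq_zero_iff hk]
    simpa [hyp_apply, mul_comm] using hL.apply_eq_zero hx hmem
  refine ⟨ha, ⟨x.2.2, ?_⟩, ?_⟩
  · obtain ⟨s, hs⟩ := ha
    have h1 := L.sub_mem hx (L.smul_mem s he)
    convert h1 using 1
    ext <;> simp [hs, mul_comm]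
  · obtain ⟨y, rfl⟩ := hle x hx
    exact ⟨y.2.2, rfl⟩

theorem exists_eq_pow_smul {W : Type*} [AddCommGroup W] [Module (ZMod (p ^ δ)) W] {k : ℕ} {x : W}
    (hx : ¬ ∃ y, x = (p : ZMod (p ^ δ)) ^ k • y) :
    ∃ j < k, ∃ y, x = (p : ZMod (p ^ δ)) ^ j • y ∧ ¬ ∃ z, y = (p : ZMod (p ^ δ)) • z := by
  induction k with
  | zero => exact absurd ⟨x, by simp⟩ hx
  | succ k ih =>
    by_cases h : ∃ y, x = (p : ZMod (p ^ δ)) ^ k • y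
    · obtain ⟨y, rfl⟩ := h
      refine ⟨k, Nat.lt_succ_self k, y, rfl, ?_⟩
      rintro ⟨z, rfl⟩
      exact hx ⟨z, by rw [pow_succ, smul_smul]⟩
    · obtain ⟨j, hj, hy⟩ := ih h
      exact ⟨j, by omega, hy⟩

/-- A submodule not contained in `p ^ k H` is related to one with a smaller last exponent. -/
theorem exists_transvRel_lastExp_lt {ω : LinearMap.BilinForm (ZMod (p ^ δ)) V} (hω : ω.IsAlt)
    (hperf : IsPerfect ω) {k : ℕ} {x : ZMod (p ^ δ) × V × ZMod (p ^ δ)} (hxL : x ∈ L)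
    (hx : ¬ ∃ y, x = (p : ZMod (p ^ δ)) ^ k • y) :
    ∃ L', TransvRel (hyp ω) L L' ∧ lastExp L' < k := by
  -- Here `x` is `p ^ j` times a vector `y` outside `p H`, with `j < k`. Moving `y` to `(0, 0, 1)`
  -- puts `(0, 0, p ^ j)` into the new submodule.
  obtain ⟨j, hj, y, rfl, hy⟩ := exists_eq_pow_smul hx
  obtain ⟨L', hrel, hL'⟩ := exists_transvRel_mem (hyp_isAlt hω) (hperf.hyp y hy)
    (y := ((0 : ZMod (p ^ δ)), (0 : V), (1 : ZMod (p ^ δ))))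
    ⟨(1, 0, 0), by simp [hyp_apply]⟩ _ hxL
  refine ⟨L', hrel, lt_of_le_of_lt (lastExp_le_of_mem ?_) hj⟩
  simpa using hL'

end LocalLagrangian

/-! ## Invariant functions with vanishing sums over types -/

section Separation

variable {p δ : ℕ} [hp : Fact p.Prime] {V : Type*} [AddCommGroup V] [Module (ZMod (p ^ δ)) V]

noncomputable instance fintypeSubmodule {R W : Type*} [Ring R] [AddCommGroup W] [Module R W]
    [Finite W] : Fintype (Submodule R W) := Fintype.ofFinite _

open Classical in
/-- A transvection-invariant function on Lagrangians is zero as soon as its sums over the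
Lagrangians of each type are. -/
def Separates [Finite V] {ι : Type*} (ω : LinearMap.BilinForm (ZMod (p ^ δ)) V)
    (ty : Submodule (ZMod (p ^ δ)) V → ι) : Prop :=
  ∀ t : Submodule (ZMod (p ^ δ)) V → ℚ, (∀ L w c, t (L.map (transv ω w c)) = t L) →
    (∀ i, ∑ L with IsLagrangian ω L ∧ ty L = i, t L = 0) → ∀ L, IsLagrangian ω L → t L = 0

theorem eq_of_transvRel {R W α : Type*} [CommRing R] [AddCommGroup W] [Module R W]
    {ω : LinearMap.BilinForm R W} {t : Submodule R W → α}
    (ht : ∀ L w c, t (L.map (transv ω w c)) = t L) {L L' : Submodule R W}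
    (h : TransvRel ω L L') : t L' = t L := by
  induction h with
  | refl => rfl
  | tail _ h ih =>
    obtain ⟨w, c, rfl⟩ := h
    rw [ht, ih]

/-- Strong induction on the last exponent makes the relation between types and orbits triangular: a
Lagrangian that does not split off its piece of the plane is related to one of smaller exponent,
where the function already vanishes. Only split Lagrangians remain, and they form a copy of the
Lagrangians of `V`. -/
theorem Separates.hyp [Finite V] {ι : Type*} {ω : LinearMap.BilinForm (ZMod (p ^ δ)) V}
    (hω : ω.IsAlt) (hperf : IsPerfect ω) {ty : Submodule (ZMod (p ^ δ)) V → ι}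
    (hsep : Separates ω ty) : Separates (hyp ω) (fun L => (lastExp L, ty (red L))) := by
  classical
  intro t ht hsum
  suffices h : ∀ k, ∀ L, IsLagrangian (SpHecke.hyp ω) L → lastExp L = k → t L = 0 from
    fun L hL => h _ L hL rfl
  intro k
  induction k using Nat.strong_induction_on with
  | _ k ih =>
  intro L hL hk
  have hkδ : k ≤ δ := hk ▸ lastExp_le L
  have key : ∀ L, IsLagrangian (SpHecke.hyp ω) L → lastExp L = k → t L ≠ 0 →
      L = splitSum ((p : ZMod (p ^ δ)) ^ (δ - k)) ((p : ZMod (p ^ δ)) ^ k) (red L) := by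
    intro L hL hk hne
    refine eq_splitSum hL hkδ (hk ▸ lastExp_spec L) fun x hxL => ?_
    by_contra hx
    obtain ⟨L', hrel, hlt⟩ := exists_transvRel_lastExp_lt hω hperf hxL hx
    exact hne (by rw [← eq_of_transvRel ht hrel,
      ih _ hlt L' (hrel.isLagrangian (hyp_isAlt hω) hL) rfl])
  by_contra hne
  -- The function on `V` is the restriction to split Lagrangians. By `key` its sum over type `i` is
  -- the full sum over type `(k, i)`, since all other terms vanish.
  have h0 := hsep
    (fun L => t (splitSum ((p : ZMod (p ^ δ)) ^ (δ - k)) ((p : ZMod (p ^ δ)) ^ k) L))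
    (fun L w c => by simp only [map_splitSum_transv hω, ht])
    (fun i => by
      rw [← hsum (k, i)]
      refine Finset.sum_bij_ne_zero
        (fun L _ _ => splitSum ((p : ZMod (p ^ δ)) ^ (δ - k)) ((p : ZMod (p ^ δ)) ^ k) L)
        ?_ ?_ ?_ ?_
      · intro L hL _
        simp only [Finset.mem_filter, Finset.mem_univ, true_and] at hL ⊢
        exact ⟨splitSum_isLagrangian hL.1 hkδ, by rw [lastExp_splitSum hkδ, red_splitSum, hL.2]⟩
      · intro L _ _ L' _ _ h
        simpa only [red_splitSum] using congrArg red h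
      · intro L hL hne
        simp only [Finset.mem_filter, Finset.mem_univ, true_and, Prod.mk.injEq] at hL
        have := key L hL.1 hL.2.1 hne
        refine ⟨red L, ?_, by rwa [← this], this.symm⟩
        simp only [Finset.mem_filter, Finset.mem_univ, true_and]
        exact ⟨hL.1.red, hL.2.2⟩
      · intro L _ _
        rfl)
    (red L) hL.red
  rw [← key L hL hk hne] at h0
  exact hne h0

theorem separates_punit {ι : Type*} (ω : LinearMap.BilinForm (ZMod (p ^ δ)) PUnit)
    (ty : Submodule (ZMod (p ^ δ)) PUnit → ι) : Separates ω ty := by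
  classical
  intro t _ hsum L hL
  have h := hsum (ty L)
  rwa [Finset.sum_eq_single L (fun L' _ hne => absurd (Subsingleton.elim L' L) hne)
    (fun hn => absurd (Finset.mem_filter.2 ⟨Finset.mem_univ _, hL, rfl⟩) hn)] at h

end Separation

/-! ## Cardinalities of submodules -/

section Card

theorem card_eq_map_mul_inf_ker {R M N : Type*} [Ring R] [AddCommGroup M] [Module R M]
    [AddCommGroup N] [Module R N] (K : Submodule R M) (f : M →ₗ[R] N) :
    Nat.card K = Nat.card (K.map f) * Nat.card (K ⊓ LinearMap.ker f : Submodule R M) := by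
  have h1 := Submodule.card_eq_card_quotient_mul_card (LinearMap.ker (f.domRestrict K))
  have h2 := Nat.card_congr (f.domRestrict K).quotKerEquivRange.toEquiv
  have h3 : LinearMap.range (f.domRestrict K) = K.map f := by
    ext x
    simp [Submodule.mem_map]
  have h4 : Nat.card (LinearMap.ker (f.domRestrict K)) =
      Nat.card (K ⊓ LinearMap.ker f : Submodule R M) :=
    Nat.card_congr
      { toFun := fun x => ⟨x.1.1, x.1.2, x.2⟩
        invFun := fun x => ⟨⟨x.1, x.2.1⟩, x.2.2⟩
        left_inv := fun _ => rfl
        right_inv := fun _ => rfl }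
  rw [h1, h2, h3, h4, mul_comm]

theorem card_map_of_injective {R M N : Type*} [Ring R] [AddCommGroup M] [Module R M]
    [AddCommGroup N] [Module R N] (K : Submodule R M) {f : M →ₗ[R] N}
    (hf : Function.Injective f) : Nat.card (K.map f) = Nat.card K :=
  Nat.card_congr (Submodule.equivMapOfInjective f hf K).symm.toEquiv

variable {p δ : ℕ} [hp : Fact p.Prime]

theorem card_pow_dvd {d : ℕ} (hd : d ≤ δ) :
    Nat.card {c : ZMod (p ^ δ) // (p : ZMod (p ^ δ)) ^ d ∣ c} = p ^ (δ - d) := by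
  have h1 := Nat.card_zmultiples (((p ^ d : ℕ) : ZMod (p ^ δ)))
  rw [ZMod.addOrderOf_coe _ (NeZero.ne _), Nat.gcd_eq_right (pow_dvd_pow p hd),
    Nat.pow_div hd hp.out.pos] at h1
  rw [← h1]
  refine Nat.card_congr (Equiv.subtypeEquivRight fun c => ?_)
  rw [AddSubgroup.mem_zmultiples_iff]
  constructor
  · rintro ⟨e, rfl⟩
    refine ⟨e.val, ?_⟩
    push_cast
    rw [zsmul_eq_mul, mul_comm]
    congr 1
    simp
  · rintro ⟨k, rfl⟩
    exact ⟨k, by push_cast; rw [zsmul_eq_mul, mul_comm]⟩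

variable {V : Type*} [AddCommGroup V] [Module (ZMod (p ^ δ)) V]

/-- The submodule of `L` killed by `p`. -/
def torsPart (L : Submodule (ZMod (p ^ δ)) V) : Submodule (ZMod (p ^ δ)) V :=
  L ⊓ LinearMap.ker (LinearMap.lsmul (ZMod (p ^ δ)) V (p : ZMod (p ^ δ)))

theorem mem_torsPart {L : Submodule (ZMod (p ^ δ)) V} {v : V} :
    v ∈ torsPart L ↔ v ∈ L ∧ (p : ZMod (p ^ δ)) • v = 0 := Iff.rfl

/-- The exponent `r` with `|p L| = p ^ r`. -/
noncomputable def rk (L : Submodule (ZMod (p ^ δ)) V) : ℕ :=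
  Nat.log p (Nat.card (L.map (LinearMap.lsmul (ZMod (p ^ δ)) V (p : ZMod (p ^ δ)))))

theorem card_eq_mul_torsPart (L : Submodule (ZMod (p ^ δ)) V) :
    Nat.card L = Nat.card (L.map (LinearMap.lsmul (ZMod (p ^ δ)) V (p : ZMod (p ^ δ)))) *
      Nat.card (torsPart L) := card_eq_map_mul_inf_ker L _

/-- Multiplication by `p` on `L` has kernel `torsPart L`. Ranks are computed by counting this
kernel, which is easier to parametrise than the image. -/
theorem rk_eq_of_card [Finite V] {L : Submodule (ZMod (p ^ δ)) V} {r : ℕ}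
    (h : Nat.card L = p ^ r * Nat.card (torsPart L)) : rk L = r := by
  rw [card_eq_mul_torsPart] at h
  rw [rk, Nat.eq_of_mul_eq_mul_right Nat.card_pos h, Nat.log_pow hp.out.one_lt]

theorem card_eq_pow_rk_mul [Finite V] {L : Submodule (ZMod (p ^ δ)) V} {m : ℕ}
    (h : Nat.card L = p ^ m) : Nat.card L = p ^ rk L * Nat.card (torsPart L) := by
  have h1 := card_eq_mul_torsPart L
  have h2 : Nat.card (L.map (LinearMap.lsmul (ZMod (p ^ δ)) V (p : ZMod (p ^ δ)))) ∣ p ^ m :=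
    ⟨_, h ▸ h1⟩
  obtain ⟨r, -, hr⟩ := (Nat.dvd_prime_pow hp.out).1 h2
  rw [hr] at h1
  rw [rk_eq_of_card h1, h1]

theorem torsPart_map {W : Type*} [AddCommGroup W] [Module (ZMod (p ^ δ)) W]
    (L : Submodule (ZMod (p ^ δ)) V) (e : V →ₗ[ZMod (p ^ δ)] W) (he : Function.Injective e) :
    torsPart (L.map e) = (torsPart L).map e := by
  ext x
  constructor
  · rintro ⟨⟨y, hy, rfl⟩, h⟩
    refine ⟨y, ⟨hy, he ?_⟩, rfl⟩
    rw [map_zero, ← h]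
    simp
  · rintro ⟨y, ⟨hy, h⟩, rfl⟩
    refine mem_torsPart.2 ⟨⟨y, hy, rfl⟩, ?_⟩
    rw [← map_smul]
    exact (congrArg e h).trans (map_zero e)

theorem rk_map [Finite V] {W : Type*} [AddCommGroup W] [Module (ZMod (p ^ δ)) W] [Finite W]
    (L : Submodule (ZMod (p ^ δ)) V) {e : V →ₗ[ZMod (p ^ δ)] W} (he : Function.Injective e) :
    rk (L.map e) = rk L := by
  have h1 := card_eq_mul_torsPart L
  have h2 := card_eq_mul_torsPart (L.map e)
  rw [torsPart_map L e he, card_map_of_injective _ he, card_map_of_injective _ he, h1] at h2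
  rw [rk, rk, Nat.eq_of_mul_eq_mul_right Nat.card_pos h2]

theorem transv_injective {R W : Type*} [CommRing R] [AddCommGroup W] [Module R W]
    {ω : LinearMap.BilinForm R W} (hω : ω.IsAlt) (w : W) (c : R) :
    Function.Injective (transv ω w c) :=
  Function.LeftInverse.injective (transv_transv_neg hω w c)

theorem TransvRel.card_eq {R W : Type*} [CommRing R] [AddCommGroup W] [Module R W]
    {ω : LinearMap.BilinForm R W} (hω : ω.IsAlt) {L L' : Submodule R W} (h : TransvRel ω L L') :
    Nat.card L' = Nat.card L :=
  eq_of_transvRel (t := fun L : Submodule R W => Nat.card L)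
    (fun _ w c => card_map_of_injective _ (transv_injective hω w c)) h

theorem TransvRel.rk_eq [Finite V] {ω : LinearMap.BilinForm (ZMod (p ^ δ)) V} (hω : ω.IsAlt)
    {L L' : Submodule (ZMod (p ^ δ)) V} (h : TransvRel ω L L') : rk L' = rk L :=
  eq_of_transvRel (t := rk) (fun _ w c => rk_map _ (transv_injective hω w c)) h

/-- The parameters `0` and `1` are `p ^ (δ - k)` and `p ^ k` at `k = 0`, because `p ^ δ = 0`. -/
theorem card_splitSum_zero_one [Finite V] (L : Submodule (ZMod (p ^ δ)) V) :
    Nat.card (splitSum 0 1 L) = Nat.card L * p ^ δ := by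
  have h := Nat.card_congr (α := splitSum 0 1 L) (β := L × ZMod (p ^ δ))
    { toFun := fun x => (⟨x.1.2.1, x.2.2.1⟩, x.1.2.2)
      invFun := fun x => ⟨(0, x.1.1, x.2), dvd_rfl, x.1.2, one_dvd _⟩
      left_inv := by
        rintro ⟨⟨a, v, b⟩, h⟩
        obtain rfl : a = 0 := zero_dvd_iff.1 h.1
        rfl
      right_inv := fun _ => rfl }
  rw [h, Nat.card_prod, Nat.card_zmod]

theorem card_torsPart_splitSum_zero_one [Finite V] (hδ : 1 ≤ δ)
    (L : Submodule (ZMod (p ^ δ)) V) :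
    Nat.card (torsPart (splitSum 0 1 L)) = Nat.card (torsPart L) * p := by
  have h := Nat.card_congr (α := torsPart (splitSum 0 1 L))
    (β := torsPart L × {c : ZMod (p ^ δ) // (p : ZMod (p ^ δ)) ^ (δ - 1) ∣ c})
    { toFun := fun x => (⟨x.1.2.1, mem_torsPart.2 ⟨x.2.1.2.1,
          congrArg (fun y => y.2.1) (mem_torsPart.1 x.2).2⟩⟩,
        ⟨x.1.2.2, (pow_mul_eq_zero_iff hδ _).1 (by
          rw [pow_one]; exact congrArg (fun y => y.2.2) (mem_torsPart.1 x.2).2)⟩)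
      invFun := fun x => ⟨(0, x.1.1, x.2.1), ⟨dvd_rfl, x.1.2.1, one_dvd _⟩, by
        have h1 := (pow_mul_eq_zero_iff hδ _).2 x.2.2
        rw [pow_one] at h1
        have h2 := (mem_torsPart.1 x.1.2).2
        simp [h1, h2]⟩
      left_inv := by
        rintro ⟨⟨a, v, b⟩, h⟩
        obtain rfl : a = 0 := zero_dvd_iff.1 h.1.1
        rfl
      right_inv := fun _ => rfl }
  rw [h, Nat.card_prod, card_pow_dvd (Nat.sub_le _ _), Nat.sub_sub_self hδ, pow_one]

/-- A Lagrangian of a hyperbolic extension lies in `p H` or is related to a split one. -/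
theorem le_or_transvRel_splitSum {ω : LinearMap.BilinForm (ZMod (p ^ δ)) V} (hω : ω.IsAlt)
    (hperf : IsPerfect ω) {L : Submodule (ZMod (p ^ δ)) (ZMod (p ^ δ) × V × ZMod (p ^ δ))}
    (hL : IsLagrangian (hyp ω) L) :
    (∀ x ∈ L, ∃ y, x = (p : ZMod (p ^ δ)) • y) ∨
      ∃ L', IsLagrangian ω L' ∧ TransvRel (hyp ω) L (splitSum 0 1 L') := by
  by_cases h : ∀ x ∈ L, ∃ y, x = (p : ZMod (p ^ δ)) • y
  · exact Or.inl h
  right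
  push Not at h
  obtain ⟨x, hxL, hx⟩ := h
  obtain ⟨L₁, hrel, hlt⟩ := exists_transvRel_lastExp_lt (k := 1) hω hperf hxL (by
    rw [pow_one]
    rintro ⟨y, hy⟩
    exact hx y hy)
  have hL₁ := hrel.isLagrangian (hyp_isAlt hω) hL
  have h0 : lastExp L₁ = 0 := by omega
  have h1 := eq_splitSum hL₁ (Nat.zero_le δ) (h0 ▸ lastExp_spec L₁) (fun x _ => ⟨x, by simp⟩)
  rw [Nat.sub_zero, natCast_pow_self, pow_zero] at h1
  exact ⟨red L₁, hL₁.red, h1 ▸ hrel⟩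

/-- The Lagrangians with last exponent `0` are determined by their reduction. -/
theorem eq_splitSum_zero_one {ω : LinearMap.BilinForm (ZMod (p ^ δ)) V}
    {L : Submodule (ZMod (p ^ δ)) (ZMod (p ^ δ) × V × ZMod (p ^ δ))}
    (hL : IsLagrangian (hyp ω) L) (h0 : lastExp L = 0) : L = splitSum 0 1 (red L) := by
  have h1 := eq_splitSum hL (Nat.zero_le δ) (h0 ▸ lastExp_spec L) (fun x _ => ⟨x, by simp⟩)
  rwa [Nat.sub_zero, natCast_pow_self, pow_zero] at h1

theorem splitSum_zero_one_isLagrangian {ω : LinearMap.BilinForm (ZMod (p ^ δ)) V}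
    {L : Submodule (ZMod (p ^ δ)) V} (hL : IsLagrangian ω L) :
    IsLagrangian (hyp ω) (splitSum 0 1 L) := by
  have := splitSum_isLagrangian hL (Nat.zero_le δ)
  rwa [Nat.sub_zero, natCast_pow_self, pow_zero] at this

theorem lastExp_splitSum_zero_one (L : Submodule (ZMod (p ^ δ)) V) :
    lastExp (splitSum 0 1 L) = 0 := by
  have := lastExp_splitSum (L := L) (Nat.zero_le δ)
  rwa [Nat.sub_zero, natCast_pow_self, pow_zero] at this

end Card

/-! ## The Lagrangians with a given reduction -/

section Over

variable {p δ : ℕ} [hp : Fact p.Prime] {V : Type*} [AddCommGroup V] [Module (ZMod (p ^ δ)) V]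

/-- The Lagrangian with reduction `L` and last exponent `d` that contains `(p ^ (δ - d), u, b)`. -/
def extend (ω : LinearMap.BilinForm (ZMod (p ^ δ)) V) (L : Submodule (ZMod (p ^ δ)) V) (d : ℕ)
    (g : V × ZMod (p ^ δ)) : Submodule (ZMod (p ^ δ)) (ZMod (p ^ δ) × V × ZMod (p ^ δ)) where
  carrier := {x | (∃ s, x.1 = s * (p : ZMod (p ^ δ)) ^ (δ - d) ∧ x.2.1 - s • g.1 ∈ L) ∧
    hyp ω x ((p : ZMod (p ^ δ)) ^ (δ - d), g) = 0}
  add_mem' := by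
    rintro x y ⟨⟨s, hs, hs'⟩, hx⟩ ⟨⟨t, ht, ht'⟩, hy⟩
    refine ⟨⟨s + t, by rw [Prod.fst_add, hs, ht, add_mul], ?_⟩, ?_⟩
    · have := L.add_mem hs' ht'
      convert this using 1
      simp only [Prod.snd_add, Prod.fst_add]
      module
    · rw [map_add, LinearMap.add_apply, hx, hy, add_zero]
  zero_mem' := ⟨⟨0, by simp, by simp⟩, by simp⟩
  smul_mem' := by
    rintro c x ⟨⟨s, hs, hs'⟩, hx⟩
    refine ⟨⟨c * s, by rw [Prod.smul_fst, hs, smul_eq_mul, mul_assoc], ?_⟩, ?_⟩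
    · have := L.smul_mem c hs'
      convert this using 1
      simp only [Prod.smul_snd, Prod.smul_fst]
      module
    · rw [map_smul, LinearMap.smul_apply, hx, smul_zero]

/-- The condition on `u` for `extend` to be Lagrangian. -/
def Extendable (ω : LinearMap.BilinForm (ZMod (p ^ δ)) V) (L : Submodule (ZMod (p ^ δ)) V) (d : ℕ)
    (u : V) : Prop := ∀ l ∈ L, (p : ZMod (p ^ δ)) ^ (δ - d) ∣ ω l u

variable {ω : LinearMap.BilinForm (ZMod (p ^ δ)) V} {L : Submodule (ZMod (p ^ δ)) V} {d : ℕ}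
  {g : V × ZMod (p ^ δ)}

theorem mem_extend {x : ZMod (p ^ δ) × V × ZMod (p ^ δ)} : x ∈ extend ω L d g ↔
    (∃ s, x.1 = s * (p : ZMod (p ^ δ)) ^ (δ - d) ∧ x.2.1 - s • g.1 ∈ L) ∧
    hyp ω x ((p : ZMod (p ^ δ)) ^ (δ - d), g) = 0 := Iff.rfl

theorem Extendable.smul_mem (hω : ω.IsAlt) (hL : IsLagrangian ω L) (hd : d ≤ δ)
    (hu : Extendable ω L d g.1) : (p : ZMod (p ^ δ)) ^ d • g.1 ∈ L := by
  rw [hL]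
  intro l hl
  rw [map_smul, LinearMap.smul_apply, smul_eq_mul, pow_mul_eq_zero_iff hd, ← hω.neg_eq l]
  exact (hu l hl).neg_right

theorem generator_mem_extend (hω : ω.IsAlt) :
    ((p : ZMod (p ^ δ)) ^ (δ - d), g) ∈ extend ω L d g :=
  ⟨⟨1, by simp, by simp⟩, hyp_isAlt hω _⟩

/-- Each element is a multiple of the generator plus a vector `(0, l, c)` with `l ∈ L`, and both
parts are orthogonal to the generator; this gives isotropy. For maximality, pairing with `(0, 0, p ^
d)` bounds the first coordinate, and pairing with the lifts `(0, l, -c)`, where `ω l u = p ^ (δ - d)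
* c`, puts the middle part into `L`. These lifts are what extendability provides. -/
theorem extend_isLagrangian (hω : ω.IsAlt) (hL : IsLagrangian ω L) (hd : d ≤ δ)
    (hu : Extendable ω L d g.1) : IsLagrangian (hyp ω) (extend ω L d g) := by
  have hgm := generator_mem_extend (d := d) (g := g) (L := L) hω
  have hω' := hyp_isAlt hω
  intro x
  constructor
  · rintro ⟨⟨s, hs, hs'⟩, hx⟩ y ⟨⟨t, ht, ht'⟩, hy⟩
    have h0 := hL.apply_eq_zero hs' ht'
    have e1 : x = s • ((p : ZMod (p ^ δ)) ^ (δ - d), g) +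
        (0, x.2.1 - s • g.1, x.2.2 - s * g.2) := by
      ext <;> simp [hs]
    have e2 : y = t • ((p : ZMod (p ^ δ)) ^ (δ - d), g) +
        (0, y.2.1 - t • g.1, y.2.2 - t * g.2) := by
      ext <;> simp [ht]
    set γ := ((p : ZMod (p ^ δ)) ^ (δ - d), g)
    have h1 : hyp ω (0, x.2.1 - s • g.1, x.2.2 - s * g.2) γ = 0 := by
      rw [e1, map_add, LinearMap.add_apply, map_smul, LinearMap.smul_apply, hω' γ] at hx
      simpa using hx
    have h2 : hyp ω γ (0, y.2.1 - t • g.1, y.2.2 - t * g.2) = 0 := by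
      rw [e2, map_add, LinearMap.add_apply, map_smul, LinearMap.smul_apply, hω' γ] at hy
      rw [← hω'.neg_eq, neg_eq_zero]
      simpa using hy
    have h3 : hyp ω (0, x.2.1 - s • g.1, x.2.2 - s * g.2)
        (0, y.2.1 - t • g.1, y.2.2 - t * g.2) = 0 := by
      simp only [hyp_apply, h0, mul_zero, zero_mul, sub_zero, add_zero]
    rw [e1, e2]
    simp only [map_add, map_smul, LinearMap.add_apply, LinearMap.smul_apply, hω' γ, h1, h2, h3,
      smul_zero, add_zero]
  · intro h
    have hx := h _ hgm
    have h1 : (p : ZMod (p ^ δ)) ^ (δ - d) ∣ x.1 := by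
      rw [← pow_mul_eq_zero_iff hd]
      have h2 := h (0, 0, (p : ZMod (p ^ δ)) ^ d) ⟨⟨0, by simp, by simp⟩, by
        simp [hyp_apply, ← pow_add, Nat.add_sub_cancel' hd, natCast_pow_self]⟩
      simpa [hyp_apply, mul_comm] using h2
    obtain ⟨s, hs⟩ := h1
    refine ⟨⟨s, by rw [hs, mul_comm], (hL _).2 fun l hl => ?_⟩, hx⟩
    obtain ⟨c, hc⟩ := hu l hl
    have h3 : ((0 : ZMod (p ^ δ)), l, -c) ∈ extend ω L d g :=
      ⟨⟨0, by simp, by simpa using hl⟩, by simp [hyp_apply, hc, mul_comm]⟩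
    have h4 := h _ h3
    have h5 := mem_extend.1 h3
    simp only [hyp_apply, mul_zero, zero_mul, sub_zero] at h4 h5
    have h6 := h5.2
    have h7 : ω g.1 l = - ω l g.1 := (hω.neg_eq l g.1).symm
    rw [map_sub, map_smul, LinearMap.sub_apply, LinearMap.smul_apply, smul_eq_mul, h7]
    rw [hs] at h4
    linear_combination h4 + s * h6

theorem lastExp_extend (hd : d ≤ δ) : lastExp (extend ω L d g) = d := by
  refine lastExp_eq hd fun b => ?_
  have h := pow_mul_eq_zero_iff (Nat.sub_le δ d) b
  rw [Nat.sub_sub_self hd] at h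
  rw [← h]
  constructor
  · intro hb
    simpa [hyp_apply, mul_comm] using (mem_extend.1 hb).2
  · intro hb
    exact ⟨⟨0, by simp, by simp⟩, by simpa [hyp_apply, mul_comm] using hb⟩

theorem red_extend (hω : ω.IsAlt) (hL : IsLagrangian ω L) (hd : d ≤ δ)
    (hu : Extendable ω L d g.1) : red (extend ω L d g) = L := by
  refine (IsLagrangian.eq_of_le hL (extend_isLagrangian hω hL hd hu).red ?_).symm
  intro l hl
  obtain ⟨c, hc⟩ := hu l hl
  exact ⟨-c, ⟨0, by simp, by simpa using hl⟩, by simp [hyp_apply, hc, mul_comm]⟩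

/-- A Lagrangian is recovered from its reduction, its exponent and any generator: it lies in the
extension so built, and Lagrangians are not properly nested. -/
theorem extendable_and_eq_extend {L : Submodule (ZMod (p ^ δ)) (ZMod (p ^ δ) × V × ZMod (p ^ δ))}
    (hω : ω.IsAlt) (hL : IsLagrangian (hyp ω) L)
    (hg : ((p : ZMod (p ^ δ)) ^ (δ - lastExp L), g) ∈ L) :
    Extendable ω (red L) (lastExp L) g.1 ∧ extend ω (red L) (lastExp L) g = L := by
  have hu : Extendable ω (red L) (lastExp L) g.1 := by
    rintro l ⟨c, hc⟩
    have := hL.apply_eq_zero hc hg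
    simp only [hyp_apply, zero_mul, sub_zero] at this
    exact ⟨-c, by linear_combination this⟩
  refine ⟨hu, (hL.eq_of_le (extend_isLagrangian hω hL.red (lastExp_le L) hu) ?_).symm⟩
  intro x hx
  obtain ⟨s, hs⟩ := (exists_generator hL).2 x hx
  refine ⟨⟨s, by rw [hs, mul_comm], x.2.2 - s * g.2, ?_⟩, hL.apply_eq_zero hx hg⟩
  have := L.sub_mem hx (L.smul_mem s hg)
  convert this using 1
  ext <;> simp [hs, mul_comm]

/-- Two generators differ by a pair `(v, c)` with `(0, v, c) ∈ L`. Such pairs map onto the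
reduction, and the fibre over zero is the ideal of `p ^ lastExp L`. -/
theorem card_generators [Finite V]
    {L : Submodule (ZMod (p ^ δ)) (ZMod (p ^ δ) × V × ZMod (p ^ δ))}
    (hL : IsLagrangian (hyp ω) L) :
    Nat.card {g : V × ZMod (p ^ δ) // ((p : ZMod (p ^ δ)) ^ (δ - lastExp L), g) ∈ L} =
      Nat.card (red L) * p ^ (δ - lastExp L) := by
  obtain ⟨⟨u, b, hg⟩, -⟩ := exists_generator hL
  have h1 : Nat.card {g : V × ZMod (p ^ δ) // ((p : ZMod (p ^ δ)) ^ (δ - lastExp L), g) ∈ L} =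
      Nat.card (L.comap (LinearMap.inr (ZMod (p ^ δ)) (ZMod (p ^ δ)) (V × ZMod (p ^ δ)))) := by
    refine Nat.card_congr ((Equiv.subRight (u, b)).subtypeEquiv fun g => ?_)
    constructor
    · intro h
      have := L.sub_mem h hg
      simpa using this
    · intro h
      have := L.add_mem h hg
      simpa using this
  rw [h1, card_eq_map_mul_inf_ker _ (LinearMap.fst (ZMod (p ^ δ)) V (ZMod (p ^ δ)))]
  congr 1
  · congr 2
    ext v
    constructor
    · rintro ⟨⟨v, c⟩, h, rfl⟩
      exact ⟨c, h⟩
    · rintro ⟨c, h⟩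
      exact ⟨(v, c), h, rfl⟩
  · rw [← card_pow_dvd (lastExp_le L)]
    refine Nat.card_congr
      { toFun := fun x => ⟨x.1.2, (mem_iff_lastExp L _).1 ?_⟩
        invFun := fun c => ⟨(0, c.1), (mem_iff_lastExp L _).2 c.2, rfl⟩
        left_inv := ?_
        right_inv := fun _ => rfl }
    · obtain ⟨⟨v, c⟩, h, h'⟩ := x
      obtain rfl : v = 0 := h'
      exact h
    · rintro ⟨⟨v, c⟩, h, h'⟩
      obtain rfl : v = 0 := h'
      rfl

/-- The Lagrangians with a given reduction and last exponent are counted by their generators. -/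
theorem card_over_mul [Finite V] (hω : ω.IsAlt) (hL : IsLagrangian ω L) (hd : d ≤ δ)
    (P : Submodule (ZMod (p ^ δ)) (ZMod (p ^ δ) × V × ZMod (p ^ δ)) → Prop) :
    Nat.card {L' // IsLagrangian (hyp ω) L' ∧ red L' = L ∧ lastExp L' = d ∧ P L'} *
      (Nat.card L * p ^ (δ - d)) =
    Nat.card {g : V × ZMod (p ^ δ) // Extendable ω L d g.1 ∧ P (extend ω L d g)} := by
  let f : {g : V × ZMod (p ^ δ) // Extendable ω L d g.1 ∧ P (extend ω L d g)} →
      {L' // IsLagrangian (hyp ω) L' ∧ red L' = L ∧ lastExp L' = d ∧ P L'} := fun g =>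
    ⟨extend ω L d g.1, extend_isLagrangian hω hL hd g.2.1, red_extend hω hL hd g.2.1,
      lastExp_extend hd, g.2.2⟩
  -- The fibre of `f` over `L'` is the set of generators of `L'`, whose number does not depend on
  -- `L'`.
  rw [← Nat.card_congr (Equiv.sigmaFiberEquiv f)]
  have : Fintype {L' // IsLagrangian (hyp ω) L' ∧ red L' = L ∧ lastExp L' = d ∧ P L'} :=
    Fintype.ofFinite _
  rw [Nat.card_sigma, Finset.sum_congr rfl (g := fun _ => Nat.card L * p ^ (δ - d)),
    Finset.sum_const, Finset.card_univ, ← Nat.card_eq_fintype_card, smul_eq_mul]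
  rintro ⟨L', h1, h2, h3, h4⟩ -
  have h5 := card_generators h1
  rw [h2, h3] at h5
  rw [← h5]
  refine Nat.card_congr
    { toFun := fun g => ⟨g.1.1, ?_⟩
      invFun := fun g => ⟨⟨g.1, ?_⟩, ?_⟩
      left_inv := fun _ => rfl
      right_inv := fun _ => rfl }
  · have h6 : extend ω L d g.1.1 = L' := congrArg Subtype.val g.2
    exact h6.le (generator_mem_extend hω)
  · have h6 := extendable_and_eq_extend hω h1 (g := g.1) (by rw [h3]; exact g.2)
    rw [h2, h3] at h6
    exact ⟨h6.1, by rw [h6.2]; exact h4⟩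
  · have h6 := extendable_and_eq_extend hω h1 (g := g.1) (by rw [h3]; exact g.2)
    rw [h2, h3] at h6
    exact Subtype.ext h6.2

end Over

/-! ## Lagrangians modulo `p` -/

section ModP

variable {p : ℕ} [hp : Fact p.Prime] {V : Type*} [AddCommGroup V] [Module (ZMod (p ^ 1)) V]
  [Finite V]

/-- A symplectic space of dimension `2 n` over `ZMod p`, with the facts on its Lagrangians that
are inherited by hyperbolic extensions. -/
structure IsSymplecticModP (ω : LinearMap.BilinForm (ZMod (p ^ 1)) V) (n : ℕ) : Prop where
  alt : ω.IsAlt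
  perfect : IsPerfect ω
  card : Nat.card V = p ^ (2 * n)
  card_lagrangian : ∀ L, IsLagrangian ω L → Nat.card L = p ^ n
  transvRel : ∀ L L', IsLagrangian ω L → IsLagrangian ω L' → TransvRel ω L L'

theorem isSymplecticModP_punit (ω : LinearMap.BilinForm (ZMod (p ^ 1)) PUnit) :
    IsSymplecticModP ω 0 where
  alt := fun x => by rw [Subsingleton.elim x 0, map_zero]
  perfect := fun x hx => absurd ⟨x, Subsingleton.elim _ _⟩ hx
  card := by simp
  card_lagrangian := fun L _ => by simp
  transvRel := fun L L' _ _ => Subsingleton.elim L L' ▸ Relation.ReflTransGen.refl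

/-- Modulo `p` the submodule `p H` is zero and contains no Lagrangian, since the complement of zero
is everything. So every Lagrangian is related to a split one, and order and transitivity are
inherited from `V`. -/
theorem IsSymplecticModP.hyp {ω : LinearMap.BilinForm (ZMod (p ^ 1)) V} {n : ℕ}
    (h : IsSymplecticModP ω n) : IsSymplecticModP (hyp ω) (n + 1) := by
  have hω := hyp_isAlt h.alt
  have hsplit : ∀ L, IsLagrangian (SpHecke.hyp ω) L →
      ∃ L', IsLagrangian ω L' ∧ TransvRel (SpHecke.hyp ω) L (splitSum 0 1 L') := by
    intro L hL
    refine (le_or_transvRel_splitSum h.alt h.perfect hL).resolve_left fun hle => ?_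
    have h0 : (p : ZMod (p ^ 1)) = 0 := (pow_one _).symm.trans natCast_pow_self
    have h1 : ((0 : ZMod (p ^ 1)), (0 : V), (1 : ZMod (p ^ 1))) ∈ L := by
      rw [hL]
      intro l hl
      obtain ⟨y, rfl⟩ := hle l hl
      rw [h0, zero_smul, map_zero]
    obtain ⟨y, hy⟩ := hle _ h1
    have h2 : (1 : ZMod (p ^ 1)) = 0 := by
      have := congrArg (fun z => z.2.2) hy
      simpa [h0] using this
    have h3 := (pow_eq_zero_iff_le (p := p) (δ := 1) (j := 0)).1 (by rw [pow_zero, h2])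
    omega
  refine ⟨hω, h.perfect.hyp, ?_, ?_, ?_⟩
  · rw [Nat.card_prod, Nat.card_prod, h.card, Nat.card_zmod]
    ring
  · intro L hL
    obtain ⟨L', hL', hrel⟩ := hsplit L hL
    rw [← hrel.card_eq hω, card_splitSum_zero_one, h.card_lagrangian L' hL']
    ring
  · intro L₁ L₂ h₁ h₂
    obtain ⟨L₁', h₁', r₁⟩ := hsplit L₁ h₁
    obtain ⟨L₂', h₂', r₂⟩ := hsplit L₂ h₂
    exact r₁.trans (((h.transvRel _ _ h₁' h₂').splitSum h.alt 0 1).trans (r₂.symm hω))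

open Classical in
-- The exponent is `0` or `1`. Only the split Lagrangian has exponent `0`. For exponent `1`
-- extendability is vacuous, so the `p ^ (2 * n + 1)` pairs `g` are shared out among Lagrangians
-- with `p ^ n` generators each.
theorem IsSymplecticModP.sum_over {ω : LinearMap.BilinForm (ZMod (p ^ 1)) V} {n : ℕ}
    (h : IsSymplecticModP ω n) {A : Type*} [CommRing A] (y : A)
    {L : Submodule (ZMod (p ^ 1)) V} (hL : IsLagrangian ω L) :
    ∑ L' with IsLagrangian (SpHecke.hyp ω) L' ∧ red L' = L, y ^ lastExp L' =
      1 + p ^ (n + 1) * y := by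
  have hcard := card_over_mul h.alt hL le_rfl (fun _ => True)
  rw [h.card_lagrangian L hL, Nat.card_congr (β := V × ZMod (p ^ 1))
    (Equiv.subtypeUnivEquiv fun g => ⟨fun l _ => by simp, trivial⟩), Nat.card_prod, h.card,
    Nat.card_zmod] at hcard
  have hN : Nat.card {L' // IsLagrangian (SpHecke.hyp ω) L' ∧ red L' = L ∧ lastExp L' = 1 ∧ True} =
      p ^ (n + 1) := by
    refine Nat.eq_of_mul_eq_mul_right (pow_pos hp.out.pos n) ?_
    simp only [Nat.sub_self, pow_zero, mul_one] at hcard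
    rw [hcard]
    ring
  rw [Nat.card_eq_fintype_card, Fintype.card_subtype] at hN
  rw [← Finset.sum_filter_add_sum_filter_not _ (fun L' => lastExp L' = 0), Finset.filter_filter,
    Finset.filter_filter]
  congr 1
  · rw [Finset.sum_eq_single (splitSum 0 1 L)]
    · rw [lastExp_splitSum_zero_one, pow_zero]
    · intro L' hL' hne
      simp only [Finset.mem_filter, Finset.mem_univ, true_and] at hL'
      have := eq_splitSum_zero_one hL'.1.1 hL'.2
      rw [hL'.1.2] at this
      exact absurd this hne
    · intro hn
      exact absurd (Finset.mem_filter.2 ⟨Finset.mem_univ _,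
        ⟨splitSum_zero_one_isLagrangian hL, red_splitSum _ _ _⟩, lastExp_splitSum_zero_one L⟩) hn
  · have hS : (Finset.univ.filter fun L' => (IsLagrangian (SpHecke.hyp ω) L' ∧ red L' = L) ∧
        ¬ lastExp L' = 0) = Finset.univ.filter fun L' => IsLagrangian (SpHecke.hyp ω) L' ∧
          red L' = L ∧ lastExp L' = 1 ∧ True := by
      ext L'
      have := lastExp_le L'
      simp only [Finset.mem_filter, Finset.mem_univ, true_and]
      constructor
      · rintro ⟨⟨h1, h2⟩, h3⟩
        exact ⟨h1, h2, by omega, trivial⟩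
      · rintro ⟨h1, h2, h3, -⟩
        exact ⟨⟨h1, h2⟩, by omega⟩
    rw [hS, Finset.sum_congr rfl (g := fun _ => y), Finset.sum_const, hN, nsmul_eq_mul]
    · push_cast
      rfl
    · intro L' hL'
      simp only [Finset.mem_filter, Finset.mem_univ, true_and] at hL'
      rw [hL'.2.2.1, pow_one]

open Classical in
theorem IsSymplecticModP.sum_hyp {ω : LinearMap.BilinForm (ZMod (p ^ 1)) V} {n : ℕ}
    (h : IsSymplecticModP ω n) {A : Type*} [CommRing A] (y : A)
    (W : Submodule (ZMod (p ^ 1)) V → A) :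
    ∑ L with IsLagrangian (SpHecke.hyp ω) L, W (red L) * y ^ lastExp L =
      (1 + p ^ (n + 1) * y) * ∑ L with IsLagrangian ω L, W L := by
  rw [← Finset.sum_fiberwise_of_maps_to (g := red)
    (t := Finset.univ.filter fun L => IsLagrangian ω L)
    (fun L hL => by
      simp only [Finset.mem_filter, Finset.mem_univ, true_and] at hL ⊢
      exact hL.red), Finset.mul_sum]
  refine Finset.sum_congr rfl fun L hL => ?_
  simp only [Finset.mem_filter, Finset.mem_univ, true_and] at hL
  rw [← h.sum_over y hL, Finset.filter_filter, Finset.sum_mul]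
  refine Finset.sum_congr rfl fun L' hL' => ?_
  simp only [Finset.mem_filter, Finset.mem_univ, true_and] at hL'
  rw [hL'.2, mul_comm]

end ModP

/-! ## Lagrangians modulo `p ^ 2` -/

section ModPSq

variable {p : ℕ} [hp : Fact p.Prime] {V : Type*} [AddCommGroup V] [Module (ZMod (p ^ 2)) V]
  [Finite V]

/-- A free symplectic module of rank `2 n` over `ZMod (p ^ 2)`, with the facts on its Lagrangians
that are inherited by hyperbolic extensions. -/
structure IsSymplecticModPSq (ω : LinearMap.BilinForm (ZMod (p ^ 2)) V) (n : ℕ) : Prop where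
  alt : ω.IsAlt
  perfect : IsPerfect ω
  card : Nat.card V = p ^ (4 * n)
  smul_eq_zero_iff : ∀ v : V, (p : ZMod (p ^ 2)) • v = 0 ↔ ∃ w, v = (p : ZMod (p ^ 2)) • w
  card_lagrangian : ∀ L, IsLagrangian ω L → Nat.card L = p ^ (2 * n)
  -- This serves the rank count: a vector outside `L + p V` must pair nontrivially with some
  -- `p`-torsion vector of `L`.
  exists_add : ∀ L, IsLagrangian ω L → ∀ u, (∀ l ∈ torsPart L, ω l u = 0) →
    ∃ l ∈ L, ∃ w, u = l + (p : ZMod (p ^ 2)) • w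
  transvRel : ∀ L L', IsLagrangian ω L → IsLagrangian ω L' → rk L = rk L' → TransvRel ω L L'

theorem isSymplecticModPSq_punit (ω : LinearMap.BilinForm (ZMod (p ^ 2)) PUnit) :
    IsSymplecticModPSq ω 0 where
  alt := fun x => by rw [Subsingleton.elim x 0, map_zero]
  perfect := fun x hx => absurd ⟨x, Subsingleton.elim _ _⟩ hx
  card := by simp
  smul_eq_zero_iff := fun v => ⟨fun _ => ⟨v, Subsingleton.elim _ _⟩, fun _ => Subsingleton.elim _ _⟩
  card_lagrangian := fun L _ => by simp
  exists_add := fun L _ u _ => ⟨0, L.zero_mem, 0, Subsingleton.elim _ _⟩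
  transvRel := fun L L' _ _ _ => Subsingleton.elim L L' ▸ Relation.ReflTransGen.refl

theorem p_mul_eq_zero_iff (b : ZMod (p ^ 2)) :
    (p : ZMod (p ^ 2)) * b = 0 ↔ (p : ZMod (p ^ 2)) ∣ b := by
  have := pow_mul_eq_zero_iff (p := p) (δ := 2) (j := 1) (by norm_num) b
  simpa using this

theorem p_sq_eq_zero : (p : ZMod (p ^ 2)) * p = 0 := (pow_two _).symm.trans natCast_pow_self

theorem p_ne_zero : (p : ZMod (p ^ 2)) ≠ 0 := by
  intro h
  have := (pow_eq_zero_iff_le (p := p) (δ := 2) (j := 1)).1 (by rwa [pow_one])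
  omega

/-- Kernel and image of multiplication by `p` coincide, so the order of `V` is the square of the
order of either. -/
theorem card_torsPart_top {n : ℕ}
    (hcard : Nat.card V = p ^ (4 * n))
    (htors : ∀ v : V, (p : ZMod (p ^ 2)) • v = 0 ↔ ∃ w, v = (p : ZMod (p ^ 2)) • w) :
    Nat.card (torsPart (⊤ : Submodule (ZMod (p ^ 2)) V)) = p ^ (2 * n) := by
  have h1 := card_eq_mul_torsPart (⊤ : Submodule (ZMod (p ^ 2)) V)
  have h2 : (⊤ : Submodule (ZMod (p ^ 2)) V).map
      (LinearMap.lsmul (ZMod (p ^ 2)) V (p : ZMod (p ^ 2))) = torsPart ⊤ := by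
    ext v
    constructor
    · rintro ⟨w, -, rfl⟩
      exact mem_torsPart.2 ⟨trivial, (htors _).2 ⟨w, rfl⟩⟩
    · rintro ⟨-, h⟩
      obtain ⟨w, rfl⟩ := (htors v).1 h
      exact ⟨w, trivial, rfl⟩
  rw [h2, Nat.card_congr (Submodule.topEquiv (R := ZMod (p ^ 2)) (M := V)).toEquiv, hcard] at h1
  have h3 : p ^ (2 * n) * p ^ (2 * n) =
      Nat.card (torsPart (⊤ : Submodule (ZMod (p ^ 2)) V)) *
        Nat.card (torsPart (⊤ : Submodule (ZMod (p ^ 2)) V)) := by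
    rw [← h1]
    ring
  exact (Nat.mul_self_inj.1 h3).symm

/-- Since `p ^ 2 = 0`, the submodule `p V` is isotropic, so a Lagrangian inside it fills it. This is
the one case in which no plane can be split off. -/
theorem lagrangian_eq_torsPart {ω : LinearMap.BilinForm (ZMod (p ^ 2)) V}
    (htors : ∀ v : V, (p : ZMod (p ^ 2)) • v = 0 ↔ ∃ w, v = (p : ZMod (p ^ 2)) • w)
    {L : Submodule (ZMod (p ^ 2)) V} (hL : IsLagrangian ω L)
    (hle : ∀ x ∈ L, ∃ y, x = (p : ZMod (p ^ 2)) • y) : L = torsPart ⊤ := by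
  ext v
  constructor
  · intro hv
    exact mem_torsPart.2 ⟨trivial, (htors v).2 (hle v hv)⟩
  · rintro ⟨-, hv⟩
    obtain ⟨w, rfl⟩ := (htors v).1 hv
    rw [hL]
    intro l hl
    obtain ⟨y, rfl⟩ := hle l hl
    rw [map_smul, map_smul, LinearMap.smul_apply, smul_smul, p_sq_eq_zero, zero_smul]

theorem exists_add_of_transvRel {ω : LinearMap.BilinForm (ZMod (p ^ 2)) V} (hω : ω.IsAlt)
    {L L' : Submodule (ZMod (p ^ 2)) V} (hrel : TransvRel ω L L')
    (h : ∀ u, (∀ l ∈ torsPart L, ω l u = 0) → ∃ l ∈ L, ∃ w, u = l + (p : ZMod (p ^ 2)) • w) :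
    ∀ u, (∀ l ∈ torsPart L', ω l u = 0) → ∃ l ∈ L', ∃ w, u = l + (p : ZMod (p ^ 2)) • w := by
  induction hrel with
  | refl => exact h
  | tail _ hs ih =>
    obtain ⟨w, c, rfl⟩ := hs
    intro u hu
    have hinv : transv ω w c (transv ω w (-c) u) = u := by
      have := transv_transv_neg hω w (-c) u
      rwa [neg_neg] at this
    obtain ⟨l, hl, v, hv⟩ := ih (transv ω w (-c) u) (fun l hl => by
      have h1 := hu (transv ω w c l) (by
        rw [torsPart_map _ _ (transv_injective hω w c)]
        exact ⟨l, hl, rfl⟩)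
      rwa [← transv_isometry hω w c, hinv])
    refine ⟨transv ω w c l, ⟨l, hl, rfl⟩, transv ω w c v, ?_⟩
    rw [← map_smul, ← map_add, ← hv, hinv]

/-- A Lagrangian of the extension `H` is either `p H`, of rank `0`, or related to a split one over
some `L'`, of rank `rk L' + 1`. The rank tells the two cases apart and determines the orbit of `L'`,
so classification by rank is inherited. -/
theorem IsSymplecticModPSq.hyp {ω : LinearMap.BilinForm (ZMod (p ^ 2)) V} {n : ℕ}
    (h : IsSymplecticModPSq ω n) : IsSymplecticModPSq (hyp ω) (n + 1) := by
  have hω := hyp_isAlt h.alt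
  have hcard : Nat.card (ZMod (p ^ 2) × V × ZMod (p ^ 2)) = p ^ (4 * (n + 1)) := by
    rw [Nat.card_prod, Nat.card_prod, h.card, Nat.card_zmod]
    ring
  have htors : ∀ v : ZMod (p ^ 2) × V × ZMod (p ^ 2),
      (p : ZMod (p ^ 2)) • v = 0 ↔ ∃ w, v = (p : ZMod (p ^ 2)) • w := by
    rintro ⟨a, v, b⟩
    constructor
    · intro hv
      simp only [Prod.smul_mk, smul_eq_mul, Prod.mk_eq_zero] at hv
      obtain ⟨a', rfl⟩ := (p_mul_eq_zero_iff a).1 hv.1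
      obtain ⟨b', rfl⟩ := (p_mul_eq_zero_iff b).1 hv.2.2
      obtain ⟨v', rfl⟩ := (h.smul_eq_zero_iff v).1 hv.2.1
      exact ⟨(a', v', b'), rfl⟩
    · rintro ⟨w, hw⟩
      rw [hw, smul_smul, p_sq_eq_zero, zero_smul]
  have hcardL : ∀ L, IsLagrangian (SpHecke.hyp ω) L → Nat.card L = p ^ (2 * (n + 1)) := by
    intro L hL
    rcases le_or_transvRel_splitSum h.alt h.perfect hL with hle | ⟨L', hL', hrel⟩
    · rw [lagrangian_eq_torsPart htors hL hle, card_torsPart_top hcard htors]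
    · rw [← hrel.card_eq hω, card_splitSum_zero_one, h.card_lagrangian L' hL']
      ring
  have hrk : ∀ L, IsLagrangian (SpHecke.hyp ω) L →
      p ^ (2 * (n + 1)) = p ^ rk L * Nat.card (torsPart L) := fun L hL =>
    (hcardL L hL) ▸ card_eq_pow_rk_mul (hcardL L hL)
  -- Lying in `p H` means being killed by `p`, i.e. having full torsion; for a fixed order this
  -- depends on the rank alone.
  have hle_iff : ∀ L L', IsLagrangian (SpHecke.hyp ω) L → IsLagrangian (SpHecke.hyp ω) L' →
      rk L = rk L' → (∀ x ∈ L, ∃ y, x = (p : ZMod (p ^ 2)) • y) →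
      ∀ x ∈ L', ∃ y, x = (p : ZMod (p ^ 2)) • y := by
    intro L L' hL hL' hr hle
    have h1 : torsPart L = L := by
      ext x
      exact ⟨fun hx => hx.1, fun hx => ⟨hx, (htors x).2 (hle x hx)⟩⟩
    have h2 : Nat.card (torsPart L') = Nat.card L' := by
      have e1 := hrk L hL
      have e2 := hrk L' hL'
      rw [h1, hcardL L hL] at e1
      rw [← hr] at e2
      rw [hcardL L' hL']
      exact Nat.eq_of_mul_eq_mul_left (pow_pos hp.out.pos (rk L)) (e2.symm.trans e1)
    have h3 : (torsPart L' : Set (ZMod (p ^ 2) × V × ZMod (p ^ 2))) = L' := by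
      refine Set.eq_of_subset_of_ncard_le (fun x hx => (mem_torsPart.1 hx).1) ?_ (Set.toFinite _)
      rw [← Nat.card_coe_set_eq, ← Nat.card_coe_set_eq]
      exact h2.ge
    intro x hx
    rw [← SetLike.mem_coe, ← h3] at hx
    exact (htors x).1 hx.2
  refine ⟨hω, h.perfect.hyp, hcard, htors, hcardL, ?_, ?_⟩
  · intro L hL
    rcases le_or_transvRel_splitSum h.alt h.perfect hL with hle | ⟨L', hL', hrel⟩
    · intro u hu
      suffices hs : ∃ y, u = (p : ZMod (p ^ 2)) • y by
        obtain ⟨y, rfl⟩ := hs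
        exact ⟨0, L.zero_mem, y, by simp⟩
      -- If `u` were outside `p H`, it would pair to a unit with some `z`. Then `p • z`, which lies
      -- in `L = p H`, would pair with `u` to a unit multiple of `p`, which is not zero.
      by_contra hn
      obtain ⟨z, hz⟩ := h.perfect.hyp u hn
      have h1 : (p : ZMod (p ^ 2)) • z ∈ torsPart L := by
        have h2 : (p : ZMod (p ^ 2)) • z ∈ torsPart (⊤ : Submodule (ZMod (p ^ 2)) _) :=
          mem_torsPart.2 ⟨trivial, (htors _).2 ⟨z, rfl⟩⟩
        refine ⟨?_, h2.2⟩
        rw [lagrangian_eq_torsPart htors hL hle]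
        exact h2
      have h2 := hu _ h1
      rw [map_smul, LinearMap.smul_apply, smul_eq_mul, ← hω.neg_eq, mul_neg, neg_eq_zero,
        hz.mul_left_eq_zero] at h2
      exact p_ne_zero h2
    · refine exists_add_of_transvRel hω (hrel.symm hω) ?_
      -- For the split Lagrangian, torsion vectors `(0, l, 0)` control `v`, the torsion vector `(0,
      -- 0, p)` forces `p ∣ a`, and `b` is free.
      rintro ⟨a, v, b⟩ hu
      obtain ⟨l, hl, w, hw⟩ := h.exists_add L' hL' v fun l hl => by
        have := hu (0, l, 0) ⟨⟨dvd_rfl, hl.1, one_dvd _⟩, by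
          have h1 := (mem_torsPart.1 hl).2
          simp [h1]⟩
        simpa [hyp_apply] using this
      obtain ⟨a', rfl⟩ : (p : ZMod (p ^ 2)) ∣ a := by
        have := hu (0, 0, p) ⟨⟨dvd_rfl, L'.zero_mem, one_dvd _⟩, by simp [p_sq_eq_zero]⟩
        rw [← p_mul_eq_zero_iff]
        simpa [hyp_apply] using this
      exact ⟨(0, l, b), ⟨dvd_rfl, hl, one_dvd _⟩, (a', w, 0), by simp [hw]⟩
  · intro L₁ L₂ h₁ h₂ hr
    rcases le_or_transvRel_splitSum h.alt h.perfect h₁ with hle | ⟨L₁', h₁', r₁⟩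
    · rw [lagrangian_eq_torsPart htors h₁ hle,
        lagrangian_eq_torsPart htors h₂ (hle_iff _ _ h₁ h₂ hr hle)]
      exact Relation.ReflTransGen.refl
    rcases le_or_transvRel_splitSum h.alt h.perfect h₂ with hle | ⟨L₂', h₂', r₂⟩
    · rw [lagrangian_eq_torsPart htors h₂ hle,
        lagrangian_eq_torsPart htors h₁ (hle_iff _ _ h₂ h₁ hr.symm hle)]
      exact Relation.ReflTransGen.refl
    have hr' : rk L₁' = rk L₂' := by
      have key : ∀ L', IsLagrangian ω L' → rk (splitSum 0 1 L') = rk L' + 1 := by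
        intro L' hL'
        refine rk_eq_of_card ?_
        rw [card_splitSum_zero_one, card_torsPart_splitSum_zero_one (by norm_num),
          card_eq_pow_rk_mul (h.card_lagrangian L' hL')]
        ring
      have e₁ := r₁.rk_eq hω
      have e₂ := r₂.rk_eq hω
      rw [key _ h₁'] at e₁
      rw [key _ h₂'] at e₂
      omega
    exact r₁.trans (((h.transvRel _ _ h₁' h₂' hr').splitSum h.alt 0 1).trans (r₂.symm hω))

end ModPSq

/-! ### Counting the extensions of a Lagrangian modulo `p ^ 2` by rank. -/

section CountModPSq

variable {p : ℕ} [hp : Fact p.Prime] {V : Type*} [AddCommGroup V] [Module (ZMod (p ^ 2)) V]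
  [Finite V] {ω : LinearMap.BilinForm (ZMod (p ^ 2)) V} {n : ℕ}
  {L : Submodule (ZMod (p ^ 2)) V}

theorem card_eq_mul_of_equiv {α β γ : Type*} {a b : ℕ} (e : α ≃ β × γ) (hβ : Nat.card β = a)
    (hγ : Nat.card γ = b) : Nat.card α = a * b := by
  rw [Nat.card_congr e, Nat.card_prod, hβ, hγ]

theorem card_p_dvd : Nat.card {c : ZMod (p ^ 2) // (p : ZMod (p ^ 2)) ∣ c} = p := by
  have h := card_pow_dvd (p := p) (δ := 2) (d := 1) (by norm_num)
  simpa using h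

theorem IsSymplecticModPSq.pow_eq (h : IsSymplecticModPSq ω n) (hL : IsLagrangian ω L) :
    p ^ (2 * n) = p ^ rk L * Nat.card (torsPart L) :=
  h.card_lagrangian L hL ▸ card_eq_pow_rk_mul (h.card_lagrangian L hL)

theorem rk_splitSum_zero_one (h : IsSymplecticModPSq ω n) (hL : IsLagrangian ω L) :
    rk (splitSum 0 1 L) = rk L + 1 := by
  refine rk_eq_of_card ?_
  rw [card_splitSum_zero_one, card_torsPart_splitSum_zero_one (by norm_num),
    card_eq_pow_rk_mul (h.card_lagrangian L hL)]
  ring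

/-- All extensions with last exponent `2` have the same rank. -/
theorem rk_extend_two (h : IsSymplecticModPSq ω n) (hL : IsLagrangian ω L)
    (g : V × ZMod (p ^ 2)) : rk (extend ω L 2 g) = rk L + 1 := by
  refine rk_eq_of_card ?_
  have hE : Extendable ω L 2 g.1 := fun l _ => by simp
  -- For exponent `2` the generator has first coordinate `1`. A torsion vector is given by its first
  -- coordinate `a`, a multiple of `p`, and a torsion vector of `L`; orthogonality to the generator
  -- then fixes the last coordinate.
  have h1 : Nat.card (torsPart (extend ω L 2 g)) = p * Nat.card (torsPart L) := by
    refine card_eq_mul_of_equiv (β := {c : ZMod (p ^ 2) // (p : ZMod (p ^ 2)) ∣ c})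
      (γ := torsPart L)
      { toFun := fun x => (⟨x.1.1, ?_⟩, ⟨x.1.2.1 - x.1.1 • g.1, ?_⟩)
        invFun := fun y => ⟨(y.1.1, y.2.1 + y.1.1 • g.1, y.1.1 * g.2 - ω y.2.1 g.1), ?_⟩
        left_inv := ?_
        right_inv := ?_ } card_p_dvd rfl
    · have := congrArg (fun y => y.1) (mem_torsPart.1 x.2).2
      exact (p_mul_eq_zero_iff _).1 this
    · obtain ⟨⟨a, v, c⟩, hx⟩ := x
      obtain ⟨⟨⟨s, hs, hs'⟩, -⟩, hx2⟩ := mem_torsPart.1 hx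
      obtain rfl : a = s := by simpa using hs
      simp only [Prod.smul_mk, smul_eq_mul, Prod.mk_eq_zero] at hx2
      refine mem_torsPart.2 ⟨hs', ?_⟩
      rw [smul_sub, hx2.2.1, smul_smul, hx2.1, zero_smul, sub_zero]
    · obtain ⟨⟨a, ha⟩, ⟨v, hv⟩⟩ := y
      rw [← p_mul_eq_zero_iff] at ha
      have hv' := mem_torsPart.1 hv
      refine mem_torsPart.2 ⟨⟨⟨a, by simp, by simpa using hv'.1⟩, ?_⟩, ?_⟩
      · simp only [hyp_apply, map_add, map_smul, LinearMap.add_apply, LinearMap.smul_apply,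
          h.alt g.1]
        simp
      · have hω : (p : ZMod (p ^ 2)) * ω v g.1 = 0 := by
          rw [← smul_eq_mul, ← LinearMap.smul_apply, ← map_smul, hv'.2, map_zero,
            LinearMap.zero_apply]
        simp only [Prod.smul_mk, smul_eq_mul, Prod.mk_eq_zero]
        refine ⟨ha, ?_, ?_⟩
        · rw [smul_add, hv'.2, smul_smul, ha, zero_smul, add_zero]
        · linear_combination g.2 * ha - hω
    · rintro ⟨⟨a, v, c⟩, hx⟩
      have hx' := (mem_torsPart.1 hx).1.2
      simp only [hyp_apply, Nat.sub_self, pow_zero, mul_one] at hx'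
      refine Subtype.ext ?_
      simp only [map_sub, map_smul, LinearMap.sub_apply, LinearMap.smul_apply, h.alt g.1,
        sub_add_cancel, Prod.mk.injEq, true_and, smul_zero, sub_zero]
      linear_combination -hx'
    · rintro ⟨⟨a, ha⟩, ⟨v, hv⟩⟩
      simp
  rw [h.hyp.card_lagrangian _ (extend_isLagrangian h.alt hL le_rfl hE), h1, mul_add, pow_add,
    h.pow_eq hL]
  ring

/-- Divisibility of `ω l u` by `p` means that `p` kills it, so extendability says that `p • u` is
orthogonal to `L`. -/
theorem extendable_one_iff (h : IsSymplecticModPSq ω n) (hL : IsLagrangian ω L) (u : V) :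
    Extendable ω L 1 u ↔ (p : ZMod (p ^ 2)) • u ∈ L := by
  constructor
  · intro hu
    have := hu.smul_mem (g := (u, 0)) h.alt hL (by norm_num)
    simpa using this
  · intro hu l hl
    have h1 := hL.apply_eq_zero hl hu
    rw [map_smul, smul_eq_mul, p_mul_eq_zero_iff] at h1
    simpa using h1

/-- The condition for the extension by `g` with last exponent `1` to have the same rank. -/
def KeepsRank (ω : LinearMap.BilinForm (ZMod (p ^ 2)) V) (L : Submodule (ZMod (p ^ 2)) V)
    (g : V × ZMod (p ^ 2)) : Prop :=
  ∃ v, (p : ZMod (p ^ 2)) • v = 0 ∧ v - g.1 ∈ L ∧ ω v g.1 = p * g.2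

theorem mem_sup_torsPart_iff (u : V) :
    u ∈ L ⊔ torsPart ⊤ ↔ ∃ v, (p : ZMod (p ^ 2)) • v = 0 ∧ v - u ∈ L := by
  rw [Submodule.mem_sup]
  constructor
  · rintro ⟨l, hl, v, hv, rfl⟩
    exact ⟨v, (mem_torsPart.1 hv).2, by simpa using hl⟩
  · rintro ⟨v, hv, hvu⟩
    exact ⟨-(v - u), L.neg_mem hvu, v, mem_torsPart.2 ⟨trivial, hv⟩, by simp⟩

theorem apply_eq_zero_of_mem_sup (h : IsSymplecticModPSq ω n) (hL : IsLagrangian ω L) {u v : V}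
    (hu : u ∈ L ⊔ torsPart ⊤) (hv : v ∈ torsPart L) : ω v u = 0 := by
  obtain ⟨l, hl, w, hw, rfl⟩ := Submodule.mem_sup.1 hu
  obtain ⟨w', rfl⟩ := (h.smul_eq_zero_iff w).1 (mem_torsPart.1 hw).2
  rw [map_add, hL.apply_eq_zero hv.1 hl, map_smul, ← LinearMap.smul_apply, ← map_smul,
    (mem_torsPart.1 hv).2, map_zero, LinearMap.zero_apply, add_zero]

/-- A torsion vector `(0, v, c)` has `c` divisible by `p`, so `c` drops out of the orthogonality to
the generator and only `ω v g.1 = 0` remains. -/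
theorem card_torsPart_extend_ker (g : V × ZMod (p ^ 2))
    (hg : (p : ZMod (p ^ 2)) • g.1 ∈ L) :
    Nat.card (torsPart (extend ω L 1 g) ⊓ LinearMap.ker (LinearMap.fst (ZMod (p ^ 2))
      (ZMod (p ^ 2)) (V × ZMod (p ^ 2))) : Submodule _ _) =
    p * Nat.card (torsPart L ⊓ LinearMap.ker (ω.flip g.1) : Submodule _ _) := by
  have key : ∀ v c, ((0 : ZMod (p ^ 2)), v, c) ∈ torsPart (extend ω L 1 g) ↔
      (p : ZMod (p ^ 2)) ∣ c ∧ v ∈ torsPart L ⊓ LinearMap.ker (ω.flip g.1) := by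
    intro v c
    rw [mem_torsPart, mem_extend]
    simp only [Prod.smul_mk, smul_eq_mul, Prod.mk_eq_zero, mul_zero, true_and, hyp_apply, zero_mul,
      sub_zero, Submodule.mem_inf, mem_torsPart, LinearMap.mem_ker, LinearMap.BilinForm.flip_apply,
      p_mul_eq_zero_iff, Nat.add_one_sub_one, pow_one]
    constructor
    · rintro ⟨⟨⟨s, hs, hs'⟩, hx⟩, hv, hc⟩
      have h1 : s • g.1 ∈ L := by
        obtain ⟨s', rfl⟩ := (p_mul_eq_zero_iff s).1 (by rw [mul_comm, ← hs])
        rw [mul_comm, mul_smul]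
        exact L.smul_mem _ hg
      refine ⟨hc, ⟨by simpa using L.add_mem hs' h1, hv⟩, ?_⟩
      have h2 := (p_mul_eq_zero_iff c).2 hc
      linear_combination hx - h2
    · rintro ⟨hc, ⟨hv, hv'⟩, hx⟩
      refine ⟨⟨⟨0, by simp, by simpa using hv⟩, ?_⟩, hv', hc⟩
      have h2 := (p_mul_eq_zero_iff c).2 hc
      linear_combination hx + h2
  refine card_eq_mul_of_equiv (β := {c : ZMod (p ^ 2) // (p : ZMod (p ^ 2)) ∣ c})
    (γ := (torsPart L ⊓ LinearMap.ker (ω.flip g.1) : Submodule _ _))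
    { toFun := fun x => (⟨x.1.2.2, ?_⟩, ⟨x.1.2.1, ?_⟩)
      invFun := fun y => ⟨(0, y.2.1, y.1.1), (key _ _).2 ⟨y.1.2, y.2.2⟩, rfl⟩
      left_inv := ?_
      right_inv := fun _ => rfl } card_p_dvd rfl
  · obtain ⟨⟨a, v, c⟩, hx, ha⟩ := x
    obtain rfl : a = 0 := ha
    exact ((key _ _).1 hx).1
  · obtain ⟨⟨a, v, c⟩, hx, ha⟩ := x
    obtain rfl : a = 0 := ha
    exact ((key _ _).1 hx).2
  · rintro ⟨⟨a, v, c⟩, hx, ha⟩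
    obtain rfl : a = 0 := ha
    rfl

theorem card_eq_of_mem_iff_p_dvd {I : Ideal (ZMod (p ^ 2))}
    (hI : ∀ a ∈ I, (p : ZMod (p ^ 2)) ∣ a) (hI' : ∃ a ∈ I, a ≠ 0) : Nat.card I = p := by
  obtain ⟨a, ha, hne⟩ := hI'
  obtain ⟨e, rfl⟩ := hI a ha
  have he : IsUnit e := isUnit_of_not_dvd (by
    rintro ⟨e', rfl⟩
    exact hne (by rw [← mul_assoc, p_sq_eq_zero, zero_mul]))
  obtain ⟨e, rfl⟩ := he
  have hpI : (p : ZMod (p ^ 2)) ∈ I := by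
    have := I.mul_mem_right (↑e⁻¹) ha
    simpa using this
  refine (Nat.card_congr (Equiv.subtypeEquivRight fun a => ⟨hI a, ?_⟩)).trans card_p_dvd
  rintro ⟨c, rfl⟩
  exact I.mul_mem_right c hpI

/-- First coordinates of torsion vectors lie in the ideal of `p`, so they form either that ideal or
zero. `KeepsRank` is the condition that some `(p, v, 0)` is a torsion vector of the extension; a
torsion vector with nonzero first coordinate can be rescaled by a unit to first coordinate `p`, and
its last coordinate does not matter. -/
theorem card_torsPart_extend_fst (g : V × ZMod (p ^ 2)) :
    (KeepsRank ω L g → Nat.card ((torsPart (extend ω L 1 g)).map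
      (LinearMap.fst (ZMod (p ^ 2)) (ZMod (p ^ 2)) (V × ZMod (p ^ 2)))) = p) ∧
    (¬ KeepsRank ω L g → Nat.card ((torsPart (extend ω L 1 g)).map
      (LinearMap.fst (ZMod (p ^ 2)) (ZMod (p ^ 2)) (V × ZMod (p ^ 2)))) = 1) := by
  constructor
  · rintro ⟨v, hv, hvg, hω⟩
    refine card_eq_of_mem_iff_p_dvd ?_ ⟨p, ⟨(p, v, 0), mem_torsPart.2 ⟨⟨⟨1, by simp, by simpa using
      hvg⟩, ?_⟩, ?_⟩, rfl⟩, p_ne_zero⟩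
    · rintro _ ⟨x, hx, rfl⟩
      exact (p_mul_eq_zero_iff _).1 (congrArg (fun y => y.1) (mem_torsPart.1 hx).2)
    · simp [hyp_apply, hω]
    · simp [p_sq_eq_zero, hv]
  · intro hn
    rw [Nat.card_eq_one_iff_unique]
    suffices hs : (torsPart (extend ω L 1 g)).map
        (LinearMap.fst (ZMod (p ^ 2)) (ZMod (p ^ 2)) (V × ZMod (p ^ 2))) = ⊥ by
      rw [hs]
      exact ⟨inferInstance, inferInstance⟩
    rw [eq_bot_iff]
    rintro _ ⟨⟨a, v, c⟩, hx, rfl⟩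
    obtain ⟨⟨⟨s, hs, hs'⟩, hx1⟩, hx2⟩ := mem_torsPart.1 hx
    simp only [Nat.add_one_sub_one, pow_one] at hs hs' hx1
    simp only [LinearMap.fst_apply, Submodule.mem_bot]
    by_contra hne
    have hsu : IsUnit s := isUnit_of_not_dvd (by
      rintro ⟨s', rfl⟩
      exact hne (by rw [hs, mul_comm, ← mul_assoc, p_sq_eq_zero, zero_mul]))
    obtain ⟨s, rfl⟩ := hsu
    simp only [Prod.smul_mk, smul_eq_mul, Prod.mk_eq_zero] at hx2
    refine hn ⟨(↑s⁻¹ : ZMod (p ^ 2)) • v, ?_, ?_, ?_⟩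
    · rw [smul_comm, hx2.2.1, smul_zero]
    · have := L.smul_mem (↑s⁻¹) hs'
      rwa [smul_sub, smul_smul, Units.inv_mul, one_smul] at this
    · simp only [hyp_apply, hs] at hx1
      rw [map_smul, LinearMap.smul_apply, smul_eq_mul]
      have h3 : ω v g.1 = s * p * g.2 := by linear_combination hx1 - hx2.2.2
      rw [h3, ← mul_assoc, ← mul_assoc, Units.inv_mul, one_mul]

/-- As `p • u ∈ L`, pairing with `u` takes values in the ideal of `p` on the torsion of `L`. It is
either zero, which happens for `u` in `L + p V`, or onto that ideal of order `p`. -/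
theorem card_torsPart_inf_ker (h : IsSymplecticModPSq ω n) (hL : IsLagrangian ω L) {u : V}
    (hu : (p : ZMod (p ^ 2)) • u ∈ L) :
    (u ∈ L ⊔ torsPart ⊤ → torsPart L ⊓ LinearMap.ker (ω.flip u) = torsPart L) ∧
    (u ∉ L ⊔ torsPart ⊤ → Nat.card (torsPart L) =
      p * Nat.card (torsPart L ⊓ LinearMap.ker (ω.flip u) : Submodule _ _)) := by
  constructor
  · intro hmem
    rw [inf_eq_left]
    intro v hv
    exact apply_eq_zero_of_mem_sup h hL hmem hv
  · intro hn
    rw [card_eq_map_mul_inf_ker (torsPart L) (ω.flip u)]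
    congr 1
    refine card_eq_of_mem_iff_p_dvd ?_ ?_
    · rintro _ ⟨v, hv, rfl⟩
      have h1 := hL.apply_eq_zero (mem_torsPart.1 hv).1 hu
      rw [map_smul, smul_eq_mul] at h1
      exact (p_mul_eq_zero_iff _).1 h1
    · by_contra hno
      push Not at hno
      obtain ⟨l, hl, w, hw⟩ := h.exists_add L hL u fun v hv => hno _ ⟨v, hv, rfl⟩
      exact hn (Submodule.mem_sup.2 ⟨l, hl, (p : ZMod (p ^ 2)) • w,
        mem_torsPart.2 ⟨trivial, (h.smul_eq_zero_iff _).2 ⟨w, rfl⟩⟩, hw.symm⟩)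

/-- The rank of an extension with last exponent `1`. -/
theorem rk_extend_one (h : IsSymplecticModPSq ω n) (hL : IsLagrangian ω L) {g : V × ZMod (p ^ 2)}
    (hg : Extendable ω L 1 g.1) :
    (KeepsRank ω L g → rk (extend ω L 1 g) = rk L) ∧
    (g.1 ∈ L ⊔ torsPart ⊤ → ¬ KeepsRank ω L g → rk (extend ω L 1 g) = rk L + 1) ∧
    (g.1 ∉ L ⊔ torsPart ⊤ → rk (extend ω L 1 g) = rk L + 2) := by
  have hu := (extendable_one_iff h hL g.1).1 hg
  -- The torsion of the extension is counted by first coordinate: the image has order `p` or `1`,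
  -- and the kernel has `p` times either all of the torsion of `L` or a `p`-th part of it. The whole
  -- extension has `p ^ 2` times the order of `L`.
  have h1 := card_eq_map_mul_inf_ker (torsPart (extend ω L 1 g))
    (LinearMap.fst (ZMod (p ^ 2)) (ZMod (p ^ 2)) (V × ZMod (p ^ 2)))
  rw [card_torsPart_extend_ker g hu] at h1
  obtain ⟨hf1, hf2⟩ := card_torsPart_extend_fst (ω := ω) (L := L) g
  obtain ⟨hk1, hk2⟩ := card_torsPart_inf_ker h hL hu
  have hc := h.hyp.card_lagrangian _ (extend_isLagrangian h.alt hL (by norm_num) hg)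
  rw [mul_add, pow_add, h.pow_eq hL] at hc
  refine ⟨fun hB => rk_eq_of_card ?_, fun hU hB => rk_eq_of_card ?_, fun hU => rk_eq_of_card ?_⟩
  · have hU : g.1 ∈ L ⊔ torsPart ⊤ := by
      obtain ⟨v, hv, hvg, -⟩ := hB
      exact (mem_sup_torsPart_iff _).2 ⟨v, hv, hvg⟩
    rw [hc, h1, hf1 hB, hk1 hU]
    ring
  · rw [hc, h1, hf2 hB, hk1 hU]
    ring
  · have hB : ¬ KeepsRank ω L g := by
      rintro ⟨v, hv, hvg, -⟩
      exact hU ((mem_sup_torsPart_iff _).2 ⟨v, hv, hvg⟩)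
    rw [hc, h1, hf2 hB, ← hk2 hU]
    ring

/-- Multiplication by `p` maps the admissible `u` onto the torsion of `L`, every torsion vector
being divisible by `p`, with kernel the full torsion of `V`. The coordinate `g.2` is free. -/
theorem card_extendable (h : IsSymplecticModPSq ω n) (hL : IsLagrangian ω L) :
    Nat.card {g : V × ZMod (p ^ 2) // Extendable ω L 1 g.1} =
      Nat.card (torsPart L) * p ^ (2 * n) * p ^ 2 := by
  let P := L.comap (LinearMap.lsmul (ZMod (p ^ 2)) V (p : ZMod (p ^ 2)))
  have h1 : Nat.card {g : V × ZMod (p ^ 2) // Extendable ω L 1 g.1} = Nat.card P * p ^ 2 :=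
    card_eq_mul_of_equiv (β := P) (γ := ZMod (p ^ 2))
      { toFun := fun g => (⟨g.1.1, (extendable_one_iff h hL _).1 g.2⟩, g.1.2)
        invFun := fun y => ⟨(y.1.1, y.2), (extendable_one_iff h hL _).2 y.1.2⟩
        left_inv := fun _ => rfl
        right_inv := fun _ => rfl } rfl (Nat.card_zmod _)
  have h2 : P.map (LinearMap.lsmul (ZMod (p ^ 2)) V (p : ZMod (p ^ 2))) = torsPart L := by
    ext v
    constructor
    · rintro ⟨w, hw, rfl⟩
      exact mem_torsPart.2 ⟨hw, (h.smul_eq_zero_iff _).2 ⟨w, rfl⟩⟩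
    · intro hv
      obtain ⟨w, rfl⟩ := (h.smul_eq_zero_iff v).1 (mem_torsPart.1 hv).2
      exact ⟨w, hv.1, rfl⟩
  have h3 : torsPart P = torsPart ⊤ := by
    ext v
    refine ⟨fun hv => ⟨trivial, hv.2⟩, fun hv => ⟨?_, hv.2⟩⟩
    have := (mem_torsPart.1 hv).2
    change (p : ZMod (p ^ 2)) • v ∈ L
    rw [this]
    exact L.zero_mem
  rw [h1, card_eq_mul_torsPart P, h2, h3, card_torsPart_top h.card h.smul_eq_zero_iff]

/-- Adding the torsion of `V` does not change the image under `p` and makes the kernel the full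
torsion. -/
theorem card_sup_torsPart (h : IsSymplecticModPSq ω n) (hL : IsLagrangian ω L) :
    Nat.card (L ⊔ torsPart ⊤ : Submodule (ZMod (p ^ 2)) V) = p ^ rk L * p ^ (2 * n) := by
  have h2 : (L ⊔ torsPart ⊤).map (LinearMap.lsmul (ZMod (p ^ 2)) V (p : ZMod (p ^ 2))) =
      L.map (LinearMap.lsmul (ZMod (p ^ 2)) V (p : ZMod (p ^ 2))) := by
    rw [Submodule.map_sup, sup_eq_left]
    rintro _ ⟨v, hv, rfl⟩
    have := (mem_torsPart.1 hv).2
    rw [LinearMap.lsmul_apply, this]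
    exact Submodule.zero_mem _
  have h3 : torsPart (L ⊔ torsPart ⊤) = torsPart (⊤ : Submodule (ZMod (p ^ 2)) V) := by
    ext v
    exact ⟨fun hv => ⟨trivial, hv.2⟩, fun hv => ⟨(le_sup_right : torsPart ⊤ ≤ L ⊔ torsPart ⊤) hv,
      hv.2⟩⟩
  have h4 := card_eq_mul_torsPart L
  rw [card_eq_pow_rk_mul (h.card_lagrangian L hL)] at h4
  rw [card_eq_mul_torsPart, h2, h3, card_torsPart_top h.card h.smul_eq_zero_iff,
    Nat.eq_of_mul_eq_mul_right Nat.card_pos h4]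

theorem card_mem_sup (h : IsSymplecticModPSq ω n) (hL : IsLagrangian ω L) :
    Nat.card {g : V × ZMod (p ^ 2) // g.1 ∈ L ⊔ torsPart ⊤} = p ^ rk L * p ^ (2 * n) * p ^ 2 :=
  card_eq_mul_of_equiv (β := (L ⊔ torsPart ⊤ : Submodule (ZMod (p ^ 2)) V)) (γ := ZMod (p ^ 2))
    { toFun := fun g => (⟨g.1.1, g.2⟩, g.1.2)
      invFun := fun y => ⟨(y.1.1, y.2), y.1.2⟩
      left_inv := fun _ => rfl
      right_inv := fun _ => rfl } (card_sup_torsPart h hL) (Nat.card_zmod _)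

/-- For fixed `u` in `L + p V`, write the torsion vector as `p • w`. It is unique up to the torsion
of `L`, which is orthogonal to `u`. The condition becomes `p * b = p * ω w u`, so `b` runs through
one residue class modulo `p`. -/
theorem card_keepsRank (h : IsSymplecticModPSq ω n) (hL : IsLagrangian ω L) :
    Nat.card {g : V × ZMod (p ^ 2) // KeepsRank ω L g} = p ^ rk L * p ^ (2 * n) * p := by
  have hfib : ∀ u : (L ⊔ torsPart ⊤ : Submodule (ZMod (p ^ 2)) V),
      ∃ e, ∀ b, KeepsRank ω L (u.1, b) ↔ (p : ZMod (p ^ 2)) ∣ b - e := by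
    rintro ⟨u, hu⟩
    obtain ⟨v, hv, hvu⟩ := (mem_sup_torsPart_iff u).1 hu
    obtain ⟨w, rfl⟩ := (h.smul_eq_zero_iff v).1 hv
    refine ⟨ω w u, fun b => ?_⟩
    rw [← p_mul_eq_zero_iff]
    constructor
    · rintro ⟨v', hv', hvu', hω⟩
      have h1 := apply_eq_zero_of_mem_sup h hL hu (v := v' - (p : ZMod (p ^ 2)) • w)
        (mem_torsPart.2 ⟨by simpa using L.sub_mem hvu' hvu, by rw [smul_sub, hv, hv', sub_zero]⟩)
      rw [map_sub, LinearMap.sub_apply, map_smul, LinearMap.smul_apply, smul_eq_mul] at h1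
      linear_combination h1 - hω
    · intro hb
      refine ⟨(p : ZMod (p ^ 2)) • w, hv, hvu, ?_⟩
      rw [map_smul, LinearMap.smul_apply, smul_eq_mul]
      linear_combination -hb
  choose e he using hfib
  refine card_eq_mul_of_equiv (β := (L ⊔ torsPart ⊤ : Submodule (ZMod (p ^ 2)) V))
    (γ := {c : ZMod (p ^ 2) // (p : ZMod (p ^ 2)) ∣ c})
    { toFun := fun g => (⟨g.1.1, ?_⟩, ⟨g.1.2 - e ⟨g.1.1, ?_⟩, ?_⟩)
      invFun := fun y => ⟨(y.1.1, y.2.1 + e y.1), ?_⟩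
      left_inv := ?_
      right_inv := ?_ } (card_sup_torsPart h hL) card_p_dvd
  · obtain ⟨v, hv, hvg, -⟩ := g.2
    exact (mem_sup_torsPart_iff _).2 ⟨v, hv, hvg⟩
  · obtain ⟨v, hv, hvg, -⟩ := g.2
    exact (mem_sup_torsPart_iff _).2 ⟨v, hv, hvg⟩
  · exact (he ⟨g.1.1, _⟩ _).1 g.2
  · rw [he]
    simpa using y.2.2
  · intro g
    simp
  · intro y
    simp

open Classical in
/-- The extensions of a Lagrangian, counted by last exponent and rank. -/
theorem IsSymplecticModPSq.sum_over (h : IsSymplecticModPSq ω n) {A : Type*} [CommRing A] (y : A)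
    (φ : ℕ → A) (hL : IsLagrangian ω L) :
    ∑ L' with IsLagrangian (SpHecke.hyp ω) L' ∧ red L' = L, y ^ lastExp L' * φ (rk L') =
      (1 + p ^ (2 * n + 2) * y ^ 2) * φ (rk L + 1) +
      y * (p ^ rk L * φ (rk L) + (p ^ (rk L + 1) - p ^ rk L) * φ (rk L + 1) +
        (p ^ (2 * n - rk L + 1) - p ^ (rk L + 1)) * φ (rk L + 2)) := by
  have hpos : 0 < p := hp.out.pos
  have hpow := h.pow_eq hL
  have hrk : rk L ≤ 2 * n :=
    (Nat.pow_dvd_pow_iff_le_right hp.out.one_lt).1 ⟨_, hpow⟩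
  have hT : Nat.card (torsPart L) = p ^ (2 * n - rk L) := by
    refine Nat.eq_of_mul_eq_mul_left (pow_pos hpos (rk L)) ?_
    rw [← hpow, ← pow_add, Nat.add_sub_cancel' hrk]
  have hcardL := h.card_lagrangian L hL
  -- Division by the number `p ^ (2 * n) * p ^ (2 - d)` of generators of each extension turns a
  -- count of generators into a count of Lagrangians.
  have hcard : ∀ (P : _ → Prop) [DecidablePred P] (d m : ℕ), d ≤ 2 →
      Nat.card {g : V × ZMod (p ^ 2) // Extendable ω L d g.1 ∧ P (extend ω L d g)} =
        m * (p ^ (2 * n) * p ^ (2 - d)) →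
      ∑ L' with IsLagrangian (SpHecke.hyp ω) L' ∧ red L' = L ∧ lastExp L' = d,
        (if P L' then (1 : A) else 0) = m := by
    intro P _ d m hd hm
    have h1 := card_over_mul h.alt hL hd P
    rw [hm, hcardL] at h1
    have h2 := Nat.eq_of_mul_eq_mul_right (by positivity) h1
    rw [← h2, Nat.card_eq_fintype_card, Fintype.card_subtype, Finset.sum_boole,
      Finset.filter_filter]
    congr 2
    ext L'
    simp only [Finset.mem_filter, Finset.mem_univ, true_and, and_assoc]
  have htwo := hcard (fun _ => True) 2 (p ^ (2 * n + 2)) le_rfl (by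
    rw [Nat.card_congr (β := V × ZMod (p ^ 2))
      (Equiv.subtypeUnivEquiv fun g => ⟨fun l _ => by simp, trivial⟩), Nat.card_prod, h.card,
      Nat.card_zmod]
    ring)
  have hall := hcard (fun _ => True) 1 (p ^ (2 * n - rk L + 1)) (by norm_num) (by
    simp only [and_true]
    rw [card_extendable h hL, hT]
    ring)
  have hU : ∀ g : V × ZMod (p ^ 2), g.1 ∈ L ⊔ torsPart ⊤ → Extendable ω L 1 g.1 := by
    intro g hg
    rw [extendable_one_iff h hL]
    obtain ⟨l, hl, v, hv, hlv⟩ := Submodule.mem_sup.1 hg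
    have h1 := (mem_torsPart.1 hv).2
    rw [← hlv, smul_add, h1, add_zero]
    exact L.smul_mem _ hl
  have hKU : ∀ g : V × ZMod (p ^ 2), KeepsRank ω L g → g.1 ∈ L ⊔ torsPart ⊤ := by
    rintro g ⟨v, hv, hvg, -⟩
    exact (mem_sup_torsPart_iff _).2 ⟨v, hv, hvg⟩
  have hle := hcard (fun L' => rk L' ≤ rk L + 1) 1 (p ^ (rk L + 1)) (by norm_num) (by
    rw [Nat.card_congr (Equiv.subtypeEquivRight (q := fun g => g.1 ∈ L ⊔ torsPart ⊤) fun g => ?_),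
      card_mem_sup h hL]
    · ring
    constructor
    · rintro ⟨hg, hr⟩
      by_contra hn
      have := (rk_extend_one h hL hg).2.2 hn
      omega
    · intro hg
      refine ⟨hU g hg, ?_⟩
      have h1 := rk_extend_one h hL (hU g hg)
      by_cases hK : KeepsRank ω L g
      · rw [h1.1 hK]
        omega
      · rw [h1.2.1 hg hK])
  have heq := hcard (fun L' => rk L' = rk L) 1 (p ^ rk L) (by norm_num) (by
    rw [Nat.card_congr (Equiv.subtypeEquivRight (q := fun g => KeepsRank ω L g) fun g => ?_),
      card_keepsRank h hL]
    · ring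
    constructor
    · rintro ⟨hg, hr⟩
      by_contra hK
      have h1 := rk_extend_one h hL hg
      by_cases hg' : g.1 ∈ L ⊔ torsPart ⊤
      · have := h1.2.1 hg' hK
        omega
      · have := h1.2.2 hg'
        omega
    · intro hK
      exact ⟨hU g (hKU g hK), (rk_extend_one h hL (hU g (hKU g hK))).1 hK⟩)
  have hgen : ∀ L', IsLagrangian (SpHecke.hyp ω) L' → red L' = L → ∃ g,
      Extendable ω L (lastExp L') g.1 ∧ extend ω L (lastExp L') g = L' := by
    intro L' h1 h2
    obtain ⟨⟨u, b, hg⟩, -⟩ := exists_generator h1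
    have := extendable_and_eq_extend h.alt h1 (g := (u, b)) hg
    rw [h2] at this
    exact ⟨_, this⟩
  have hsplit : ∀ f : Submodule (ZMod (p ^ 2)) (ZMod (p ^ 2) × V × ZMod (p ^ 2)) → A,
      ∑ L' with IsLagrangian (SpHecke.hyp ω) L' ∧ red L' = L, f L' =
      ∑ d ∈ Finset.range 3, ∑ L' with IsLagrangian (SpHecke.hyp ω) L' ∧ red L' = L ∧
        lastExp L' = d, f L' := by
    intro f
    rw [← Finset.sum_fiberwise_of_maps_to (g := lastExp) (t := Finset.range 3)
      (fun L' _ => Finset.mem_range.2 (by have := lastExp_le L'; omega))]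
    refine Finset.sum_congr rfl fun d _ => ?_
    rw [Finset.filter_filter]
    simp only [and_assoc]
  rw [hsplit, Finset.sum_range_succ, Finset.sum_range_succ, Finset.sum_range_one]
  have e0 : ∑ L' with IsLagrangian (SpHecke.hyp ω) L' ∧ red L' = L ∧ lastExp L' = 0,
      y ^ lastExp L' * φ (rk L') = φ (rk L + 1) := by
    rw [Finset.sum_eq_single (splitSum 0 1 L)]
    · rw [lastExp_splitSum_zero_one, pow_zero, one_mul, rk_splitSum_zero_one h hL]
    · intro L' hL' hne
      simp only [Finset.mem_filter, Finset.mem_univ, true_and] at hL'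
      have := eq_splitSum_zero_one hL'.1 hL'.2.2
      rw [hL'.2.1] at this
      exact absurd this hne
    · intro hn
      exact absurd (Finset.mem_filter.2 ⟨Finset.mem_univ _,
        splitSum_zero_one_isLagrangian hL, red_splitSum _ _ _, lastExp_splitSum_zero_one L⟩) hn
  have e2 : ∑ L' with IsLagrangian (SpHecke.hyp ω) L' ∧ red L' = L ∧ lastExp L' = 2,
      y ^ lastExp L' * φ (rk L') = p ^ (2 * n + 2) * y ^ 2 * φ (rk L + 1) := by
    rw [Finset.sum_congr rfl (g := fun _ => y ^ 2 * φ (rk L + 1) * if True then 1 else 0),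
      ← Finset.mul_sum, htwo]
    · push_cast
      ring
    · intro L' hL'
      simp only [Finset.mem_filter, Finset.mem_univ, true_and] at hL'
      obtain ⟨g, -, hg⟩ := hgen L' hL'.1 hL'.2.1
      rw [hL'.2.2] at hg
      rw [hL'.2.2, ← hg, rk_extend_two h hL, if_pos trivial, mul_one]
  have e1 : ∑ L' with IsLagrangian (SpHecke.hyp ω) L' ∧ red L' = L ∧ lastExp L' = 1,
      y ^ lastExp L' * φ (rk L') = y * (p ^ rk L * φ (rk L) +
        (p ^ (rk L + 1) - p ^ rk L) * φ (rk L + 1) +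
        (p ^ (2 * n - rk L + 1) - p ^ (rk L + 1)) * φ (rk L + 2)) := by
    -- The ranks form the nested conditions "any", "at most `rk L + 1`" and "equal to `rk L`", so
    -- `φ` is written by summation by parts in terms of their indicators, whose sums are `hall`,
    -- `hle` and `heq`.
    rw [Finset.sum_congr rfl (g := fun L' => y * φ (rk L + 2) * (if True then 1 else 0) +
      (y * (φ (rk L + 1) - φ (rk L + 2)) * (if rk L' ≤ rk L + 1 then 1 else 0) +
        y * (φ (rk L) - φ (rk L + 1)) * if rk L' = rk L then 1 else 0))]
    · rw [Finset.sum_add_distrib, Finset.sum_add_distrib, ← Finset.mul_sum, ← Finset.mul_sum,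
        ← Finset.mul_sum, hall, hle, heq]
      push_cast
      ring
    · intro L' hL'
      simp only [Finset.mem_filter, Finset.mem_univ, true_and] at hL'
      obtain ⟨g, hg', hg⟩ := hgen L' hL'.1 hL'.2.1
      rw [hL'.2.2] at hg hg'
      have h1 := rk_extend_one h hL hg'
      rw [hg] at h1
      rw [hL'.2.2, pow_one, if_pos trivial]
      by_cases hm : g.1 ∈ L ⊔ torsPart ⊤
      · by_cases hK : KeepsRank ω L g
        · rw [h1.1 hK, if_pos (Nat.le_succ _), if_pos rfl]
          ring
        · rw [h1.2.1 hm hK, if_pos le_rfl, if_neg (by omega)]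
          ring
      · rw [h1.2.2 hm, if_neg (by omega), if_neg (by omega)]
        ring
  rw [e0, e1, e2]
  ring

open Classical in
theorem IsSymplecticModPSq.sum_hyp (h : IsSymplecticModPSq ω n) {A : Type*} [CommRing A] (y : A)
    (W : Submodule (ZMod (p ^ 2)) V → A) (φ : ℕ → A) :
    ∑ L with IsLagrangian (SpHecke.hyp ω) L, W (red L) * y ^ lastExp L * φ (rk L) =
      ∑ L with IsLagrangian ω L, W L * ((1 + p ^ (2 * n + 2) * y ^ 2) * φ (rk L + 1) +
      y * (p ^ rk L * φ (rk L) + (p ^ (rk L + 1) - p ^ rk L) * φ (rk L + 1) +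
        (p ^ (2 * n - rk L + 1) - p ^ (rk L + 1)) * φ (rk L + 2))) := by
  rw [← Finset.sum_fiberwise_of_maps_to (g := red)
    (t := Finset.univ.filter fun L => IsLagrangian ω L)
    (fun L hL => by
      simp only [Finset.mem_filter, Finset.mem_univ, true_and] at hL ⊢
      exact hL.red)]
  refine Finset.sum_congr rfl fun L hL => ?_
  simp only [Finset.mem_filter, Finset.mem_univ, true_and] at hL
  rw [← h.sum_over y φ hL, Finset.filter_filter, Finset.mul_sum]
  refine Finset.sum_congr rfl fun L' hL' => ?_
  simp only [Finset.mem_filter, Finset.mem_univ, true_and] at hL'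
  rw [hL'.2, mul_assoc]

end CountModPSq

/-! ## Integral symplectic matrices in the group of similitudes -/

section Integral

variable {n p : ℕ} [hp : Fact p.Prime]

theorem p_ratCast_ne_zero : (p : ℚ) ≠ 0 := by exact_mod_cast hp.out.ne_zero

theorem map_mul_map_inv {N : Matrix (Fin n ⊕ Fin n) (Fin n ⊕ Fin n) ℤ}
    (hN : N ∈ symplecticGroup (Fin n) ℤ) :
    N.map (Int.castRingHom ℚ) *
      ((⟨N, hN⟩ : symplecticGroup (Fin n) ℤ)⁻¹ : symplecticGroup (Fin n) ℤ).1.map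
        (Int.castRingHom ℚ) = 1 := by
  rw [← Matrix.map_mul]
  have h : N * ((⟨N, hN⟩ : symplecticGroup (Fin n) ℤ)⁻¹ : symplecticGroup (Fin n) ℤ).1 = 1 :=
    congrArg Subtype.val (mul_inv_cancel (⟨N, hN⟩ : symplecticGroup (Fin n) ℤ))
  rw [h, Matrix.map_one _ (map_zero _) (map_one _)]

/-- An integral symplectic matrix as an element of `simGroup n p`. -/
noncomputable def ofSp (N : Matrix (Fin n ⊕ Fin n) (Fin n ⊕ Fin n) ℤ)
    (hN : N ∈ symplecticGroup (Fin n) ℤ) : simGroup n p :=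
  ⟨⟨N.map (Int.castRingHom ℚ),
    ((⟨N, hN⟩ : symplecticGroup (Fin n) ℤ)⁻¹ : symplecticGroup (Fin n) ℤ).1.map
      (Int.castRingHom ℚ), map_mul_map_inv hN, mul_eq_one_comm.1 (map_mul_map_inv hN)⟩,
  fun i j => ⟨0, N i j, by simp⟩, 0, by
    have h2 := congrArg (fun A => A.map (Int.castRingHom ℚ)) ((SymplecticGroup.mem_iff').1 hN)
    simp only [Matrix.map_mul, map_J] at h2
    unfold IsSimilitude
    rw [zpow_zero, one_smul, ← transpose_map]
    exact h2⟩

theorem ofSp_mem (N : Matrix (Fin n ⊕ Fin n) (Fin n ⊕ Fin n) ℤ)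
    (hN : N ∈ symplecticGroup (Fin n) ℤ) : ofSp (p := p) N hN ∈ siegel n p := ⟨N, hN, rfl⟩

theorem isSimilitude_of_mem_siegel {γ : simGroup n p} (hγ : γ ∈ siegel n p) :
    IsSimilitude n γ.1.1 1 := by
  obtain ⟨N, hN, h⟩ := hγ
  have h2 := congrArg (fun A => A.map (Int.castRingHom ℚ)) ((SymplecticGroup.mem_iff').1 hN)
  simp only [Matrix.map_mul, map_J] at h2
  unfold IsSimilitude
  rw [h, one_smul, ← transpose_map]
  exact h2

theorem coset_mul_left {γ : simGroup n p} (hγ : γ ∈ siegel n p) (M : simGroup n p) :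
    coset (siegel n p) (γ * M) = coset (siegel n p) M := by
  rw [coset_eq_iff]
  simpa using (siegel n p).inv_mem hγ

theorem exists_mul_of_coset_eq {M N : simGroup n p}
    (h : coset (siegel n p) M = coset (siegel n p) N) : ∃ γ ∈ siegel n p, N = γ * M :=
  ⟨N * M⁻¹, (coset_eq_iff _ _ _).1 h, by simp⟩

theorem IsSimilitude.unique [NeZero n] {M : Matrix (Fin n ⊕ Fin n) (Fin n ⊕ Fin n) ℚ} {μ ν : ℚ}
    (h : IsSimilitude n M μ) (h' : IsSimilitude n M ν) : μ = ν := by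
  have h1 := congrFun (congrFun (h.symm.trans h') (Sum.inr 0)) (Sum.inl 0)
  simpa [J] using h1

theorem zpow_p_injective {a b : ℤ} (h : (p : ℚ) ^ a = (p : ℚ) ^ b) : a = b :=
  zpow_right_injective₀ (by exact_mod_cast hp.out.pos) (by exact_mod_cast hp.out.ne_one) h

/-- `M J ᵗM = μ J`. -/
theorem IsSimilitude.transpose {M : Matrix (Fin n ⊕ Fin n) (Fin n ⊕ Fin n) ℚ} {μ : ℚ}
    (hμ : μ ≠ 0) (h : IsSimilitude n M μ) : M * J (Fin n) ℚ * Mᵀ = μ • J (Fin n) ℚ := by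
  unfold IsSimilitude at h
  have h1 : (-(μ⁻¹ • (J (Fin n) ℚ * Mᵀ * J (Fin n) ℚ))) * M = 1 := by
    rw [Matrix.neg_mul, Matrix.smul_mul, Matrix.mul_assoc, Matrix.mul_assoc, ← Matrix.mul_assoc Mᵀ,
      h, Matrix.mul_smul, smul_smul, inv_mul_cancel₀ hμ, one_smul, J_squared, neg_neg]
  have h2 := mul_eq_one_comm.1 h1
  have h3 : M * J (Fin n) ℚ * Mᵀ * J (Fin n) ℚ = -(μ • (1 : Matrix _ _ ℚ)) := by
    rw [← h2, Matrix.mul_neg, Matrix.mul_smul, smul_neg, neg_neg, smul_smul, mul_inv_cancel₀ hμ,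
      one_smul]
    simp only [Matrix.mul_assoc]
  calc M * J (Fin n) ℚ * Mᵀ = -(M * J (Fin n) ℚ * Mᵀ * (J (Fin n) ℚ * J (Fin n) ℚ)) := by
        rw [J_squared, Matrix.mul_neg, Matrix.mul_one, neg_neg]
    _ = μ • J (Fin n) ℚ := by
        rw [← Matrix.mul_assoc, h3, Matrix.neg_mul, neg_neg, Matrix.smul_mul, Matrix.one_mul]

end Integral

/-! ## Triangular representatives -/

section Triangular

variable {p : ℕ} [hp : Fact p.Prime]

/-- The bottom row consists of minus the numerator and the denominator of `y / x`; these are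
coprime, and a Bézout relation supplies the top row. -/
theorem exists_sl2_kill (x y : ℚ) : ∃ a b c d : ℤ, a * d - b * c = 1 ∧ c * x + d * y = 0 := by
  by_cases hx : x = 0
  · exact ⟨0, -1, 1, 0, by norm_num, by simp [hx]⟩
  have h := Rat.isCoprime_num_den (y / x)
  obtain ⟨u, v, huv⟩ := h
  refine ⟨v, u, -(y / x).num, (y / x).den, by linear_combination huv, ?_⟩
  have h1 := Rat.mul_den_eq_num (y / x)
  push_cast
  rw [← h1]
  field_simp
  ring

/-- The matrix that acts by `(a b; c d)` in the `i`-th hyperbolic plane. -/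
def planeMat (i : Fin 3) (a b c d : ℤ) : Matrix (Fin 3 ⊕ Fin 3) (Fin 3 ⊕ Fin 3) ℤ :=
  fromBlocks (diagonal fun k => if k = i then a else 1) (diagonal fun k => if k = i then b else 0)
    (diagonal fun k => if k = i then c else 0) (diagonal fun k => if k = i then d else 1)

theorem planeMat_mem (i : Fin 3) {a b c d : ℤ} (h : a * d - b * c = 1) :
    planeMat i a b c d ∈ symplecticGroup (Fin 3) ℤ := by
  rw [SymplecticGroup.mem_iff', planeMat, J, fromBlocks_transpose, fromBlocks_multiply,
    fromBlocks_multiply]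
  simp only [diagonal_transpose, Matrix.mul_zero, Matrix.mul_one, Matrix.mul_neg, zero_add,
    add_zero, Matrix.neg_mul, diagonal_mul_diagonal]
  congr 1 <;> ext k l <;> by_cases hkl : k = l <;> simp [hkl, Matrix.one_apply] <;>
    split_ifs <;> linarith

/-- The matrix `(a b; c d)` in the `i`-th and `j`-th coordinates. -/
def pairBlock (i j : Fin 3) (a b c d : ℤ) : Matrix (Fin 3) (Fin 3) ℤ := Matrix.of fun k l =>
  if k = i then (if l = i then a else if l = j then b else 0)
  else if k = j then (if l = i then c else if l = j then d else 0)
  else if k = l then 1 else 0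

/-- The matrix that acts by `(a b; c d)` on the `i`-th and `j`-th coordinates of the first
half. -/
def pairMat (i j : Fin 3) (a b c d : ℤ) : Matrix (Fin 3 ⊕ Fin 3) (Fin 3 ⊕ Fin 3) ℤ :=
  fromBlocks (pairBlock i j a b c d) 0 0 (pairBlock i j d (-c) (-b) a)

/-- The second block is the transposed inverse of the first, which is what makes the block diagonal
matrix `pairMat` symplectic. -/
theorem pairBlock_mul {i j : Fin 3} (hij : i ≠ j) {a b c d : ℤ} (h : a * d - b * c = 1) :
    (pairBlock i j a b c d)ᵀ * pairBlock i j d (-c) (-b) a = 1 := by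
  ext k l
  rw [Matrix.mul_apply, Fin.sum_univ_three]
  fin_cases i <;> fin_cases j <;>
    first | exact absurd rfl hij | (fin_cases k <;> fin_cases l <;> simp [pairBlock] <;> linarith)

theorem pairMat_mem {i j : Fin 3} (hij : i ≠ j) {a b c d : ℤ} (h : a * d - b * c = 1) :
    pairMat i j a b c d ∈ symplecticGroup (Fin 3) ℤ := by
  have h1 := pairBlock_mul hij h
  have h2 := congrArg Matrix.transpose h1
  rw [transpose_mul, transpose_transpose, transpose_one] at h2
  rw [SymplecticGroup.mem_iff', pairMat, J, fromBlocks_transpose, fromBlocks_multiply,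
    fromBlocks_multiply]
  simp [h1, h2]

variable (M : Matrix (Fin 3 ⊕ Fin 3) (Fin 3 ⊕ Fin 3) ℚ)

theorem planeMat_mul_inl (i : Fin 3) (a b c d : ℤ) (k : Fin 3) (l : Fin 3 ⊕ Fin 3) :
    ((planeMat i a b c d).map (Int.castRingHom ℚ) * M) (Sum.inl k) l =
      if k = i then a * M (Sum.inl k) l + b * M (Sum.inr k) l else M (Sum.inl k) l := by
  simp only [planeMat, Matrix.mul_apply, Fintype.sum_sum_type, Matrix.map_apply,
    fromBlocks_apply₁₁, fromBlocks_apply₁₂, diagonal_apply, eq_intCast, Int.cast_ite, Int.cast_zero,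
    ite_mul, zero_mul, Finset.sum_ite_eq, Finset.mem_univ, if_true]
  split_ifs <;> simp

theorem planeMat_mul_inr (i : Fin 3) (a b c d : ℤ) (k : Fin 3) (l : Fin 3 ⊕ Fin 3) :
    ((planeMat i a b c d).map (Int.castRingHom ℚ) * M) (Sum.inr k) l =
      if k = i then c * M (Sum.inl k) l + d * M (Sum.inr k) l else M (Sum.inr k) l := by
  simp only [planeMat, Matrix.mul_apply, Fintype.sum_sum_type, Matrix.map_apply,
    fromBlocks_apply₂₁, fromBlocks_apply₂₂, diagonal_apply, eq_intCast, Int.cast_ite, Int.cast_zero,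
    ite_mul, zero_mul, Finset.sum_ite_eq, Finset.mem_univ, if_true]
  split_ifs <;> simp

theorem pairMat_mul_inl {i j : Fin 3} (hij : i ≠ j) (a b c d : ℤ) (k : Fin 3)
    (l : Fin 3 ⊕ Fin 3) :
    ((pairMat i j a b c d).map (Int.castRingHom ℚ) * M) (Sum.inl k) l =
      if k = i then a * M (Sum.inl i) l + b * M (Sum.inl j) l
      else if k = j then c * M (Sum.inl i) l + d * M (Sum.inl j) l else M (Sum.inl k) l := by
  simp only [pairMat, Matrix.mul_apply, Fintype.sum_sum_type, Matrix.map_apply,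
    fromBlocks_apply₁₁, fromBlocks_apply₁₂, Fin.sum_univ_three, pairBlock, Matrix.of_apply]
  fin_cases i <;> fin_cases j <;>
    first | exact absurd rfl hij | (fin_cases k <;> simp <;> ring)

theorem pairMat_mul_inr {i j : Fin 3} (hij : i ≠ j) (a b c d : ℤ) (k : Fin 3)
    (l : Fin 3 ⊕ Fin 3) :
    ((pairMat i j a b c d).map (Int.castRingHom ℚ) * M) (Sum.inr k) l =
      if k = i then d * M (Sum.inr i) l - c * M (Sum.inr j) l
      else if k = j then -b * M (Sum.inr i) l + a * M (Sum.inr j) l else M (Sum.inr k) l := by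
  simp only [pairMat, Matrix.mul_apply, Fintype.sum_sum_type, Matrix.map_apply,
    fromBlocks_apply₂₁, fromBlocks_apply₂₂, Fin.sum_univ_three, pairBlock, Matrix.of_apply]
  fin_cases i <;> fin_cases j <;>
    first | exact absurd rfl hij | (fin_cases k <;> simp <;> ring)

/-- `M'` is a left translate of `M` by an integral symplectic matrix. -/
def LeftRel (M M' : Matrix (Fin 3 ⊕ Fin 3) (Fin 3 ⊕ Fin 3) ℚ) : Prop :=
  ∃ N ∈ symplecticGroup (Fin 3) ℤ, M' = N.map (Int.castRingHom ℚ) * M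

variable {M}

theorem LeftRel.trans {M' M'' : Matrix (Fin 3 ⊕ Fin 3) (Fin 3 ⊕ Fin 3) ℚ}
    (h : LeftRel M M') (h' : LeftRel M' M'') : LeftRel M M'' := by
  obtain ⟨N, hN, rfl⟩ := h
  obtain ⟨N', hN', rfl⟩ := h'
  exact ⟨N' * N, mul_mem hN' hN, by rw [Matrix.map_mul, Matrix.mul_assoc]⟩

theorem LeftRel.isSimilitude {M' : Matrix (Fin 3 ⊕ Fin 3) (Fin 3 ⊕ Fin 3) ℚ} {μ : ℚ}
    (h : LeftRel M M') (hM : IsSimilitude 3 M μ) : IsSimilitude 3 M' μ := by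
  obtain ⟨N, hN, rfl⟩ := h
  have h2 := congrArg (fun A => A.map (Int.castRingHom ℚ)) ((SymplecticGroup.mem_iff').1 hN)
  simp only [Matrix.map_mul, map_J] at h2
  have h3 : IsSimilitude 3 (N.map (Int.castRingHom ℚ)) 1 := by
    unfold IsSimilitude
    rw [one_smul, ← transpose_map]
    exact h2
  simpa using h3.mul hM

/-- The last two conclusions protect columns that are already reduced: other rows do not change, and
a column vanishing in both rows of the plane still vanishes there. -/
theorem exists_kill_inr (M : Matrix (Fin 3 ⊕ Fin 3) (Fin 3 ⊕ Fin 3) ℚ) (i : Fin 3)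
    (j : Fin 3 ⊕ Fin 3) : ∃ M', LeftRel M M' ∧ M' (Sum.inr i) j = 0 ∧
      (∀ k ≠ i, ∀ l, M' (Sum.inl k) l = M (Sum.inl k) l ∧ M' (Sum.inr k) l = M (Sum.inr k) l) ∧
      ∀ l, M (Sum.inl i) l = 0 → M (Sum.inr i) l = 0 →
        M' (Sum.inl i) l = 0 ∧ M' (Sum.inr i) l = 0 := by
  obtain ⟨a, b, c, d, h, hz⟩ := exists_sl2_kill (M (Sum.inl i) j) (M (Sum.inr i) j)
  refine ⟨_, ⟨_, planeMat_mem i h, rfl⟩, ?_, ?_, ?_⟩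
  · rw [planeMat_mul_inr, if_pos rfl, hz]
  · intro k hk l
    rw [planeMat_mul_inl, planeMat_mul_inr, if_neg hk, if_neg hk]
    exact ⟨rfl, rfl⟩
  · intro l h1 h2
    rw [planeMat_mul_inl, planeMat_mul_inr, if_pos rfl, if_pos rfl, h1, h2]
    simp

theorem exists_kill_inl (M : Matrix (Fin 3 ⊕ Fin 3) (Fin 3 ⊕ Fin 3) ℚ) {i j : Fin 3} (hij : i ≠ j)
    (m : Fin 3 ⊕ Fin 3) : ∃ M', LeftRel M M' ∧ M' (Sum.inl i) m = 0 ∧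
      (∀ k, k ≠ i → k ≠ j → ∀ l,
        M' (Sum.inl k) l = M (Sum.inl k) l ∧ M' (Sum.inr k) l = M (Sum.inr k) l) ∧
      (∀ l, M (Sum.inl i) l = 0 → M (Sum.inl j) l = 0 →
        M' (Sum.inl i) l = 0 ∧ M' (Sum.inl j) l = 0) ∧
      ∀ l, M (Sum.inr i) l = 0 → M (Sum.inr j) l = 0 →
        M' (Sum.inr i) l = 0 ∧ M' (Sum.inr j) l = 0 := by
  obtain ⟨c, d, a, b, h, hz⟩ := exists_sl2_kill (M (Sum.inl i) m) (M (Sum.inl j) m)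
  refine ⟨_, ⟨_, pairMat_mem hij (a := a) (b := b) (c := -c) (d := -d)
    (by linear_combination h), rfl⟩, ?_, ?_, ?_, ?_⟩
  · rw [pairMat_mul_inl M hij, if_pos rfl, hz]
  · intro k hk hk' l
    rw [pairMat_mul_inl M hij, pairMat_mul_inr M hij, if_neg hk, if_neg hk, if_neg hk', if_neg hk']
    exact ⟨rfl, rfl⟩
  · intro l h1 h2
    rw [pairMat_mul_inl M hij, pairMat_mul_inl M hij, if_pos rfl, if_neg hij.symm, if_pos rfl, h1,
      h2]
    simp
  · intro l h1 h2
    rw [pairMat_mul_inr M hij, pairMat_mul_inr M hij, if_pos rfl, if_neg hij.symm, if_pos rfl, h1,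
      h2]
    simp

/-- The symplectic relation between two columns. -/
theorem IsSimilitude.columns {μ : ℚ} (h : IsSimilitude 3 M μ) (i j : Fin 3 ⊕ Fin 3) :
    ∑ k : Fin 3, (M (Sum.inr k) i * M (Sum.inl k) j - M (Sum.inl k) i * M (Sum.inr k) j) =
      μ * J (Fin 3) ℚ i j := by
  have h1 := congrFun (congrFun h i) j
  rw [Matrix.smul_apply, smul_eq_mul] at h1
  rw [← h1, Matrix.mul_apply, Fintype.sum_sum_type]
  simp only [Matrix.mul_apply, Fintype.sum_sum_type, J, fromBlocks_apply₁₁, fromBlocks_apply₁₂,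
    fromBlocks_apply₂₁, fromBlocks_apply₂₂, transpose_apply, Matrix.zero_apply, Matrix.neg_apply,
    Matrix.one_apply, mul_zero, Finset.sum_const_zero, zero_add, add_zero, mul_neg, mul_ite, mul_one,
    Finset.sum_neg_distrib, Finset.sum_ite_eq', Finset.mem_univ, if_true]
  rw [← Finset.sum_add_distrib]
  refine Finset.sum_congr rfl fun k _ => ?_
  ring

end Triangular

/-! ### Column reduction; existence and uniqueness of triangular forms. -/

section Triangular

variable {p : ℕ} [hp : Fact p.Prime] {M : Matrix (Fin 3 ⊕ Fin 3) (Fin 3 ⊕ Fin 3) ℚ} {μ : ℚ}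

theorem mul_J_mul_transpose_apply {R : Type*} [CommRing R]
    (X Y : Matrix (Fin 3 ⊕ Fin 3) (Fin 3 ⊕ Fin 3) R) (i j : Fin 3 ⊕ Fin 3) :
    (X * J (Fin 3) R * Yᵀ) i j =
      ∑ k : Fin 3, (X i (Sum.inr k) * Y j (Sum.inl k) - X i (Sum.inl k) * Y j (Sum.inr k)) := by
  rw [Matrix.mul_apply, Fintype.sum_sum_type]
  simp only [Matrix.mul_apply, Fintype.sum_sum_type, J, fromBlocks_apply₁₁, fromBlocks_apply₁₂,
    fromBlocks_apply₂₁, fromBlocks_apply₂₂, transpose_apply, Matrix.zero_apply, Matrix.neg_apply,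
    Matrix.one_apply, mul_zero, Finset.sum_const_zero, zero_add, add_zero, mul_neg, mul_ite, mul_one,
    Finset.sum_neg_distrib, Finset.sum_ite_eq', Finset.mem_univ, if_true]
  rw [← Finset.sum_add_distrib]
  refine Finset.sum_congr rfl fun k _ => ?_
  ring

/-- The column `inl 2` has been reduced. -/
def ColTwo (M : Matrix (Fin 3 ⊕ Fin 3) (Fin 3 ⊕ Fin 3) ℚ) : Prop :=
  M (Sum.inl 0) (Sum.inl 2) = 0 ∧ M (Sum.inl 1) (Sum.inl 2) = 0 ∧
    M (Sum.inr 0) (Sum.inl 2) = 0 ∧ M (Sum.inr 1) (Sum.inl 2) = 0 ∧ M (Sum.inr 2) (Sum.inl 2) = 0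

/-- The column `inl 1` has been reduced. -/
def ColOne (M : Matrix (Fin 3 ⊕ Fin 3) (Fin 3 ⊕ Fin 3) ℚ) : Prop :=
  M (Sum.inl 0) (Sum.inl 1) = 0 ∧
    M (Sum.inr 0) (Sum.inl 1) = 0 ∧ M (Sum.inr 1) (Sum.inl 1) = 0 ∧ M (Sum.inr 2) (Sum.inl 1) = 0

/-- The column `inl 0` has been reduced. -/
def ColZero (M : Matrix (Fin 3 ⊕ Fin 3) (Fin 3 ⊕ Fin 3) ℚ) : Prop :=
  M (Sum.inr 0) (Sum.inl 0) = 0 ∧ M (Sum.inr 1) (Sum.inl 0) = 0 ∧ M (Sum.inr 2) (Sum.inl 0) = 0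

theorem exists_colTwo (M : Matrix (Fin 3 ⊕ Fin 3) (Fin 3 ⊕ Fin 3) ℚ) :
    ∃ M', LeftRel M M' ∧ ColTwo M' := by
  obtain ⟨M₁, r₁, z₁, -, -⟩ := exists_kill_inr M 0 (Sum.inl 2)
  obtain ⟨M₂, r₂, z₂, k₂, -⟩ := exists_kill_inr M₁ 1 (Sum.inl 2)
  obtain ⟨M₃, r₃, z₃, k₃, -⟩ := exists_kill_inr M₂ 2 (Sum.inl 2)
  obtain ⟨M₄, r₄, z₄, k₄, -, q₄⟩ := exists_kill_inl M₃ (i := 0) (j := 2) (by decide) (Sum.inl 2)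
  obtain ⟨M₅, r₅, z₅, k₅, -, q₅⟩ := exists_kill_inl M₄ (i := 1) (j := 2) (by decide) (Sum.inl 2)
  have a₀ : M₃ (Sum.inr 0) (Sum.inl 2) = 0 := by
    rw [(k₃ 0 (by decide) _).2, (k₂ 0 (by decide) _).2, z₁]
  have a₁ : M₃ (Sum.inr 1) (Sum.inl 2) = 0 := by rw [(k₃ 1 (by decide) _).2, z₂]
  obtain ⟨b₀, b₂⟩ := q₄ _ a₀ z₃
  have b₁ : M₄ (Sum.inr 1) (Sum.inl 2) = 0 := by
    rw [(k₄ 1 (by decide) (by decide) _).2, a₁]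
  obtain ⟨c₁, c₂⟩ := q₅ _ b₁ b₂
  refine ⟨M₅, r₁.trans (r₂.trans (r₃.trans (r₄.trans r₅))), ?_, z₅, ?_, c₁, c₂⟩
  · rw [(k₅ 0 (by decide) (by decide) _).1, z₄]
  · rw [(k₅ 0 (by decide) (by decide) _).2, b₀]

theorem ColTwo.ne_zero (h : ColTwo M) (hM : IsSimilitude 3 M μ) (hμ : μ ≠ 0) :
    M (Sum.inl 2) (Sum.inl 2) ≠ 0 := by
  obtain ⟨h0, h1, h2, h3, h4⟩ := h
  intro h5
  have := hM.columns (Sum.inl 2) (Sum.inr 2)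
  simp [Fin.sum_univ_three, h0, h1, h2, h3, h4, h5, J] at this
  exact hμ this

theorem ColOne.ne_zero (h : ColOne M) (h' : ColTwo M) (hM : IsSimilitude 3 M μ) (hμ : μ ≠ 0) :
    M (Sum.inl 1) (Sum.inl 1) ≠ 0 := by
  have hne := h'.ne_zero hM hμ
  obtain ⟨h0, h1, h2, h3, h4⟩ := h'
  obtain ⟨g0, g1, g2, g3⟩ := h
  intro h5
  have e1 := hM.columns (Sum.inl 2) (Sum.inr 1)
  have e2 := hM.columns (Sum.inl 1) (Sum.inr 1)
  simp [Fin.sum_univ_three, h0, h1, h2, h3, h4, J, hne] at e1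
  simp [Fin.sum_univ_three, g0, g1, g2, g3, h5, e1, J] at e2
  exact hμ e2

/-- The symplectic relation with the reduced column `inl 2` already forces the entry in row `inr 2`
to vanish. So only the planes `0` and `1` are used, and the zeros of column `inl 2` survive. -/
theorem exists_colOne (h : ColTwo M) (hM : IsSimilitude 3 M μ) (hμ : μ ≠ 0) :
    ∃ M', LeftRel M M' ∧ ColTwo M' ∧ ColOne M' := by
  have hne := h.ne_zero hM hμ
  obtain ⟨h0, h1, h2, h3, h4⟩ := h
  have e : M (Sum.inr 2) (Sum.inl 1) = 0 := by
    have := hM.columns (Sum.inl 1) (Sum.inl 2)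
    simpa [Fin.sum_univ_three, h0, h1, h2, h3, h4, J, hne] using this
  obtain ⟨M₁, r₁, z₁, k₁, p₁⟩ := exists_kill_inr M 0 (Sum.inl 1)
  obtain ⟨M₂, r₂, z₂, k₂, p₂⟩ := exists_kill_inr M₁ 1 (Sum.inl 1)
  obtain ⟨M₃, r₃, z₃, k₃, p₃, q₃⟩ := exists_kill_inl M₂ (i := 0) (j := 1) (by decide) (Sum.inl 1)
  obtain ⟨a0, a2⟩ := p₁ _ h0 h2
  have a1 : M₁ (Sum.inl 1) (Sum.inl 2) = 0 := by rw [(k₁ 1 (by decide) _).1, h1]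
  have a3 : M₁ (Sum.inr 1) (Sum.inl 2) = 0 := by rw [(k₁ 1 (by decide) _).2, h3]
  obtain ⟨b1, b3⟩ := p₂ _ a1 a3
  have b0 : M₂ (Sum.inl 0) (Sum.inl 2) = 0 := by rw [(k₂ 0 (by decide) _).1, a0]
  have b2 : M₂ (Sum.inr 0) (Sum.inl 2) = 0 := by rw [(k₂ 0 (by decide) _).2, a2]
  have z₁' : M₂ (Sum.inr 0) (Sum.inl 1) = 0 := by rw [(k₂ 0 (by decide) _).2, z₁]
  obtain ⟨c0, c1⟩ := p₃ _ b0 b1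
  obtain ⟨c2, c3⟩ := q₃ _ b2 b3
  obtain ⟨d0, d1⟩ := q₃ _ z₁' z₂
  have f : ∀ l, M₃ (Sum.inr 2) l = M (Sum.inr 2) l := fun l => by
    rw [(k₃ 2 (by decide) (by decide) l).2, (k₂ 2 (by decide) l).2, (k₁ 2 (by decide) l).2]
  exact ⟨M₃, r₁.trans (r₂.trans r₃), ⟨c0, c1, c2, c3, by rw [f, h4]⟩, z₃, d0, d1, by rw [f, e]⟩

theorem exists_colZero (h : ColTwo M) (h' : ColOne M) (hM : IsSimilitude 3 M μ) (hμ : μ ≠ 0) :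
    ∃ M', LeftRel M M' ∧ ColTwo M' ∧ ColOne M' ∧ ColZero M' := by
  have hne := h.ne_zero hM hμ
  have hne' := h'.ne_zero h hM hμ
  obtain ⟨h0, h1, h2, h3, h4⟩ := h
  obtain ⟨g0, g1, g2, g3⟩ := h'
  have e : M (Sum.inr 2) (Sum.inl 0) = 0 := by
    have := hM.columns (Sum.inl 0) (Sum.inl 2)
    simpa [Fin.sum_univ_three, h0, h1, h2, h3, h4, J, hne] using this
  have e' : M (Sum.inr 1) (Sum.inl 0) = 0 := by
    have := hM.columns (Sum.inl 0) (Sum.inl 1)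
    simpa [Fin.sum_univ_three, g0, g1, g2, g3, J, hne', e] using this
  obtain ⟨M₁, r₁, z₁, k₁, p₁⟩ := exists_kill_inr M 0 (Sum.inl 0)
  obtain ⟨a0, a2⟩ := p₁ _ h0 h2
  obtain ⟨b0, b2⟩ := p₁ _ g0 g1
  refine ⟨M₁, r₁, ⟨a0, ?_, a2, ?_, ?_⟩, ⟨b0, b2, ?_, ?_⟩, z₁, ?_, ?_⟩
  · rw [(k₁ 1 (by decide) _).1, h1]
  · rw [(k₁ 1 (by decide) _).2, h3]
  · rw [(k₁ 2 (by decide) _).2, h4]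
  · rw [(k₁ 1 (by decide) _).2, g2]
  · rw [(k₁ 2 (by decide) _).2, g3]
  · rw [(k₁ 1 (by decide) _).2, e']
  · rw [(k₁ 2 (by decide) _).2, e]

/-- After clearing denominators, an integer divides a power of `p`, so it is a power of `p` up to
sign. The sign `s` is kept so that it can be removed by a sign matrix. -/
theorem eq_zpow_or_neg_of_mul_eq {x y : ℚ} (hx : x ∈ zInv p) (hy : y ∈ zInv p) {δ : ℤ}
    (h : x * y = (p : ℚ) ^ δ) : ∃ s : ℤ, s * s = 1 ∧ ∃ k : ℤ, s * x = (p : ℚ) ^ k := by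
  have hp0 : (p : ℚ) ≠ 0 := p_ratCast_ne_zero
  obtain ⟨a, m, hm⟩ := hx
  obtain ⟨b, l, hl⟩ := hy
  obtain ⟨e, f, hef⟩ : ∃ e f : ℕ, δ = e - f := ⟨δ.toNat, (-δ).toNat, by omega⟩
  have h1 : m * (l * p ^ f) = (p : ℤ) ^ (a + b + e) := by
    have : (m : ℚ) * (l * p ^ f) = (p : ℚ) ^ (a + b + e) := by
      have h0 : x * y * (p : ℚ) ^ f = (p : ℚ) ^ e := by
        rw [h, hef, zpow_sub₀ hp0, zpow_natCast, zpow_natCast, div_mul_cancel₀ _ (pow_ne_zero _ hp0)]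
      rw [← hm, ← hl, pow_add, pow_add, ← h0]
      ring
    exact_mod_cast this
  have h2 : m.natAbs ∣ p ^ (a + b + e) := by
    rw [← Int.natCast_dvd_natCast, Int.natAbs_dvd]
    push_cast
    exact ⟨_, h1.symm⟩
  obtain ⟨k, -, hk⟩ := (Nat.dvd_prime_pow hp.out).1 h2
  have hxm : x = m * (p : ℚ) ^ (-(a : ℤ)) := by
    rw [← hm, _root_.zpow_neg, zpow_natCast]
    field_simp
  refine ⟨m.sign, ?_, k - a, ?_⟩
  · have hm0 : m ≠ 0 := by
      rintro rfl
      simp only [Int.natAbs_zero] at hk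
      exact pow_ne_zero k hp.out.ne_zero hk.symm
    rcases lt_or_gt_of_ne hm0 with h | h
    · rw [Int.sign_eq_neg_one_of_neg h]; norm_num
    · rw [Int.sign_eq_one_of_pos h]; norm_num
  · have h3 : (m.sign : ℚ) * m = (p : ℚ) ^ k := by
      have h4 := Int.sign_mul_self_eq_natAbs m
      rw [hk] at h4
      exact_mod_cast h4
    rw [hxm, ← mul_assoc, h3, ← zpow_natCast, ← zpow_add₀ hp0, sub_eq_add_neg]

/-- The diagonal matrix of signs. -/
def signMat (s : Fin 3 → ℤ) : Matrix (Fin 3 ⊕ Fin 3) (Fin 3 ⊕ Fin 3) ℤ :=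
  fromBlocks (diagonal s) 0 0 (diagonal s)

theorem signMat_mem {s : Fin 3 → ℤ} (hs : ∀ i, s i * s i = 1) :
    signMat s ∈ symplecticGroup (Fin 3) ℤ := by
  rw [SymplecticGroup.mem_iff', signMat, J, fromBlocks_transpose, fromBlocks_multiply,
    fromBlocks_multiply]
  have h : diagonal s * diagonal s = 1 := by rw [diagonal_mul_diagonal]; simp [hs]
  simp only [diagonal_transpose, Matrix.mul_zero, Matrix.mul_one, Matrix.mul_neg, zero_add,
    add_zero, Matrix.neg_mul, Matrix.zero_mul, transpose_zero, h, neg_zero]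

theorem signMat_mul_inr (s : Fin 3 → ℤ) (k : Fin 3) (l : Fin 3 ⊕ Fin 3) :
    ((signMat s).map (Int.castRingHom ℚ) * M) (Sum.inr k) l = s k * M (Sum.inr k) l := by
  simp [signMat, Matrix.mul_apply, diagonal_apply]

/-- Each coset has a triangular representative. -/
theorem exists_isTriangular (M : simGroup 3 p) : ∃ T δ d,
    coset (siegel 3 p) T = coset (siegel 3 p) M ∧ IsTriangular 3 p T δ d := by
  obtain ⟨hM, δ, hδ⟩ := M.2
  have hμ : (p : ℚ) ^ δ ≠ 0 := zpow_ne_zero _ p_ratCast_ne_zero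
  obtain ⟨M₁, r₁, t₁⟩ := exists_colTwo M.1.1
  obtain ⟨M₂, r₂, t₂, o₂⟩ := exists_colOne t₁ (r₁.isSimilitude hδ) hμ
  obtain ⟨M₃, r₃, t₃, o₃, z₃⟩ := exists_colZero t₂ o₂ (r₂.isSimilitude (r₁.isSimilitude hδ)) hμ
  have hr := r₁.trans (r₂.trans r₃)
  have hsim := hr.isSimilitude hδ
  have n₂ := t₃.ne_zero hsim hμ
  have n₁ := o₃.ne_zero t₃ hsim hμ
  have hent : ∀ i j, M₃ i j ∈ zInv p := by
    obtain ⟨N, hN, rfl⟩ := hr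
    exact mul_entry_mem _ (fun i j => ⟨0, N i j, by simp⟩) hM
  obtain ⟨h0, h1, h2, h3, h4⟩ := t₃
  obtain ⟨g0, g1, g2, g3⟩ := o₃
  obtain ⟨f0, f1, f2⟩ := z₃
  -- The lower left block is zero and the upper left block is lower triangular; the column relations
  -- then make the lower right block upper triangular.
  have d20 : M₃ (Sum.inr 2) (Sum.inr 0) = 0 := by
    have := hsim.columns (Sum.inl 2) (Sum.inr 0)
    simpa [Fin.sum_univ_three, h0, h1, h2, h3, h4, J, n₂] using this
  have d21 : M₃ (Sum.inr 2) (Sum.inr 1) = 0 := by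
    have := hsim.columns (Sum.inl 2) (Sum.inr 1)
    simpa [Fin.sum_univ_three, h0, h1, h2, h3, h4, J, n₂] using this
  have d10 : M₃ (Sum.inr 1) (Sum.inr 0) = 0 := by
    have := hsim.columns (Sum.inl 1) (Sum.inr 0)
    simpa [Fin.sum_univ_three, g0, g1, g2, g3, J, n₁, d20] using this
  have hdiag : ∀ i : Fin 3, M₃ (Sum.inr i) (Sum.inr i) * M₃ (Sum.inl i) (Sum.inl i) =
      (p : ℚ) ^ δ := by
    intro i
    have e0 := hsim.columns (Sum.inl 0) (Sum.inr 0)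
    have e1 := hsim.columns (Sum.inl 1) (Sum.inr 1)
    have e2 := hsim.columns (Sum.inl 2) (Sum.inr 2)
    simp only [Fin.sum_univ_three, h0, h1, h2, h3, h4, g0, g1, g2, g3, f0, f1, f2, d20, d21, d10, J,
      fromBlocks_apply₁₂, Matrix.neg_apply, Matrix.one_apply_eq] at e0 e1 e2
    fin_cases i <;> simp only [Fin.zero_eta, Fin.mk_one, Fin.reduceFinMk]
    · linear_combination -e0
    · linear_combination -e1
    · linear_combination -e2
  -- The signs of the diagonal entries are collected into one symplectic sign matrix, which makes
  -- the diagonal consist of powers of `p`.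
  choose s hs d hd using fun i => eq_zpow_or_neg_of_mul_eq (hent _ _) (hent _ _) (hdiag i)
  obtain ⟨N, hN, hNM⟩ := hr
  have hmem := mul_mem (signMat_mem hs) hN
  have hval : (ofSp (p := p) _ hmem * M).1.1 = (signMat s).map (Int.castRingHom ℚ) * M₃ := by
    rw [hNM, ← Matrix.mul_assoc, ← Matrix.map_mul]
    rfl
  refine ⟨ofSp _ hmem * M, δ, d, coset_mul_left (ofSp_mem _ hmem) M, ?_, ?_, ?_, ?_⟩
  · have := (isSimilitude_of_mem_siegel (ofSp_mem (p := p) _ hmem)).mul hδ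
    rwa [one_mul] at this
  · intro i j
    rw [hval, signMat_mul_inr]
    fin_cases i <;> fin_cases j <;> simp [h2, h3, h4, g1, g2, g3, f0, f1, f2]
  · intro i j hij
    rw [hval, signMat_mul_inr]
    fin_cases i <;> fin_cases j <;> simp at hij <;> simp [d20, d21, d10]
  · intro i
    rw [hval, signMat_mul_inr, hd]

theorem exists_int_entry {γ : simGroup 3 p} (hγ : γ ∈ siegel 3 p) (i j : Fin 3 ⊕ Fin 3) :
    ∃ a : ℤ, γ.1.1 i j = a := by
  obtain ⟨N, -, hN⟩ := hγ
  exact ⟨N i j, by rw [hN]; rfl⟩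

theorem le_of_zpow_eq {a b m : ℤ} (h : (p : ℚ) ^ b = m * (p : ℚ) ^ a) : a ≤ b := by
  have hp0 : (p : ℚ) ≠ 0 := p_ratCast_ne_zero
  have h1 : (p : ℚ) ^ (b - a) = m := by
    rw [zpow_sub₀ hp0, h]
    field_simp
  by_contra hlt
  push Not at hlt
  have h2 : 0 < (p : ℚ) ^ (b - a) := zpow_pos (by exact_mod_cast hp.out.pos) _
  have h3 : (p : ℚ) ^ (b - a) < 1 :=
    zpow_lt_one_of_neg₀ (by exact_mod_cast hp.out.one_lt) (by omega)
  rw [h1] at h2 h3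
  have : 0 < m := by exact_mod_cast h2
  have : m < 1 := by exact_mod_cast h3
  omega

/-- A `γ` carrying one triangular matrix to another is itself block triangular with upper triangular
lower right block. Its integral diagonal gives `p ^ d' i` as an integer times `p ^ d i`. The same
bound for the inverse yields uniqueness. -/
theorem IsTriangular.le {T γ : simGroup 3 p} (hγ : γ ∈ siegel 3 p) {δ δ' : ℤ} {d d' : Fin 3 → ℤ}
    (h : IsTriangular 3 p T δ d) (h' : IsTriangular 3 p (γ * T) δ' d') : δ = δ' ∧ d ≤ d' := by
  obtain ⟨hs, hC, hD, hd⟩ := h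
  obtain ⟨hs', hC', hD', hd'⟩ := h'
  have hμ : (p : ℚ) ^ δ ≠ 0 := zpow_ne_zero _ p_ratCast_ne_zero
  have hδ := (isSimilitude_of_mem_siegel hγ).mul hs
  rw [one_mul] at hδ
  refine ⟨zpow_p_injective (hδ.unique hs'), ?_⟩
  have hval : (γ * T).1.1 = γ.1.1 * T.1.1 := rfl
  have hG : ∀ i j : Fin 3, γ.1.1 (Sum.inr i) (Sum.inl j) = 0 := by
    intro i j
    have h1 : (γ * T).1.1 * J (Fin 3) ℚ * T.1.1ᵀ = (p : ℚ) ^ δ • (γ.1.1 * J (Fin 3) ℚ) := by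
      rw [hval, Matrix.mul_assoc, Matrix.mul_assoc, ← Matrix.mul_assoc T.1.1, hs.transpose hμ,
        Matrix.mul_smul]
    have h2 := congrFun (congrFun h1 (Sum.inr i)) (Sum.inr j)
    rw [mul_J_mul_transpose_apply] at h2
    simp only [hC, hC', mul_zero, zero_mul, sub_zero, Finset.sum_const_zero] at h2
    simpa [Matrix.mul_apply, Fintype.sum_sum_type, J, Matrix.one_apply, hμ] using h2
  have hmul : ∀ i j : Fin 3, (γ * T).1.1 (Sum.inr i) (Sum.inr j) =
      ∑ k : Fin 3, γ.1.1 (Sum.inr i) (Sum.inr k) * T.1.1 (Sum.inr k) (Sum.inr j) := by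
    intro i j
    rw [hval, Matrix.mul_apply, Fintype.sum_sum_type]
    simp [hG]
  have hp0 : (p : ℚ) ≠ 0 := p_ratCast_ne_zero
  have t10 := hD 1 0 (by decide)
  have t20 := hD 2 0 (by decide)
  have t21 := hD 2 1 (by decide)
  have n0 : T.1.1 (Sum.inr 0) (Sum.inr 0) ≠ 0 := by rw [hd]; exact zpow_ne_zero _ hp0
  have n1 : T.1.1 (Sum.inr 1) (Sum.inr 1) ≠ 0 := by rw [hd]; exact zpow_ne_zero _ hp0
  have g10 : γ.1.1 (Sum.inr 1) (Sum.inr 0) = 0 := by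
    have := (hmul 1 0).symm.trans (hD' 1 0 (by decide))
    simpa [Fin.sum_univ_three, t10, t20, n0] using this
  have g20 : γ.1.1 (Sum.inr 2) (Sum.inr 0) = 0 := by
    have := (hmul 2 0).symm.trans (hD' 2 0 (by decide))
    simpa [Fin.sum_univ_three, t10, t20, n0] using this
  have g21 : γ.1.1 (Sum.inr 2) (Sum.inr 1) = 0 := by
    have := (hmul 2 1).symm.trans (hD' 2 1 (by decide))
    simpa [Fin.sum_univ_three, t21, g20, n1] using this
  have key : ∀ i : Fin 3, (p : ℚ) ^ d' i = γ.1.1 (Sum.inr i) (Sum.inr i) * (p : ℚ) ^ d i := by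
    intro i
    rw [← hd', ← hd, hmul, Fin.sum_univ_three]
    fin_cases i <;> simp [t10, t20, t21, g10, g20, g21]
  intro i
  obtain ⟨m, hm⟩ := exists_int_entry hγ (Sum.inr i) (Sum.inr i)
  refine le_of_zpow_eq (p := p) (m := m) ?_
  rw [key, hm]

theorem IsTriangular.unique {T T' : simGroup 3 p} {δ δ' : ℤ} {d d' : Fin 3 → ℤ}
    (h : IsTriangular 3 p T δ d) (h' : IsTriangular 3 p T' δ' d')
    (hc : coset (siegel 3 p) T = coset (siegel 3 p) T') : δ = δ' ∧ d = d' := by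
  obtain ⟨γ, hγ, rfl⟩ := exists_mul_of_coset_eq hc
  obtain ⟨h1, h2⟩ := h.le hγ h'
  obtain ⟨-, h3⟩ := h'.le ((siegel 3 p).inv_mem hγ) (by rwa [inv_mul_cancel_left])
  exact ⟨h1, le_antisymm h2 h3⟩

theorem IsTriangular.mul {T T' : simGroup 3 p} {δ δ' : ℤ} {d d' : Fin 3 → ℤ}
    (h : IsTriangular 3 p T δ d) (h' : IsTriangular 3 p T' δ' d') :
    IsTriangular 3 p (T * T') (δ + δ') (d + d') := by
  have hp0 : (p : ℚ) ≠ 0 := p_ratCast_ne_zero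
  obtain ⟨hs, hC, hD, hd⟩ := h
  obtain ⟨hs', hC', hD', hd'⟩ := h'
  have hval : (T * T').1.1 = T.1.1 * T'.1.1 := rfl
  refine ⟨?_, ?_, ?_, ?_⟩
  · rw [zpow_add₀ hp0]
    exact hs.mul hs'
  · intro i j
    rw [hval, Matrix.mul_apply, Fintype.sum_sum_type]
    simp [hC, hC']
  · intro i j hij
    rw [hval, Matrix.mul_apply, Fintype.sum_sum_type]
    simp only [hC, zero_mul, Finset.sum_const_zero, zero_add]
    refine Finset.sum_eq_zero fun k _ => ?_
    rcases lt_or_ge k i with hk | hk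
    · rw [hD i k hk, zero_mul]
    · rw [hD' k j (hij.trans_le hk), mul_zero]
  · intro i
    rw [hval, Matrix.mul_apply, Fintype.sum_sum_type]
    simp only [hC, zero_mul, Finset.sum_const_zero, zero_add]
    rw [Finset.sum_eq_single i, hd, hd', Pi.add_apply, zpow_add₀ hp0]
    · intro k _ hk
      rcases lt_or_gt_of_ne hk with hk | hk
      · rw [hD i k hk, zero_mul]
      · rw [hD' k i hk, mul_zero]
    · simp

end Triangular

/-! ## The spherical map is a ring homomorphism -/

section Spherical

variable {p : ℕ} [hp : Fact p.Prime]

variable (p) in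
/-- `x₀ ^ δ ∏ᵢ (xᵢ p ^ (-i)) ^ dᵢ`. -/
noncomputable def monom (δ : ℤ) (d : Fin 3 → ℤ) : Laurent 3 :=
  AddMonoidAlgebra.single (Fin.cons δ d) (∏ i : Fin 3, ((p : ℚ) ^ (-((i : ℤ) + 1))) ^ d i)

theorem cosetMonomial_eq {T : simGroup 3 p} {δ : ℤ} {d : Fin 3 → ℤ} (h : IsTriangular 3 p T δ d) :
    cosetMonomial 3 p (coset (siegel 3 p) T) = monom p δ d := by
  have hex : ∃ w : ℤ × (Fin 3 → ℤ), ∃ M : simGroup 3 p,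
      coset (siegel 3 p) M = coset (siegel 3 p) T ∧ IsTriangular 3 p M w.1 w.2 :=
    ⟨(δ, d), T, rfl, h⟩
  rw [cosetMonomial, dif_pos hex]
  obtain ⟨M, hM, hM'⟩ := hex.choose_spec
  obtain ⟨h1, h2⟩ := hM'.unique h hM
  rw [h1, h2, monom]

theorem monom_mul (δ δ' : ℤ) (d d' : Fin 3 → ℤ) :
    monom p δ d * monom p δ' d' = monom p (δ + δ') (d + d') := by
  have hp0 : (p : ℚ) ≠ 0 := p_ratCast_ne_zero
  rw [monom, monom, monom, AddMonoidAlgebra.single_mul_single, ← Finset.prod_mul_distrib]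
  congr 1
  · funext i
    refine Fin.cases ?_ (fun i => ?_) i <;> simp
  · refine Finset.prod_congr rfl fun i _ => ?_
    rw [Pi.add_apply, zpow_add₀ (zpow_ne_zero _ hp0)]

theorem cosetMonomial_translate {N : simGroup 3 p} {δ : ℤ} {d : Fin 3 → ℤ}
    (h : IsTriangular 3 p N δ d) (c : Cosets (siegel 3 p)) :
    cosetMonomial 3 p (translate (siegel 3 p) N c) = cosetMonomial 3 p c * monom p δ d := by
  obtain ⟨T, ε, e, hT, hT'⟩ := exists_isTriangular c.out
  rw [coset_out] at hT
  rw [← hT, translate_coset, cosetMonomial_eq hT', cosetMonomial_eq (hT'.mul h), monom_mul]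

variable (p) in
/-- The spherical map on combinations of cosets. -/
noncomputable def omegaAux : (Cosets (siegel 3 p) →₀ ℚ) →ₗ[ℚ] Laurent 3 :=
  Finsupp.linearCombination ℚ (cosetMonomial 3 p)

theorem Omega_apply (t : LocalHecke 3 p) :
    Omega 3 p t = omegaAux p (toCosets (siegel 3 p) t) := rfl

theorem omegaAux_single (c : Cosets (siegel 3 p)) (a : ℚ) :
    omegaAux p (Finsupp.single c a) = a • cosetMonomial 3 p c := by
  simp [omegaAux, Finsupp.linearCombination_single]

theorem omegaAux_act {N : simGroup 3 p} {δ : ℤ} {d : Fin 3 → ℤ}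
    (h : IsTriangular 3 p N δ d) (t : Cosets (siegel 3 p) →₀ ℚ) :
    omegaAux p (act (siegel 3 p) N t) = omegaAux p t * monom p δ d := by
  induction t using Finsupp.induction_linear with
  | zero => simp
  | add a b ha hb => simp only [map_add, ha, hb, add_mul]
  | single c a =>
    rw [act_single, omegaAux_single, omegaAux_single, cosetMonomial_translate h, smul_mul_assoc]

/-- Invariance of the left factor allows a triangular representative for each coset of the right
factor. Translation by it multiplies all monomials of the left factor by the monomial of that coset.
-/
theorem Omega_mul (t u : LocalHecke 3 p) : Omega 3 p (t * u) = Omega 3 p t * Omega 3 p u := by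
  rw [Omega_apply, Omega_apply, Omega_apply, toCosets_mul]
  induction toCosets (siegel 3 p) u using Finsupp.induction_linear with
  | zero => simp
  | add a b ha hb => simp only [map_add, ha, hb, mul_add]
  | single c a =>
    obtain ⟨T, δ, d, hT, hT'⟩ := exists_isTriangular c.out
    rw [cosetMul_single, ← act_eq_of_coset_eq _ t hT, map_smul, omegaAux_act hT', omegaAux_single,
      mul_smul_comm]
    rw [coset_out] at hT
    rw [← hT, cosetMonomial_eq hT']

theorem isTriangular_one : IsTriangular 3 p 1 0 0 := by
  refine ⟨?_, fun i j => ?_, fun i j hij => ?_, fun i => ?_⟩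
  · simp [IsSimilitude]
  · simp
  · simp [hij.ne']
  · simp

theorem Omega_one : Omega 3 p 1 = 1 := by
  rw [Omega_apply, toCosets_one, omegaAux_single, cosetMonomial_eq isTriangular_one, one_smul,
    monom, AddMonoidAlgebra.one_def]
  congr 1
  · funext i
    refine Fin.cases ?_ (fun i => ?_) i <;> simp
  · simp

variable (p) in
/-- The spherical map as a ring homomorphism. -/
noncomputable def OmegaHom : LocalHecke 3 p →+* Laurent 3 where
  toFun := Omega 3 p
  map_one' := Omega_one
  map_mul' := Omega_mul
  map_zero' := map_zero _
  map_add' := map_add _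

/-- The spherical map on a double coset. -/
theorem Omega_double (M : simGroup 3 p) : Omega 3 p (double 3 p M) =
    ∑ c ∈ (cosetsIn_finite 3 p M).toFinset, cosetMonomial 3 p c := by
  rw [Omega_apply]
  change omegaAux p (∑ c ∈ (cosetsIn_finite 3 p M).toFinset, Finsupp.single c 1) = _
  rw [map_sum]
  simp only [omegaAux_single, one_smul]

end Spherical

/-! ## The Lagrangian of an integral similitude -/

section Space

variable (R : Type) [CommRing R]

/-- The free symplectic module of rank `6`, as an iterated hyperbolic extension. -/
abbrev Space : Type := R × (R × (R × PUnit.{1} × R) × R) × R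

/-- The symplectic form on `Space R`. -/
def form : LinearMap.BilinForm R (Space R) :=
  hyp (hyp (hyp (0 : LinearMap.BilinForm R PUnit.{1})))

theorem form_isAlt : (form R).IsAlt :=
  hyp_isAlt (hyp_isAlt (hyp_isAlt fun _ => rfl))

variable {R}

/-- The coordinates in `Space R`. -/
def toSpace : (Fin 3 ⊕ Fin 3 → R) ≃ₗ[R] Space R where
  -- Index `2` belongs to the outermost plane: the last row of a triangular matrix has only its last
  -- coordinate nonzero, so it produces `lastExp`, and successive reductions read off the earlier
  -- diagonal entries.
  toFun v := (v (Sum.inl 2), (v (Sum.inl 1), (v (Sum.inl 0), PUnit.unit, v (Sum.inr 0)),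
    v (Sum.inr 1)), v (Sum.inr 2))
  invFun x := Sum.elim ![x.2.1.2.1.1, x.2.1.1, x.1] ![x.2.1.2.1.2.2, x.2.1.2.2, x.2.2]
  map_add' _ _ := rfl
  map_smul' _ _ := rfl
  left_inv v := by
    funext i
    rcases i with i | i <;> fin_cases i <;> rfl
  right_inv _ := rfl

theorem toSpace_apply (v : Fin 3 ⊕ Fin 3 → R) : toSpace v =
    (v (Sum.inl 2), (v (Sum.inl 1), (v (Sum.inl 0), PUnit.unit, v (Sum.inr 0)), v (Sum.inr 1)),
      v (Sum.inr 2)) := rfl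

theorem form_toSpace (v w : Fin 3 ⊕ Fin 3 → R) :
    form R (toSpace v) (toSpace w) = v ⬝ᵥ (J (Fin 3) R *ᵥ w) := by
  simp only [form, toSpace_apply, hyp_apply, dotProduct, mulVec, Fintype.sum_sum_type,
    Fin.sum_univ_three, J]
  simp
  ring

theorem transvection_mem (w : Fin 3 ⊕ Fin 3 → R) (c : R) :
    1 + vecMulVec (c • (J (Fin 3) R *ᵥ w)) w ∈ symplecticGroup (Fin 3) R := by
  rw [SymplecticGroup.mem_iff]
  have h1 : w ᵥ* J (Fin 3) R = -(J (Fin 3) R *ᵥ w) := by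
    rw [← mulVec_transpose, J_transpose, neg_mulVec]
  have h2 : w ⬝ᵥ (J (Fin 3) R *ᵥ w) = 0 := by
    rw [← form_toSpace]
    exact form_isAlt R _
  rw [transpose_add, transpose_one, transpose_vecMulVec, Matrix.add_mul, Matrix.one_mul,
    vecMulVec_mul, h1, Matrix.mul_add, Matrix.mul_one, Matrix.add_mul, mul_vecMulVec,
    vecMulVec_mul_vecMulVec, neg_dotProduct, dotProduct_comm, h2]
  ext i j
  simp only [vecMulVec_apply, Matrix.add_apply, Pi.neg_apply, Pi.smul_apply, smul_eq_mul, neg_zero,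
    zero_smul, Pi.zero_apply]
  ring

theorem vecMul_transvection (v w : Fin 3 ⊕ Fin 3 → R) (c : R) :
    toSpace (v ᵥ* (1 + vecMulVec (c • (J (Fin 3) R *ᵥ w)) w)) =
      transv (form R) (toSpace w) c (toSpace v) := by
  rw [transv_apply, form_toSpace, vecMul_add, vecMul_one, map_add, ← map_smul, vecMul_vecMulVec,
    dotProduct_smul, smul_eq_mul]

end Space

/-! ### The Lagrangian of an integral similitude as its row space modulo `p ^ δ`. -/

section LagrangianOf

variable {p δ : ℕ} [hp : Fact p.Prime] {N : Matrix (Fin 3 ⊕ Fin 3) (Fin 3 ⊕ Fin 3) ℤ}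

/-- Reduction of an integral vector. -/
def reduce (q : ℕ) (v : Fin 3 ⊕ Fin 3 → ℤ) : Space (ZMod q) :=
  toSpace fun i => (v i : ZMod q)

theorem form_reduce (q : ℕ) (v w : Fin 3 ⊕ Fin 3 → ℤ) :
    form (ZMod q) (reduce q v) (reduce q w) = ((v ⬝ᵥ (J (Fin 3) ℤ *ᵥ w) : ℤ) : ZMod q) := by
  rw [reduce, reduce, form_toSpace, ← map_J (Fin 3) (Int.castRingHom (ZMod q))]
  simp [dotProduct, mulVec]

theorem reduce_surjective {q : ℕ} (x : Space (ZMod q)) : ∃ v, reduce q v = x := by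
  choose v hv using fun i => ZMod.intCast_surjective (toSpace.symm x i)
  refine ⟨v, ?_⟩
  rw [reduce]
  simp only [hv]
  exact toSpace.apply_symm_apply x

theorem reduce_vecMul {q : ℕ} (z : Fin 3 ⊕ Fin 3 → ℤ)
    (N : Matrix (Fin 3 ⊕ Fin 3) (Fin 3 ⊕ Fin 3) ℤ) :
    reduce q (z ᵥ* N) = ∑ i, (z i : ZMod q) • reduce q (N i) := by
  simp only [reduce, ← map_smul, ← map_sum]
  congr 1
  funext j
  simp [vecMul, dotProduct]

variable (p δ) in
/-- The vectors orthogonal to the rows of `N`. -/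
def lag (N : Matrix (Fin 3 ⊕ Fin 3) (Fin 3 ⊕ Fin 3) ℤ) :
    Submodule (ZMod (p ^ δ)) (Space (ZMod (p ^ δ))) where
  carrier := {x | ∀ i, form (ZMod (p ^ δ)) x (reduce (p ^ δ) (N i)) = 0}
  add_mem' h h' i := by rw [map_add, LinearMap.add_apply, h, h', add_zero]
  zero_mem' i := by simp
  smul_mem' c x h i := by rw [map_smul, LinearMap.smul_apply, h, smul_zero]

theorem mem_lag {x : Space (ZMod (p ^ δ))} :
    x ∈ lag p δ N ↔ ∀ i, form (ZMod (p ^ δ)) x (reduce (p ^ δ) (N i)) = 0 := Iff.rfl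

variable (p δ) in
/-- `ᵗN J N = p ^ δ J` for an integral matrix `N`. -/
def IsIntSim (N : Matrix (Fin 3 ⊕ Fin 3) (Fin 3 ⊕ Fin 3) ℤ) : Prop :=
  Nᵀ * J (Fin 3) ℤ * N = (p : ℤ) ^ δ • J (Fin 3) ℤ

theorem isIntSim_iff : IsIntSim p δ N ↔
    IsSimilitude 3 (N.map (Int.castRingHom ℚ)) ((p : ℚ) ^ (δ : ℤ)) := by
  unfold IsIntSim IsSimilitude
  rw [← (Matrix.map_injective (f := Int.castRingHom ℚ) Int.cast_injective).eq_iff, Matrix.map_mul,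
    Matrix.map_mul, map_J, transpose_map]
  have : ((p : ℤ) ^ δ • J (Fin 3) ℤ).map (Int.castRingHom ℚ) = (p : ℚ) ^ (δ : ℤ) • J (Fin 3) ℚ := by
    rw [← map_J (Fin 3) (Int.castRingHom ℚ)]
    ext i j
    simp only [Matrix.map_apply, Matrix.smul_apply, smul_eq_mul, map_mul, map_pow, map_natCast,
      zpow_natCast]
  rw [this]

theorem IsIntSim.transpose (h : IsIntSim p δ N) :
    N * J (Fin 3) ℤ * Nᵀ = (p : ℤ) ^ δ • J (Fin 3) ℤ := by
  have h1 := (isIntSim_iff.1 h).transpose (zpow_ne_zero _ p_ratCast_ne_zero)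
  apply Matrix.map_injective (f := Int.castRingHom ℚ) Int.cast_injective
  beta_reduce
  rw [Matrix.map_mul, Matrix.map_mul, map_J, transpose_map, h1,
    ← map_J (Fin 3) (Int.castRingHom ℚ)]
  ext i j
  simp only [Matrix.map_apply, Matrix.smul_apply, smul_eq_mul, map_mul, map_pow, map_natCast,
    zpow_natCast]

theorem IsIntSim.mul_mem {G : Matrix (Fin 3 ⊕ Fin 3) (Fin 3 ⊕ Fin 3) ℤ} (h : IsIntSim p δ N)
    (hG : G ∈ symplecticGroup (Fin 3) ℤ) : IsIntSim p δ (N * G) := by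
  unfold IsIntSim at *
  have h2 := SymplecticGroup.mem_iff'.1 hG
  calc (N * G)ᵀ * J (Fin 3) ℤ * (N * G) = Gᵀ * (Nᵀ * J (Fin 3) ℤ * N) * G := by
        rw [transpose_mul]; simp only [Matrix.mul_assoc]
    _ = _ := by rw [h, Matrix.mul_smul, Matrix.smul_mul, h2]

theorem mul_mulVec_transpose (v : Fin 3 ⊕ Fin 3 → ℤ)
    (N : Matrix (Fin 3 ⊕ Fin 3) (Fin 3 ⊕ Fin 3) ℤ) (i : Fin 3 ⊕ Fin 3) :
    v ⬝ᵥ (J (Fin 3) ℤ *ᵥ N i) = (v ᵥ* (J (Fin 3) ℤ * Nᵀ)) i := by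
  rw [← vecMul_vecMul, dotProduct_mulVec]
  rfl

theorem IsIntSim.row_mem (h : IsIntSim p δ N) (i : Fin 3 ⊕ Fin 3) :
    reduce (p ^ δ) (N i) ∈ lag p δ N := by
  intro j
  rw [form_reduce]
  have h1 : N i ⬝ᵥ (J (Fin 3) ℤ *ᵥ N j) = (p : ℤ) ^ δ * J (Fin 3) ℤ i j := by
    have h2 := congrFun (congrFun h.transpose i) j
    rw [Matrix.smul_apply, smul_eq_mul] at h2
    rw [← h2, mul_mulVec_transpose, Matrix.mul_assoc]
    rfl
  rw [h1]
  push_cast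
  rw [natCast_pow_self, zero_mul]

/-- A vector whose reduction is orthogonal to the rows of `N` is an integral combination of the
rows. -/
theorem IsIntSim.exists_vecMul_eq (h : IsIntSim p δ N) {v : Fin 3 ⊕ Fin 3 → ℤ}
    (hv : reduce (p ^ δ) v ∈ lag p δ N) : ∃ z : Fin 3 ⊕ Fin 3 → ℤ, v = z ᵥ* N := by
  have h1 : ∀ i, ∃ z : ℤ, (v ᵥ* (J (Fin 3) ℤ * Nᵀ)) i = (p : ℤ) ^ δ * z := by
    intro i
    have h2 := hv i
    rw [form_reduce, mul_mulVec_transpose, ZMod.intCast_zmod_eq_zero_iff_dvd] at h2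
    push_cast at h2
    exact h2
  choose z hz using h1
  have hz' : v ᵥ* (J (Fin 3) ℤ * Nᵀ) = (p : ℤ) ^ δ • z := funext hz
  -- Multiplying the relation for `z` on the right by `J N` gives `-p ^ δ v = p ^ δ z J N`, and `p ^
  -- δ` is cancelled.
  refine ⟨-(z ᵥ* J (Fin 3) ℤ), ?_⟩
  have h3 := congrArg (fun u => u ᵥ* (J (Fin 3) ℤ * N)) hz'
  have h4 : J (Fin 3) ℤ * Nᵀ * (J (Fin 3) ℤ * N) = -((p : ℤ) ^ δ • 1) := by
    rw [Matrix.mul_assoc, ← Matrix.mul_assoc Nᵀ, h, Matrix.mul_smul, J_squared, smul_neg]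
  simp only [vecMul_vecMul, h4, vecMul_neg, vecMul_smul, smul_vecMul, vecMul_one] at h3
  have hq : (p : ℤ) ^ δ ≠ 0 := pow_ne_zero _ (by exact_mod_cast hp.out.ne_zero)
  funext i
  have h5 := congrFun h3 i
  simp only [Pi.neg_apply, Pi.smul_apply, smul_eq_mul] at h5
  rw [neg_vecMul, vecMul_vecMul, Pi.neg_apply]
  exact mul_left_cancel₀ hq (by linear_combination -h5)

/-- The orthogonal complement of the rows equals their span, so orthogonality to the rows and to the
whole submodule agree. -/
theorem IsIntSim.isLagrangian (h : IsIntSim p δ N) : IsLagrangian (form _) (lag p δ N) := by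
  intro x
  constructor
  · intro hx l hl
    obtain ⟨v, rfl⟩ := reduce_surjective l
    obtain ⟨z, rfl⟩ := h.exists_vecMul_eq hl
    rw [reduce_vecMul, map_sum]
    exact Finset.sum_eq_zero fun i _ => by rw [map_smul, hx i, smul_zero]
  · exact fun hx i => hx _ (h.row_mem i)

theorem lag_mul_left {G N : Matrix (Fin 3 ⊕ Fin 3) (Fin 3 ⊕ Fin 3) ℤ} (h : IsIntSim p δ N)
    (h' : IsIntSim p δ (G * N)) : lag p δ (G * N) = lag p δ N := by
  refine (h.isLagrangian.eq_of_le h'.isLagrangian fun x hx i => ?_).symm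
  have h1 : (G * N) i = G i ᵥ* N := rfl
  rw [h1, reduce_vecMul, map_sum]
  exact Finset.sum_eq_zero fun j _ => by rw [map_smul, hx j, smul_zero]

theorem exists_mul_eq_of_lag_eq {N N' : Matrix (Fin 3 ⊕ Fin 3) (Fin 3 ⊕ Fin 3) ℤ}
    (h : IsIntSim p δ N) (h' : IsIntSim p δ N') (hl : lag p δ N = lag p δ N') :
    ∃ G, N' = G * N := by
  choose G hG using fun i => h.exists_vecMul_eq (hl ▸ h'.row_mem i)
  exact ⟨Matrix.of G, by ext i j; rw [hG]; rfl⟩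

/-- Right multiplication by an integral matrix on `Space`. -/
def rightMul (q : ℕ) (G : Matrix (Fin 3 ⊕ Fin 3) (Fin 3 ⊕ Fin 3) ℤ) :
    Space (ZMod q) →ₗ[ZMod q] Space (ZMod q) :=
  toSpace.toLinearMap ∘ₗ (G.map (Int.castRingHom (ZMod q))).vecMulLinear ∘ₗ
    toSpace.symm.toLinearMap

theorem rightMul_reduce (q : ℕ) (G : Matrix (Fin 3 ⊕ Fin 3) (Fin 3 ⊕ Fin 3) ℤ)
    (v : Fin 3 ⊕ Fin 3 → ℤ) : rightMul q G (reduce q v) = reduce q (v ᵥ* G) := by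
  simp only [rightMul, reduce, LinearMap.comp_apply, LinearEquiv.coe_coe,
    LinearEquiv.symm_apply_apply, Matrix.vecMulLinear_apply]
  congr 1
  funext i
  simp [vecMul, dotProduct]

theorem rightMul_injective (q : ℕ) {G : Matrix (Fin 3 ⊕ Fin 3) (Fin 3 ⊕ Fin 3) ℤ}
    (hG : G ∈ symplecticGroup (Fin 3) ℤ) : Function.Injective (rightMul q G) := by
  have hinv : G * ((⟨G, hG⟩ : symplecticGroup (Fin 3) ℤ)⁻¹ : symplecticGroup (Fin 3) ℤ).1 = 1 :=
    congrArg Subtype.val (mul_inv_cancel (⟨G, hG⟩ : symplecticGroup (Fin 3) ℤ))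
  refine Function.LeftInverse.injective (g := rightMul q
    ((⟨G, hG⟩ : symplecticGroup (Fin 3) ℤ)⁻¹ : symplecticGroup (Fin 3) ℤ).1) fun x => ?_
  obtain ⟨v, rfl⟩ := reduce_surjective x
  rw [rightMul_reduce, rightMul_reduce, vecMul_vecMul, hinv, vecMul_one]

theorem lag_mul_right {G : Matrix (Fin 3 ⊕ Fin 3) (Fin 3 ⊕ Fin 3) ℤ} (h : IsIntSim p δ N)
    (hG : G ∈ symplecticGroup (Fin 3) ℤ) :
    lag p δ (N * G) = (lag p δ N).map (rightMul (p ^ δ) G) := by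
  ext x
  constructor
  · intro hx
    obtain ⟨v, rfl⟩ := reduce_surjective x
    obtain ⟨z, rfl⟩ := (h.mul_mem hG).exists_vecMul_eq hx
    refine ⟨reduce _ (z ᵥ* N), ?_, by rw [rightMul_reduce, vecMul_vecMul]⟩
    rw [reduce_vecMul]
    exact Submodule.sum_mem _ fun i _ => Submodule.smul_mem _ _ (h.row_mem i)
  · rintro ⟨y, hy, rfl⟩
    obtain ⟨v, rfl⟩ := reduce_surjective y
    obtain ⟨z, rfl⟩ := h.exists_vecMul_eq hy
    rw [rightMul_reduce, vecMul_vecMul, reduce_vecMul]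
    exact Submodule.sum_mem _ fun i _ => Submodule.smul_mem _ _ ((h.mul_mem hG).row_mem i)

/-- Transvections lift to integral symplectic matrices. -/
theorem exists_rightMul_eq_transv {q : ℕ} (w : Space (ZMod q)) (c : ZMod q) :
    ∃ G ∈ symplecticGroup (Fin 3) ℤ, rightMul q G = transv (form (ZMod q)) w c := by
  obtain ⟨w, rfl⟩ := reduce_surjective w
  obtain ⟨c, rfl⟩ := ZMod.intCast_surjective c
  refine ⟨_, transvection_mem w c, LinearMap.ext fun x => ?_⟩
  obtain ⟨v, rfl⟩ := reduce_surjective x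
  rw [rightMul_reduce]
  have h := vecMul_transvection (fun i => (v i : ZMod q)) (fun i => (w i : ZMod q)) (c : ZMod q)
  refine Eq.trans ?_ h
  rw [reduce]
  congr 1
  funext i
  rw [← map_J (Fin 3) (Int.castRingHom (ZMod q))]
  simp [vecMul, dotProduct, vecMulVec_apply, mulVec, Matrix.one_apply, mul_assoc]

end LagrangianOf

/-! ### Integral cosets and their Lagrangians. -/

section CosetLagrangian

variable {p δ : ℕ} [hp : Fact p.Prime] {N : Matrix (Fin 3 ⊕ Fin 3) (Fin 3 ⊕ Fin 3) ℤ}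
  {M : simGroup 3 p} {c c' : Cosets (siegel 3 p)}

variable (p δ) in
/-- The cosets of integral matrices with multiplier `p ^ δ`. -/
def IsIntCoset (c : Cosets (siegel 3 p)) : Prop :=
  ∃ N : Matrix (Fin 3 ⊕ Fin 3) (Fin 3 ⊕ Fin 3) ℤ, ∃ M : simGroup 3 p,
    coset (siegel 3 p) M = c ∧ M.1.1 = N.map (Int.castRingHom ℚ) ∧ IsIntSim p δ N

open Classical in
variable (p δ) in
/-- The Lagrangian of a coset of integral matrices. -/
noncomputable def lagCoset (c : Cosets (siegel 3 p)) :
    Submodule (ZMod (p ^ δ)) (Space (ZMod (p ^ δ))) :=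
  if h : IsIntCoset p δ c then lag p δ h.choose else ⊥

theorem map_intCast_injective {X Y : Matrix (Fin 3 ⊕ Fin 3) (Fin 3 ⊕ Fin 3) ℤ}
    (h : X.map (Int.castRingHom ℚ) = Y.map (Int.castRingHom ℚ)) : X = Y :=
  Matrix.map_injective (f := Int.castRingHom ℚ) Int.cast_injective h

theorem lagCoset_eq (hM : M.1.1 = N.map (Int.castRingHom ℚ)) (hN : IsIntSim p δ N) :
    lagCoset p δ (coset (siegel 3 p) M) = lag p δ N := by
  have hex : IsIntCoset p δ (coset (siegel 3 p) M) := ⟨N, M, rfl, hM, hN⟩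
  rw [lagCoset, dif_pos hex]
  obtain ⟨M', hc, hM', hN'⟩ := hex.choose_spec
  obtain ⟨γ, ⟨G, -, hG⟩, rfl⟩ := exists_mul_of_coset_eq hc
  have h1 : (γ * M').1.1 = γ.1.1 * M'.1.1 := rfl
  rw [hM, hG, hM', ← Matrix.map_mul] at h1
  have h2 := map_intCast_injective h1
  rw [h2] at hN ⊢
  exact (lag_mul_left hN' hN).symm

theorem IsIntCoset.isLagrangian (h : IsIntCoset p δ c) :
    IsLagrangian (form _) (lagCoset p δ c) := by
  obtain ⟨N, M, rfl, hM, hN⟩ := h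
  rw [lagCoset_eq hM hN]
  exact hN.isLagrangian

/-- Equal Lagrangians give `N' = G * N` with `G` integral. The multipliers agree, so `G` has
multiplier `1` and belongs to `Γ`. -/
theorem IsIntCoset.eq_of_lagCoset_eq (h : IsIntCoset p δ c) (h' : IsIntCoset p δ c')
    (hl : lagCoset p δ c = lagCoset p δ c') : c = c' := by
  obtain ⟨N, M, rfl, hM, hN⟩ := h
  obtain ⟨N', M', rfl, hM', hN'⟩ := h'
  rw [lagCoset_eq hM hN, lagCoset_eq hM' hN'] at hl
  obtain ⟨G, hG⟩ := exists_mul_eq_of_lag_eq hN hN' hl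
  have hμ : (p : ℚ) ^ (δ : ℤ) ≠ 0 := zpow_ne_zero _ p_ratCast_ne_zero
  have hone : M.1.1 * (M⁻¹).1.1 = 1 :=
    congrArg (fun g : simGroup 3 p => g.1.1) (mul_inv_cancel M)
  rw [coset_eq_iff]
  have hval : (M' * M⁻¹).1.1 = G.map (Int.castRingHom ℚ) := by
    have h1 : (M' * M⁻¹).1.1 = M'.1.1 * (M⁻¹).1.1 := rfl
    rw [h1, hM', hG, Matrix.map_mul, ← hM, Matrix.mul_assoc, hone, Matrix.mul_one]
  refine mem_siegel 3 p _ (fun i j => ⟨G i j, by rw [hval]; rfl⟩) ?_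
  have h2 := isIntSim_iff.1 hN
  have h3 := isIntSim_iff.1 hN'
  rw [← hM] at h2
  rw [← hM'] at h3
  have h4 := h3.mul (h2.inv hμ)
  rw [mul_inv_cancel₀ hμ] at h4
  exact h4

theorem IsIntCoset.translate (h : IsIntCoset p δ c)
    {G : Matrix (Fin 3 ⊕ Fin 3) (Fin 3 ⊕ Fin 3) ℤ} (hG : G ∈ symplecticGroup (Fin 3) ℤ)
    {γ : simGroup 3 p} (hγ : γ.1.1 = G.map (Int.castRingHom ℚ)) :
    IsIntCoset p δ (translate (siegel 3 p) γ c) ∧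
      lagCoset p δ (translate (siegel 3 p) γ c) =
        (lagCoset p δ c).map (rightMul (p ^ δ) G) := by
  obtain ⟨N, M, rfl, hM, hN⟩ := h
  have hval : (M * γ).1.1 = (N * G).map (Int.castRingHom ℚ) := by
    have h1 : (M * γ).1.1 = M.1.1 * γ.1.1 := rfl
    rw [h1, hM, hγ, Matrix.map_mul]
  rw [translate_coset]
  refine ⟨⟨N * G, M * γ, rfl, hval, hN.mul_mem hG⟩, ?_⟩
  rw [lagCoset_eq hval (hN.mul_mem hG), lagCoset_eq hM hN, lag_mul_right hN hG]

/-- A Lagrangian related by transvections to that of `c` is the Lagrangian of a translate. -/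
theorem exists_translate_of_transvRel (h : IsIntCoset p δ c)
    {L : Submodule (ZMod (p ^ δ)) (Space (ZMod (p ^ δ)))}
    (hL : TransvRel (form _) (lagCoset p δ c) L) :
    ∃ γ ∈ siegel 3 p, IsIntCoset p δ (translate (siegel 3 p) γ c) ∧
      lagCoset p δ (translate (siegel 3 p) γ c) = L := by
  induction hL with
  | refl => exact ⟨1, one_mem _, by simpa [translate_one] using h, by simp [translate_one]⟩
  | tail _ hs ih =>
    obtain ⟨w, a, rfl⟩ := hs
    obtain ⟨γ, hγ, h1, rfl⟩ := ih
    obtain ⟨G, hG, hGw⟩ := exists_rightMul_eq_transv w a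
    obtain ⟨h2, h3⟩ := h1.translate hG (γ := ofSp G hG) rfl
    rw [translate_translate] at h2 h3
    exact ⟨γ * ofSp G hG, mul_mem hγ (ofSp_mem _ _), h2, by rw [h3, hGw]⟩

end CosetLagrangian

/-! ## The type of a Lagrangian -/

section LagrangianType

variable {p δ : ℕ} [hp : Fact p.Prime] {N : Matrix (Fin 3 ⊕ Fin 3) (Fin 3 ⊕ Fin 3) ℤ}

theorem IsIntSim.rows (h : IsIntSim p δ N) (i j : Fin 3 ⊕ Fin 3) :
    ∑ k : Fin 3, (N i (Sum.inr k) * N j (Sum.inl k) - N i (Sum.inl k) * N j (Sum.inr k)) =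
      (p : ℤ) ^ δ * J (Fin 3) ℤ i j := by
  rw [← mul_J_mul_transpose_apply, h.transpose]
  rfl

theorem pow_natCast_dvd_of_mul {d : ℕ} {a : ℤ} (had : a * (p : ℤ) ^ d = (p : ℤ) ^ δ)
    {b : ZMod (p ^ δ)} (hb : b * (a : ZMod (p ^ δ)) = 0) : d ≤ δ ∧ (p : ZMod (p ^ δ)) ^ d ∣ b := by
  have hp0 : (p : ℤ) ≠ 0 := by exact_mod_cast hp.out.ne_zero
  have hd : d ≤ δ := by
    have h1 : (p : ℤ) ^ d ∣ (p : ℤ) ^ δ := ⟨a, by rw [← had, mul_comm]⟩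
    have h2 : p ^ d ∣ p ^ δ := by exact_mod_cast h1
    exact (Nat.pow_dvd_pow_iff_le_right hp.out.one_lt).1 h2
  have ha : a = (p : ℤ) ^ (δ - d) := by
    refine mul_right_cancel₀ (pow_ne_zero d hp0) ?_
    rw [had, ← pow_add, Nat.sub_add_cancel hd]
  refine ⟨hd, ?_⟩
  rw [ha] at hb
  push_cast at hb
  rw [mul_comm, pow_mul_eq_zero_iff (Nat.sub_le _ _), Nat.sub_sub_self hd] at hb
  exact hb

variable {d : Fin 3 → ℕ}

/-- The exponents of the Lagrangian of a triangular matrix are those of its diagonal. -/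
theorem IsIntSim.lastExp_lag (h : IsIntSim p δ N)
    (hC : ∀ i j : Fin 3, N (Sum.inr i) (Sum.inl j) = 0)
    (hD : ∀ i j : Fin 3, j < i → N (Sum.inr i) (Sum.inr j) = 0)
    (hd : ∀ i : Fin 3, N (Sum.inr i) (Sum.inr i) = (p : ℤ) ^ d i) :
    lastExp (lag p δ N) = d 2 ∧ lastExp (red (lag p δ N)) = d 1 ∧
      lastExp (red (red (lag p δ N))) = d 0 := by
  have hp0 : (p : ℤ) ≠ 0 := by exact_mod_cast hp.out.ne_zero
  have hn : ∀ i, N (Sum.inr i) (Sum.inr i) ≠ 0 := fun i => by rw [hd]; exact pow_ne_zero _ hp0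
  have t10 := hD 1 0 (by decide)
  have t20 := hD 2 0 (by decide)
  have t21 := hD 2 1 (by decide)
  -- The row relations make the upper left block lower triangular with diagonal entries
  -- complementary to `p ^ d i`.
  have e02 : N (Sum.inl 0) (Sum.inl 2) = 0 := by
    have := h.rows (Sum.inl 0) (Sum.inr 2)
    simpa [Fin.sum_univ_three, hC, t20, t21, J, hn] using this
  have e12 : N (Sum.inl 1) (Sum.inl 2) = 0 := by
    have := h.rows (Sum.inl 1) (Sum.inr 2)
    simpa [Fin.sum_univ_three, hC, t20, t21, J, hn] using this
  have e01 : N (Sum.inl 0) (Sum.inl 1) = 0 := by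
    have := h.rows (Sum.inl 0) (Sum.inr 1)
    simpa [Fin.sum_univ_three, hC, t10, e02, J, hn] using this
  have f2 : N (Sum.inl 2) (Sum.inl 2) * (p : ℤ) ^ d 2 = (p : ℤ) ^ δ := by
    have := h.rows (Sum.inl 2) (Sum.inr 2)
    simp only [Fin.sum_univ_three, hC, t20, t21, J, fromBlocks_apply₁₂, Matrix.neg_apply,
      Matrix.one_apply_eq, hd] at this
    linear_combination -this
  have f1 : N (Sum.inl 1) (Sum.inl 1) * (p : ℤ) ^ d 1 = (p : ℤ) ^ δ := by
    have := h.rows (Sum.inl 1) (Sum.inr 1)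
    simp only [Fin.sum_univ_three, hC, t10, e12, J, fromBlocks_apply₁₂, Matrix.neg_apply,
      Matrix.one_apply_eq, hd] at this
    linear_combination -this
  have f0 : N (Sum.inl 0) (Sum.inl 0) * (p : ℤ) ^ d 0 = (p : ℤ) ^ δ := by
    have := h.rows (Sum.inl 0) (Sum.inr 0)
    simp only [Fin.sum_univ_three, hC, e01, e02, J, fromBlocks_apply₁₂, Matrix.neg_apply,
      Matrix.one_apply_eq, hd] at this
    linear_combination -this
  have hrow : ∀ i, ∀ s : ZMod (p ^ δ), s • reduce (p ^ δ) (N i) ∈ lag p δ N :=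
    fun i s => Submodule.smul_mem _ _ (h.row_mem i)
  refine ⟨lastExp_eq (pow_natCast_dvd_of_mul f2 (zero_mul _)).1 fun b => ⟨fun hb => ?_, ?_⟩,
    lastExp_eq (pow_natCast_dvd_of_mul f1 (zero_mul _)).1 fun b => ⟨fun hb => ?_, ?_⟩,
    lastExp_eq (pow_natCast_dvd_of_mul f0 (zero_mul _)).1 fun b => ⟨fun hb => ?_, ?_⟩⟩
  -- Pairing with row `inl 2` bounds the exponent below; multiples of row `inr 2` attain it. The
  -- other two exponents use the rows of index `1` and `0` in the same way.
  · have h1 := mem_lag.1 hb (Sum.inl 2)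
    simp only [form, reduce, toSpace_apply, hyp_apply] at h1
    exact (pow_natCast_dvd_of_mul f2 (by simpa using h1)).2
  · rintro ⟨s, rfl⟩
    have h1 := hrow (Sum.inr 2) s
    simp only [reduce, toSpace_apply, hC, t20, t21, hd, Prod.smul_mk, smul_eq_mul, Int.cast_zero,
      mul_zero, Int.cast_pow, Int.cast_natCast] at h1
    rw [mul_comm _ s]
    exact h1
  · obtain ⟨c, hc⟩ := hb
    have h1 := mem_lag.1 hc (Sum.inl 1)
    simp only [form, reduce, toSpace_apply, hyp_apply, e12] at h1
    exact (pow_natCast_dvd_of_mul f1 (by simpa using h1)).2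
  · rintro ⟨s, rfl⟩
    have h1 := hrow (Sum.inr 1) s
    refine ⟨s * (N (Sum.inr 1) (Sum.inr 2) : ZMod (p ^ δ)), ?_⟩
    simp only [reduce, toSpace_apply, hC, t10, hd, Prod.smul_mk, smul_eq_mul, Int.cast_zero,
      mul_zero, Int.cast_pow, Int.cast_natCast] at h1
    rw [mul_comm _ s]
    exact h1
  · obtain ⟨c, c', hc⟩ := hb
    have h1 := mem_lag.1 hc (Sum.inl 0)
    simp only [form, reduce, toSpace_apply, hyp_apply, e01, e02] at h1
    exact (pow_natCast_dvd_of_mul f0 (by simpa using h1)).2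
  · rintro ⟨s, rfl⟩
    have h1 := hrow (Sum.inr 0) s
    refine ⟨s * (N (Sum.inr 0) (Sum.inr 1) : ZMod (p ^ δ)),
      s * (N (Sum.inr 0) (Sum.inr 2) : ZMod (p ^ δ)), ?_⟩
    simpa [reduce, toSpace_apply, hC, hd, mul_comm] using h1

variable (p) in
/-- The weight `xᵢ p ^ (-i)`, with `i` counted from `0`. -/
noncomputable def wt (i : Fin 3) : Laurent 3 :=
  AddMonoidAlgebra.single (Pi.single i.succ 1) ((p : ℚ) ^ (-((i : ℤ) + 1)))

theorem monom_natCast (d : Fin 3 → ℕ) :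
    monom p δ (fun i => (d i : ℤ)) = x 3 0 ^ δ * (wt p 0 ^ d 0 * wt p 1 ^ d 1 * wt p 2 ^ d 2) := by
  simp only [monom, x, wt, AddMonoidAlgebra.single_pow, AddMonoidAlgebra.single_mul_single, one_pow,
    one_mul, Fin.prod_univ_three, zpow_natCast]
  congr 1
  funext i
  fin_cases i <;> simp <;> rfl

variable (p) in
/-- The weight of a Lagrangian. -/
noncomputable def lagWeight (L : Submodule (ZMod (p ^ δ)) (Space (ZMod (p ^ δ)))) : Laurent 3 :=
  wt p 0 ^ lastExp (red (red L)) * wt p 1 ^ lastExp (red L) * wt p 2 ^ lastExp L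

theorem IsIntCoset.exists_isTriangular {c : Cosets (siegel 3 p)} (h : IsIntCoset p δ c) :
    ∃ T, ∃ d : Fin 3 → ℕ, coset (siegel 3 p) T = c ∧ IsTriangular 3 p T δ (fun i => (d i : ℤ)) ∧
      lastExp (lagCoset p δ c) = d 2 ∧ lastExp (red (lagCoset p δ c)) = d 1 ∧
      lastExp (red (red (lagCoset p δ c))) = d 0 := by
  obtain ⟨N, M, rfl, hM, hN⟩ := h
  obtain ⟨T, ε, d, hT, hT'⟩ := SpHecke.exists_isTriangular M
  obtain ⟨γ, hγ, rfl⟩ := exists_mul_of_coset_eq hT.symm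
  obtain ⟨G, hG, hGγ⟩ := hγ
  have hval : (γ * M).1.1 = (G * N).map (Int.castRingHom ℚ) := by
    have h1 : (γ * M).1.1 = γ.1.1 * M.1.1 := rfl
    rw [h1, hGγ, hM, Matrix.map_mul]
  have hsim : IsSimilitude 3 (γ * M).1.1 ((p : ℚ) ^ (δ : ℤ)) := by
    have h1 := (isSimilitude_of_mem_siegel ⟨G, hG, hGγ⟩).mul (isIntSim_iff.1 hN)
    rw [one_mul, ← hM] at h1
    exact h1
  have hGN : IsIntSim p δ (G * N) := isIntSim_iff.2 (hval ▸ hsim)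
  have hent : ∀ i j, (γ * M).1.1 i j = (((G * N) i j : ℤ) : ℚ) := fun i j => by rw [hval]; rfl
  obtain ⟨h1, h2, h3, h4⟩ := hT'
  have hε : ε = δ := zpow_p_injective (h1.unique hsim)
  subst hε
  have hd : ∀ i, 0 ≤ d i := fun i => by
    refine le_of_zpow_eq (p := p) (m := (G * N) (Sum.inr i) (Sum.inr i)) ?_
    rw [← h4, hent, zpow_zero, mul_one]
  have hd' : ∀ i, ((d i).toNat : ℤ) = d i := fun i => Int.toNat_of_nonneg (hd i)
  refine ⟨γ * M, fun i => (d i).toNat, hT, ⟨h1, h2, h3, fun i => by beta_reduce; rw [h4, hd']⟩, ?_⟩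
  rw [← hT, lagCoset_eq hval hGN]
  refine hGN.lastExp_lag (d := fun i => (d i).toNat) ?_ ?_ ?_
  · intro i j
    have := h2 i j
    rw [hent] at this
    exact_mod_cast this
  · intro i j hij
    have := h3 i j hij
    rw [hent] at this
    exact_mod_cast this
  · intro i
    have := h4 i
    rw [hent, ← hd', zpow_natCast] at this
    exact_mod_cast this

theorem IsIntCoset.cosetMonomial_eq {c : Cosets (siegel 3 p)} (h : IsIntCoset p δ c) :
    cosetMonomial 3 p c = x 3 0 ^ δ * lagWeight p (lagCoset p δ c) := by
  obtain ⟨T, d, hT, hT', h2, h1, h0⟩ := h.exists_isTriangular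
  rw [lagWeight, h0, h1, h2, ← monom_natCast, ← hT, SpHecke.cosetMonomial_eq hT']

end LagrangianType

/-! ## Injectivity of the spherical map -/

section Injective

variable {p : ℕ} [hp : Fact p.Prime]

/-- The type of a Lagrangian. -/
noncomputable def lagType {δ : ℕ} (L : Submodule (ZMod (p ^ δ)) (Space (ZMod (p ^ δ)))) :
    ℕ × ℕ × ℕ × Unit := (lastExp L, lastExp (red L), lastExp (red (red L)), ())

theorem form_separates (δ : ℕ) : Separates (form (ZMod (p ^ δ))) (lagType (p := p)) := by
  have a0 : (0 : LinearMap.BilinForm (ZMod (p ^ δ)) PUnit.{1}).IsAlt := fun _ => rfl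
  have b0 : IsPerfect (0 : LinearMap.BilinForm (ZMod (p ^ δ)) PUnit.{1}) :=
    fun x hx => absurd ⟨x, rfl⟩ hx
  exact (((separates_punit 0 (fun _ => ())).hyp a0 b0).hyp (hyp_isAlt a0) b0.hyp).hyp
    (hyp_isAlt (hyp_isAlt a0)) b0.hyp.hyp

theorem toCosets_translate (t : LocalHecke 3 p) {γ : simGroup 3 p} (hγ : γ ∈ siegel 3 p)
    (c : Cosets (siegel 3 p)) : toCosets (siegel 3 p) t (translate (siegel 3 p) γ c) =
      toCosets (siegel 3 p) t c := by
  have hinj : Function.Injective (translate (siegel 3 p) γ) :=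
    Function.LeftInverse.injective (g := translate (siegel 3 p) γ⁻¹) fun c => by
      rw [translate_translate, mul_inv_cancel, translate_one]
      rfl
  conv_lhs => rw [← act_toCosets (siegel 3 p) t hγ]
  exact Finsupp.mapDomain_apply hinj _ _

/-- The exponent vector of the monomial records multiplier and type, and its coefficient is a power
of `p` depending only on the type. Hence a coefficient of the spherical image is, up to a nonzero
factor, a sum over one type. -/
theorem IsIntCoset.coeff_cosetMonomial {δ ε : ℕ} {c : Cosets (siegel 3 p)}
    (h : IsIntCoset p ε c) (i : ℕ × ℕ × ℕ × Unit) [Decidable (IsIntCoset p δ c ∧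
      lagType (lagCoset p δ c) = i)] :
    (cosetMonomial 3 p c).coeff (Fin.cons (δ : ℤ) ![(i.2.2.1 : ℤ), (i.2.1 : ℤ), (i.1 : ℤ)]) =
      (if IsIntCoset p δ c ∧ lagType (lagCoset p δ c) = i then 1 else 0) *
        ∏ k : Fin 3, ((p : ℚ) ^ (-((k : ℤ) + 1))) ^
          (![(i.2.2.1 : ℤ), (i.2.1 : ℤ), (i.1 : ℤ)] : Fin 3 → ℤ) k := by
  obtain ⟨T, d, rfl, hT', h2, h1, h0⟩ := h.exists_isTriangular
  rw [SpHecke.cosetMonomial_eq hT', monom, AddMonoidAlgebra.coeff_single]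
  by_cases hi : IsIntCoset p δ (coset (siegel 3 p) T) ∧
      lagType (lagCoset p δ (coset (siegel 3 p) T)) = i
  · rw [if_pos hi, one_mul]
    obtain ⟨hδ, rfl⟩ := hi
    obtain ⟨T₁, d₁, hT₁, hT₁', -⟩ := hδ.exists_isTriangular
    have hδε := (hT'.unique hT₁' hT₁.symm).1
    have hδε' : ε = δ := by exact_mod_cast hδε
    subst hδε'
    have hd : (![((d 0 : ℕ) : ℤ), (d 1 : ℤ), (d 2 : ℤ)] : Fin 3 → ℤ) = fun k => (d k : ℤ) := by
      funext k
      fin_cases k <;> rfl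
    simp only [lagType, h0, h1, h2, hd, Finsupp.single_eq_same]
  · rw [if_neg hi, zero_mul]
    refine Finsupp.single_eq_of_ne fun heq => hi ?_
    have e : (δ : ℤ) = ε := congrFun heq 0
    have e0 : (i.2.2.1 : ℤ) = d 0 := congrFun heq 1
    have e1 : (i.2.1 : ℤ) = d 1 := congrFun heq 2
    have e2 : (i.1 : ℤ) = d 2 := congrFun heq 3
    have e' : ε = δ := by exact_mod_cast e.symm
    subst e'
    refine ⟨h, ?_⟩
    simp only [lagType, h0, h1, h2]
    refine Prod.ext ?_ (Prod.ext ?_ (Prod.ext ?_ rfl))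
    · exact_mod_cast e2.symm
    · exact_mod_cast e1.symm
    · exact_mod_cast e0.symm

/-- The coefficients of `t` on cosets of multiplier `p ^ δ` become a transvection-invariant function
`g` on Lagrangians, extended by zero. Vanishing of the spherical image makes its sums over types
zero, and `form_separates` applies. -/
theorem eq_zero_of_isInt (t : LocalHecke 3 p)
    (hint : ∀ c ∈ (toCosets (siegel 3 p) t).support, ∃ δ, IsIntCoset p δ c)
    (h0 : Omega 3 p t = 0) : t = 0 := by
  classical
  set f := toCosets (siegel 3 p) t with hf
  suffices h : ∀ δ c, IsIntCoset p δ c → f c = 0 by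
    refine toCosets_injective _ ?_
    rw [map_zero]
    ext c
    by_contra hc
    obtain ⟨δ, hδ⟩ := hint c (Finsupp.mem_support_iff.2 hc)
    exact hc (h δ c hδ)
  intro δ
  let g : Submodule (ZMod (p ^ δ)) (Space (ZMod (p ^ δ))) → ℚ := fun L =>
    ∑ c ∈ f.support with IsIntCoset p δ c ∧ lagCoset p δ c = L, f c
  have hmap : ∀ L w a c, IsIntCoset p δ c → lagCoset p δ c = L → ∃ γ ∈ siegel 3 p,
      IsIntCoset p δ (translate (siegel 3 p) γ c) ∧
      lagCoset p δ (translate (siegel 3 p) γ c) = L.map (transv (form _) w a) := by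
    rintro L w a c hc rfl
    exact exists_translate_of_transvRel hc (TransvRel.single _ _ w a)
  have hg : ∀ c, IsIntCoset p δ c → g (lagCoset p δ c) = f c := by
    intro c hc
    refine Finset.sum_eq_single c ?_ ?_
    · intro c' hc' hne
      rw [Finset.mem_filter] at hc'
      exact absurd (hc'.2.1.eq_of_lagCoset_eq hc hc'.2.2) hne
    · intro hn
      by_contra hfc
      exact hn (Finset.mem_filter.2 ⟨Finsupp.mem_support_iff.2 hfc, hc, rfl⟩)
  have hg0 : ∀ L, (¬ ∃ c, IsIntCoset p δ c ∧ lagCoset p δ c = L) → g L = 0 := by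
    intro L hL
    refine Finset.sum_eq_zero fun c hc => ?_
    exact absurd ⟨c, (Finset.mem_filter.1 hc).2⟩ hL
  have hinv : ∀ L w a, g (L.map (transv (form _) w a)) = g L := by
    intro L w a
    by_cases hL : ∃ c, IsIntCoset p δ c ∧ lagCoset p δ c = L
    · obtain ⟨c, hc, hcL⟩ := hL
      obtain ⟨γ, hγ, h1, h2⟩ := hmap L w a c hc hcL
      rw [← h2, hg _ h1, ← hcL, hg _ hc]
      exact toCosets_translate t hγ c
    · rw [hg0 L hL, hg0]
      -- If the image came from a coset, so would `L`, by the inverse transvection.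
      rintro ⟨c, hc, hcL⟩
      obtain ⟨γ, hγ, h1, h2⟩ := hmap _ w (-a) c hc hcL
      refine hL ⟨_, h1, ?_⟩
      rw [h2]
      ext x
      rw [mem_map_transv (form_isAlt _), neg_neg, mem_map_transv (form_isAlt _),
        transv_transv_neg (form_isAlt _)]
  intro c hc
  rw [← hg c hc]
  refine form_separates δ g hinv (fun i => ?_) _ hc.isLagrangian
  have h1 : ∑ L with IsLagrangian (form _) L ∧ lagType L = i, g L =
      ∑ c ∈ f.support with IsIntCoset p δ c ∧ lagType (lagCoset p δ c) = i, f c := by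
    rw [← Finset.sum_fiberwise_of_maps_to (g := lagCoset p δ)
      (t := Finset.univ.filter fun L => IsLagrangian (form _) L ∧ lagType L = i)]
    · refine Finset.sum_congr rfl fun L hL => Finset.sum_congr ?_ fun _ _ => rfl
      rw [Finset.mem_filter] at hL
      ext c
      simp only [Finset.mem_filter]
      constructor
      · rintro ⟨h1, h2, rfl⟩
        exact ⟨⟨h1, h2, hL.2.2⟩, rfl⟩
      · rintro ⟨⟨h1, h2, -⟩, h3⟩
        exact ⟨h1, h2, h3⟩
    · intro c hc
      rw [Finset.mem_filter] at hc ⊢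
      exact ⟨Finset.mem_univ _, hc.2.1.isLagrangian, hc.2.2⟩
  refine Eq.trans (b := ∑ c ∈ f.support with IsIntCoset p δ c ∧ lagType (lagCoset p δ c) = i, f c)
    (by convert h1) ?_
  have h2 := congrArg (fun y : Laurent 3 =>
    y.coeff (Fin.cons (δ : ℤ) ![(i.2.2.1 : ℤ), (i.2.1 : ℤ), (i.1 : ℤ)])) h0
  have h3 : Omega 3 p t = ∑ c ∈ f.support, f c • cosetMonomial 3 p c := rfl
  rw [h3] at h2
  simp only [AddMonoidAlgebra.coeff_sum, AddMonoidAlgebra.coeff_zero, Finsupp.coe_zero,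
    Pi.zero_apply, Finsupp.finsetSum_apply, AddMonoidAlgebra.coeff_smul_apply, smul_eq_mul] at h2
  rw [Finset.sum_congr rfl fun c hc => by
    obtain ⟨ε, hε⟩ := hint c hc
    rw [hε.coeff_cosetMonomial (δ := δ) i, ← mul_assoc], ← Finset.sum_mul, mul_eq_zero] at h2
  have hp0 : (p : ℚ) ≠ 0 := p_ratCast_ne_zero
  rw [Finset.sum_filter]
  simpa using h2.resolve_right
    (Finset.prod_ne_zero_iff.2 fun k _ => zpow_ne_zero _ (zpow_ne_zero _ hp0))

variable (p) in
/-- The scalar matrix `p E₆`. -/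
noncomputable def scalarElt : simGroup 3 p := diagElt 3 p 2 fun _ => 1

theorem scalarElt_val : (scalarElt p).1.1 = (p : ℚ) • 1 := by
  change diagonal _ = _
  rw [smul_one_eq_diagonal]
  congr 1
  funext i
  rcases i with i | i <;> simp

theorem mul_scalarElt (M : simGroup 3 p) : M * scalarElt p = scalarElt p * M := by
  refine Subtype.ext (Units.ext ?_)
  change M.1.1 * (scalarElt p).1.1 = (scalarElt p).1.1 * M.1.1
  rw [scalarElt_val]
  simp

theorem scalarElt_pow_val (k : ℕ) : (scalarElt p ^ k).1.1 = (p : ℚ) ^ k • 1 := by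
  induction k with
  | zero => simp
  | succ k ih =>
    have h : (scalarElt p ^ (k + 1)).1.1 = (scalarElt p ^ k).1.1 * (scalarElt p).1.1 := by
      rw [pow_succ]
      rfl
    rw [h, ih, scalarElt_val, smul_mul_smul_comm, pow_succ, Matrix.one_mul]

theorem toCosets_bracket : toCosets (siegel 3 p) (bracket 3 p) =
    Finsupp.single (coset (siegel 3 p) (scalarElt p)) 1 := by
  change ∑ c ∈ (cosetsIn_finite 3 p (scalarElt p)).toFinset, Finsupp.single c 1 = _
  have h : (cosetsIn_finite 3 p (scalarElt p)).toFinset = {coset (siegel 3 p) (scalarElt p)} := by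
    ext c
    rw [Set.Finite.mem_toFinset, Finset.mem_singleton]
    constructor
    · rintro ⟨γ, rfl⟩
      beta_reduce
      rw [← mul_scalarElt, coset_mul_left γ.2]
    · rintro rfl
      exact ⟨1, by simp⟩
  rw [h, Finset.sum_singleton]

theorem toCosets_mul_bracket_pow (t : LocalHecke 3 p) (k : ℕ) :
    toCosets (siegel 3 p) (t * bracket 3 p ^ k) =
      act (siegel 3 p) (scalarElt p ^ k) (toCosets (siegel 3 p) t) := by
  induction k with
  | zero => rw [pow_zero, pow_zero, mul_one, act_one]
  | succ k ih =>
    rw [pow_succ, ← mul_assoc, toCosets_mul, toCosets_bracket, cosetMul_single, one_smul,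
      act_eq_of_coset_eq _ _ (coset_out _ _), ih, act_act, pow_succ]

theorem exists_isIntCoset (c : Cosets (siegel 3 p)) : ∃ K, ∀ k ≥ K, ∃ δ,
    IsIntCoset p δ (translate (siegel 3 p) (scalarElt p ^ k) c) := by
  rw [← coset_out _ c]
  set M := c.out
  obtain ⟨K, hK⟩ := exists_common_denom p M.2.1
  refine ⟨K, fun k hk => ?_⟩
  obtain ⟨-, ε, hε⟩ := (M * scalarElt p ^ k).2
  have hval : (M * scalarElt p ^ k).1.1 = (p : ℚ) ^ k • M.1.1 := by
    have h1 : (M * scalarElt p ^ k).1.1 = M.1.1 * (scalarElt p ^ k).1.1 := rfl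
    rw [h1, scalarElt_pow_val, Matrix.mul_smul, Matrix.mul_one]
  choose A hA using hK
  have hN : (M * scalarElt p ^ k).1.1 =
      (Matrix.of fun i j => (p : ℤ) ^ (k - K) * A i j).map (Int.castRingHom ℚ) := by
    ext i j
    rw [hval, Matrix.smul_apply, smul_eq_mul, Matrix.map_apply, Matrix.of_apply, map_mul, map_pow,
      eq_intCast, eq_intCast, ← hA]
    push_cast
    rw [← mul_assoc, ← pow_add, Nat.sub_add_cancel hk]
  generalize (Matrix.of fun i j => (p : ℤ) ^ (k - K) * A i j) = N at hN
  -- The multiplier is an entry of an integral matrix, so its exponent is not negative.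
  have hε0 : 0 ≤ ε := by
    have h1 := congrFun (congrFun hε (Sum.inr 0)) (Sum.inl 0)
    rw [hN, ← map_J (Fin 3) (Int.castRingHom ℚ), ← transpose_map, ← Matrix.map_mul,
      ← Matrix.map_mul] at h1
    refine le_of_zpow_eq (p := p) (m := (Nᵀ * J (Fin 3) ℤ * N) (Sum.inr 0) (Sum.inl 0)) ?_
    rw [zpow_zero, mul_one]
    simpa [J] using h1.symm
  obtain ⟨δ, rfl⟩ := Int.eq_ofNat_of_zero_le hε0
  exact ⟨δ, N, M * scalarElt p ^ k, rfl, hN, isIntSim_iff.2 (hN ▸ hε)⟩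

/-- Finitely many cosets occur, so one power of `[p]` makes all of them integral. Multiplication by
it is translation by a scalar matrix, which can be undone on combinations of cosets. -/
theorem Omega_injective : Function.Injective (Omega 3 p) := by
  rw [injective_iff_map_eq_zero]
  intro t ht
  choose K hK using fun c => exists_isIntCoset (p := p) c
  obtain ⟨k, hk⟩ := ((toCosets (siegel 3 p) t).support.image K).exists_le
  have h1 : t * bracket 3 p ^ k = 0 := by
    refine eq_zero_of_isInt _ ?_ (by rw [Omega_mul, ht, zero_mul])
    classical
    intro c hc
    rw [toCosets_mul_bracket_pow] at hc
    obtain ⟨c, hc', rfl⟩ := Finset.mem_image.1 (Finsupp.mapDomain_support hc)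
    exact hK c k (hk _ (Finset.mem_image_of_mem _ hc'))
  have h2 := toCosets_mul_bracket_pow t k
  rw [h1, map_zero] at h2
  refine toCosets_injective _ ?_
  rw [map_zero, ← act_one (siegel 3 p) (toCosets (siegel 3 p) t),
    ← mul_inv_cancel (scalarElt p ^ k), ← act_act, ← h2, map_zero]

end Injective

/-! ## The spherical images of the generators -/

section DiagonalLagrangian

variable {p δ : ℕ} [hp : Fact p.Prime]

variable (p δ) in
/-- `diag(p ^ a₁, p ^ a₂, p ^ a₃; p ^ (δ - a₁), p ^ (δ - a₂), p ^ (δ - a₃))`. -/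
def diagMat (a : Fin 3 → ℕ) : Matrix (Fin 3 ⊕ Fin 3) (Fin 3 ⊕ Fin 3) ℤ :=
  diagonal (Sum.elim (fun j => (p : ℤ) ^ a j) (fun j => (p : ℤ) ^ (δ - a j)))

variable {a : Fin 3 → ℕ}

theorem diagElt_val (ha : ∀ j, a j ≤ δ) :
    (diagElt 3 p δ (fun j => (a j : ℤ))).1.1 = (diagMat p δ a).map (Int.castRingHom ℚ) := by
  change diagonal _ = _
  rw [diagMat, diagonal_map (map_zero _)]
  congr 1
  funext i
  rcases i with i | i
  · simp
  · simp [← Nat.cast_sub (ha i)]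

theorem isIntSim_diagMat (ha : ∀ j, a j ≤ δ) : IsIntSim p δ (diagMat p δ a) := by
  have h : ∀ j, (p : ℤ) ^ a j * (p : ℤ) ^ (δ - a j) = (p : ℤ) ^ δ := fun j => by
    rw [← pow_add, Nat.add_sub_cancel' (ha j)]
  unfold IsIntSim diagMat
  ext i j
  rw [diagonal_transpose, mul_diagonal, diagonal_mul, Matrix.smul_apply, smul_eq_mul]
  rcases i with i | i <;> rcases j with j | j <;>
    simp only [J, fromBlocks_apply₁₁, fromBlocks_apply₁₂, fromBlocks_apply₂₁, fromBlocks_apply₂₂,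
      Matrix.zero_apply, Matrix.neg_apply, Matrix.one_apply, Sum.elim_inl, Sum.elim_inr, mul_zero,
      zero_mul]
  · split_ifs with hij
    · subst hij
      linear_combination -h i
    · simp
  · split_ifs with hij
    · subst hij
      linear_combination h i
    · simp

theorem isIntCoset_diagElt (ha : ∀ j, a j ≤ δ) :
    IsIntCoset p δ (coset (siegel 3 p) (diagElt 3 p δ (fun j => (a j : ℤ)))) :=
  ⟨_, _, rfl, diagElt_val ha, isIntSim_diagMat ha⟩

theorem lag_diagMat (ha : ∀ j, a j ≤ δ) : lag p δ (diagMat p δ a) =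
    splitSum ((p : ZMod (p ^ δ)) ^ a 2) ((p : ZMod (p ^ δ)) ^ (δ - a 2))
      (splitSum ((p : ZMod (p ^ δ)) ^ a 1) ((p : ZMod (p ^ δ)) ^ (δ - a 1))
        (splitSum ((p : ZMod (p ^ δ)) ^ a 0) ((p : ZMod (p ^ δ)) ^ (δ - a 0)) ⊤)) := by
  have h1 : ∀ (j : Fin 3) (b : ZMod (p ^ δ)),
      b * (p : ZMod (p ^ δ)) ^ a j = 0 ↔ (p : ZMod (p ^ δ)) ^ (δ - a j) ∣ b := fun j b => by
    rw [mul_comm, pow_mul_eq_zero_iff (ha j)]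
  have h2 : ∀ (j : Fin 3) (b : ZMod (p ^ δ)),
      b * (p : ZMod (p ^ δ)) ^ (δ - a j) = 0 ↔ (p : ZMod (p ^ δ)) ^ a j ∣ b := fun j b => by
    rw [mul_comm, pow_mul_eq_zero_iff (Nat.sub_le _ _), Nat.sub_sub_self (ha j)]
  ext ⟨b₂, ⟨b₁, ⟨b₀, b, c₀⟩, c₁⟩, c₂⟩
  rw [mem_lag]
  simp only [Sum.forall, Fin.forall_fin_succ, form, reduce, toSpace_apply, hyp_apply, diagMat,
    mem_splitSum]
  simp [h1, h2]
  tauto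

theorem card_pow_dvd_eq (d : ℕ) :
    Nat.card {c : ZMod (p ^ δ) // (p : ZMod (p ^ δ)) ^ d ∣ c} = p ^ (δ - d) := by
  rcases le_total d δ with h | h
  · exact card_pow_dvd h
  · have h1 : (p : ZMod (p ^ δ)) ^ d = (p : ZMod (p ^ δ)) ^ δ := by
      rw [natCast_pow_self, pow_eq_zero_iff_le.2 h]
    rw [h1, card_pow_dvd le_rfl, Nat.sub_self, Nat.sub_eq_zero_of_le h]

variable {V : Type*} [AddCommGroup V] [Module (ZMod (p ^ δ)) V] [Finite V]

theorem card_splitSum (i j : ℕ) (L : Submodule (ZMod (p ^ δ)) V) :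
    Nat.card (splitSum ((p : ZMod (p ^ δ)) ^ i) ((p : ZMod (p ^ δ)) ^ j) L) =
      p ^ (δ - i) * (Nat.card L * p ^ (δ - j)) := by
  have h := Nat.card_congr (α := splitSum ((p : ZMod (p ^ δ)) ^ i) ((p : ZMod (p ^ δ)) ^ j) L)
    (β := {c : ZMod (p ^ δ) // (p : ZMod (p ^ δ)) ^ i ∣ c} × L ×
      {c : ZMod (p ^ δ) // (p : ZMod (p ^ δ)) ^ j ∣ c})
    { toFun := fun x => (⟨x.1.1, x.2.1⟩, ⟨x.1.2.1, x.2.2.1⟩, ⟨x.1.2.2, x.2.2.2⟩)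
      invFun := fun x => ⟨(x.1.1, x.2.1.1, x.2.2.1), x.1.2, x.2.1.2, x.2.2.2⟩
      left_inv := fun _ => rfl
      right_inv := fun _ => rfl }
  rw [h, Nat.card_prod, Nat.card_prod, card_pow_dvd_eq, card_pow_dvd_eq]

theorem map_lsmul_splitSum (i j : ℕ) (L : Submodule (ZMod (p ^ δ)) V) :
    (splitSum ((p : ZMod (p ^ δ)) ^ i) ((p : ZMod (p ^ δ)) ^ j) L).map
      (LinearMap.lsmul (ZMod (p ^ δ)) _ (p : ZMod (p ^ δ))) =
    splitSum ((p : ZMod (p ^ δ)) ^ (i + 1)) ((p : ZMod (p ^ δ)) ^ (j + 1))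
      (L.map (LinearMap.lsmul (ZMod (p ^ δ)) V (p : ZMod (p ^ δ)))) := by
  ext ⟨b, v, c⟩
  constructor
  · rintro ⟨⟨b, v, c⟩, ⟨h1, h2, h3⟩, h⟩
    obtain ⟨rfl, rfl, rfl⟩ : (p : ZMod (p ^ δ)) * b = _ ∧ (p : ZMod (p ^ δ)) • v = _ ∧
        (p : ZMod (p ^ δ)) * c = _ := by simpa using h
    refine ⟨?_, ⟨v, h2, rfl⟩, ?_⟩
    · rw [pow_succ']
      exact mul_dvd_mul_left _ h1
    · rw [pow_succ']
      exact mul_dvd_mul_left _ h3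
  · rintro ⟨⟨b, rfl⟩, ⟨v, hv, rfl⟩, ⟨c, rfl⟩⟩
    refine ⟨((p : ZMod (p ^ δ)) ^ i * b, v, (p : ZMod (p ^ δ)) ^ j * c),
      ⟨dvd_mul_right _ _, hv, dvd_mul_right _ _⟩, ?_⟩
    simp [pow_succ', mul_assoc]

/-- Multiplication by `p` raises both exponents in each plane by one. A plane with `a j = 0` then
contributes a factor `p` to the order, and a plane with `a j = 1` contributes nothing. -/
theorem rk_lag_diagMat {a : Fin 3 → ℕ} (ha : ∀ j, a j ≤ 1) :
    rk (lag p 2 (diagMat p 2 a)) = (1 - a 0) + (1 - a 1) + (1 - a 2) := by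
  have h : ∀ j, (2 - (a j + 1)) = 1 - a j ∧ 2 - (2 - a j + 1) = 0 := fun j => by
    have := ha j
    omega
  rw [rk, lag_diagMat fun j => (ha j).trans (by norm_num), map_lsmul_splitSum, map_lsmul_splitSum,
    map_lsmul_splitSum, card_splitSum, card_splitSum, card_splitSum]
  simp only [h, pow_zero, mul_one, Nat.card_unique]
  rw [← pow_add, ← pow_add, Nat.log_pow hp.out.one_lt]
  omega

end DiagonalLagrangian

/-! ### Double cosets as orbits of Lagrangians. -/

section Images

variable {p δ : ℕ} [hp : Fact p.Prime]

open Classical in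
-- The property `P` has to cut out one orbit: `h1` says that translates stay inside it, `h2` that
-- transvections reach all of it.
theorem Omega_double_eq_sum {M : simGroup 3 p} (hM : IsIntCoset p δ (coset (siegel 3 p) M))
    {P : Submodule (ZMod (p ^ δ)) (Space (ZMod (p ^ δ))) → Prop}
    (h1 : ∀ G ∈ symplecticGroup (Fin 3) ℤ,
      P ((lagCoset p δ (coset (siegel 3 p) M)).map (rightMul (p ^ δ) G)))
    (h2 : ∀ L, IsLagrangian (form _) L → P L →
      TransvRel (form _) (lagCoset p δ (coset (siegel 3 p) M)) L) :
    Omega 3 p (double 3 p M) =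
      x 3 0 ^ δ * ∑ L with IsLagrangian (form (ZMod (p ^ δ))) L, if P L then lagWeight p L else 0 := by
  rw [Omega_double, ← Finset.sum_filter, Finset.filter_filter, Finset.mul_sum]
  have hint : ∀ c ∈ (cosetsIn_finite 3 p M).toFinset,
      IsIntCoset p δ c ∧ P (lagCoset p δ c) := by
    intro c hc
    rw [Set.Finite.mem_toFinset] at hc
    obtain ⟨⟨γ, G, hG, hGγ⟩, rfl⟩ := hc
    have h3 := hM.translate hG hGγ
    rw [translate_coset] at h3
    exact ⟨h3.1, h3.2 ▸ h1 G hG⟩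
  refine Finset.sum_bij (fun c _ => lagCoset p δ c) ?_ ?_ ?_ ?_
  · intro c hc
    rw [Finset.mem_filter]
    exact ⟨Finset.mem_univ _, (hint c hc).1.isLagrangian, (hint c hc).2⟩
  · intro c hc c' hc' h
    exact (hint c hc).1.eq_of_lagCoset_eq (hint c' hc').1 h
  · intro L hL
    rw [Finset.mem_filter] at hL
    obtain ⟨γ, hγ, -, h3⟩ := exists_translate_of_transvRel hM (h2 L hL.2.1 hL.2.2)
    refine ⟨_, ?_, h3⟩
    rw [Set.Finite.mem_toFinset]
    exact ⟨⟨γ, hγ⟩, rfl⟩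
  · intro c hc
    exact (hint c hc).1.cosetMonomial_eq

theorem form_isSymplecticModP : IsSymplecticModP (form (ZMod (p ^ 1))) 3 :=
  (isSymplecticModP_punit 0).hyp.hyp.hyp

theorem form_isSymplecticModPSq : IsSymplecticModPSq (form (ZMod (p ^ 2))) 3 :=
  (isSymplecticModPSq_punit 0).hyp.hyp.hyp

open Classical in
theorem sum_lagrangian_punit {q : ℕ} {A : Type*} [AddCommMonoid A]
    (W : Submodule (ZMod q) PUnit.{1} → A) :
    ∑ L with IsLagrangian (0 : LinearMap.BilinForm (ZMod q) PUnit.{1}) L, W L = W ⊤ := by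
  rw [Finset.sum_eq_single ⊤]
  · intro L _ hL
    exact absurd (Subsingleton.elim _ _) hL
  · intro h
    exact absurd (Finset.mem_filter.2 ⟨Finset.mem_univ _, fun v => ⟨fun _ _ _ => rfl,
      fun _ => trivial⟩⟩) h

theorem Omega_heckeT : Omega 3 p (heckeT 3 p) =
    x 3 0 * ((1 + p ^ 3 * wt p 2) * ((1 + p ^ 2 * wt p 1) * (1 + p * wt p 0))) := by
  classical
  have h0 : (diagElt 3 p 1 0) = diagElt 3 p (1 : ℕ) (fun j => ((0 : ℕ) : ℤ)) := rfl
  have hM := isIntCoset_diagElt (p := p) (δ := 1) (a := fun _ => 0) (fun _ => Nat.zero_le _)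
  rw [heckeT, h0, Omega_double_eq_sum hM (P := fun _ => True) (fun _ _ => trivial)
    fun L hL _ => form_isSymplecticModP.transvRel _ _ hM.isLagrangian hL]
  simp only [if_true, pow_one, lagWeight]
  congr 1
  have s2 := (isSymplecticModP_punit (p := p) 0).hyp.hyp.sum_hyp (wt p 2)
    (fun L => wt p 0 ^ lastExp (red L) * wt p 1 ^ lastExp L)
  have s1 := (isSymplecticModP_punit (p := p) 0).hyp.sum_hyp (wt p 1)
    (fun L => wt p 0 ^ lastExp L)
  have s0 := (isSymplecticModP_punit (p := p) 0).sum_hyp (wt p 0) (fun _ => 1)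
  simp only [one_mul, sum_lagrangian_punit, mul_one, zero_add, pow_one] at s0
  rw [s0] at s1
  rw [s1] at s2
  exact s2

/-- One step of the recursion for the sums over Lagrangians of given rank. -/
def rankStep {A : Type*} [CommRing A] (p n : ℕ) (y : A) (φ : ℕ → A) (k : ℕ) : A :=
  (1 + p ^ (2 * n + 2) * y ^ 2) * φ (k + 1) + y * (p ^ k * φ k + (p ^ (k + 1) - p ^ k) * φ (k + 1) +
    (p ^ (2 * n - k + 1) - p ^ (k + 1)) * φ (k + 2))

open Classical in
-- The planes are peeled off from the outside. The plane of index `2`, over a module of rank `4`,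
-- acts on `φ` first, and the recursion ends at the zero module of rank `0`.
theorem sum_lagWeight (φ : ℕ → Laurent 3) :
    ∑ L with IsLagrangian (form (ZMod (p ^ 2))) L, lagWeight p L * φ (rk L) =
      rankStep p 0 (wt p 0) (rankStep p 1 (wt p 1) (rankStep p 2 (wt p 2) φ)) 0 := by
  have s2 := (isSymplecticModPSq_punit (p := p) 0).hyp.hyp.sum_hyp (wt p 2)
    (fun L => wt p 0 ^ lastExp (red L) * wt p 1 ^ lastExp L) φ
  have s1 := (isSymplecticModPSq_punit (p := p) 0).hyp.sum_hyp (wt p 1)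
    (fun L => wt p 0 ^ lastExp L) (rankStep p 2 (wt p 2) φ)
  have s0 := (isSymplecticModPSq_punit (p := p) 0).sum_hyp (wt p 0) (fun _ => 1)
    (rankStep p 1 (wt p 1) (rankStep p 2 (wt p 2) φ))
  have hrk : rk (⊤ : Submodule (ZMod (p ^ 2)) PUnit.{1}) = 0 := by simp [rk]
  simp only [one_mul, sum_lagrangian_punit, hrk] at s0
  exact s2.trans (s1.trans s0)

/-- The Lagrangian of the diagonal matrix has rank `3 - i`, the number of entries `1` in its first
half, and modulo `p ^ 2` the rank determines the orbit. -/
theorem Omega_heckeTi {i : ℕ} (h1 : 1 ≤ i) (h3 : i ≤ 3) : Omega 3 p (heckeTi 3 p i) =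
    x 3 0 ^ 2 * rankStep p 0 (wt p 0) (rankStep p 1 (wt p 1) (rankStep p 2 (wt p 2)
      fun k => if k = 3 - i then 1 else 0)) 0 := by
  classical
  let a : Fin 3 → ℕ := fun j => if (j : ℕ) + i < 3 then 0 else 1
  have ha : ∀ j, a j ≤ 1 := fun j => by
    simp only [a]
    split_ifs <;> norm_num
  have ha2 : ∀ j, a j ≤ 2 := fun j => (ha j).trans (by norm_num)
  have h0 : (diagElt 3 p 2 (fun j => if (j : ℕ) + i < 3 then 0 else 1)) =
      diagElt 3 p (2 : ℕ) (fun j => (a j : ℤ)) := by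
    congr 1
    funext j
    simp only [a]
    push_cast
    rfl
  have hM := isIntCoset_diagElt (p := p) ha2
  have hr : rk (lagCoset p 2 (coset (siegel 3 p) (diagElt 3 p (2 : ℕ) (fun j => (a j : ℤ))))) =
      3 - i := by
    rw [lagCoset_eq (diagElt_val ha2) (isIntSim_diagMat ha2), rk_lag_diagMat ha]
    simp only [a]
    interval_cases i <;> simp
  rw [heckeTi, h0, Omega_double_eq_sum hM (P := fun L => rk L = 3 - i)
    (fun G hG => (rk_map _ (rightMul_injective _ hG)).trans hr)
    fun L hL hL' => form_isSymplecticModPSq.transvRel _ _ hM.isLagrangian hL (hr.trans hL'.symm),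
    ← sum_lagWeight]
  congr 1
  refine Finset.sum_congr rfl fun L _ => ?_
  by_cases h : rk L = 3 - i <;> simp [h]

theorem bracket_eq_heckeTi : bracket 3 p = heckeTi 3 p 3 := by
  rw [bracket, heckeTi]
  congr 2

theorem x_succ (i : Fin 3) : x 3 i.succ = (p : Laurent 3) ^ ((i : ℕ) + 1) * wt p i := by
  have hp0 : (p : ℚ) ≠ 0 := p_ratCast_ne_zero
  have h : (p : Laurent 3) ^ ((i : ℕ) + 1) =
      AddMonoidAlgebra.single 0 ((p : ℚ) ^ ((i : ℕ) + 1)) := by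
    rw [AddMonoidAlgebra.natCast_def, AddMonoidAlgebra.single_pow, smul_zero]
  rw [h, x, wt, AddMonoidAlgebra.single_mul_single, zero_add]
  congr 1
  rw [_root_.zpow_neg, ← zpow_natCast]
  push_cast
  exact (mul_inv_cancel₀ (zpow_ne_zero _ hp0)).symm

end Images

/-! ## The spinor polynomial -/

section Spinor

theorem rankStep_rank_zero {A : Type*} [CommRing A] (p : ℕ) (y₀ y₁ y₂ : A) :
    rankStep p 0 y₀ (rankStep p 1 y₁ (rankStep p 2 y₂ fun k => if k = 3 - 3 then 1 else 0)) 0 =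
      y₀ * y₁ * y₂ := by
  simp [rankStep]
  ring

theorem rankStep_rank_one {A : Type*} [CommRing A] (p : ℕ) (y₀ y₁ y₂ : A) :
    rankStep p 0 y₀ (rankStep p 1 y₁ (rankStep p 2 y₂ fun k => if k = 3 - 2 then 1 else 0)) 0 =
      p * y₀ * y₂ + p ^ 2 * y₁ * y₂ + (p ^ 3 - 1) * y₀ * y₁ * y₂ + p ^ 4 * y₀ ^ 2 * y₁ * y₂ +
        p ^ 5 * y₀ * y₁ ^ 2 * y₂ + p ^ 6 * y₀ * y₁ * y₂ ^ 2 + y₀ * y₁ := by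
  simp [rankStep]
  ring

theorem rankStep_rank_two {A : Type*} [CommRing A] (p : ℕ) (y₀ y₁ y₂ : A) :
    rankStep p 0 y₀ (rankStep p 1 y₁ (rankStep p 2 y₂ fun k => if k = 3 - 1 then 1 else 0)) 0 =
      (p ^ 2 - 1) * y₀ * y₁ + p * (p ^ 2 - 1) * y₀ * y₂ + p ^ 2 * (p ^ 2 - 1) * y₁ * y₂ +
        p ^ 2 * (3 * p ^ 3 - p ^ 2 - p - 1) * y₀ * y₁ * y₂ +
        p ^ 4 * (p ^ 2 - 1) * y₀ ^ 2 * y₁ * y₂ + p ^ 5 * (p ^ 2 - 1) * y₀ * y₁ ^ 2 * y₂ +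
        p ^ 6 * (p ^ 2 - 1) * y₀ * y₁ * y₂ ^ 2 + y₀ + p * y₁ + p ^ 2 * y₂ +
        p ^ 3 * y₀ ^ 2 * y₁ + p ^ 4 * y₀ * y₁ ^ 2 + p ^ 4 * y₀ ^ 2 * y₂ + p ^ 6 * y₀ * y₂ ^ 2 +
        p ^ 6 * y₁ ^ 2 * y₂ + p ^ 7 * y₁ * y₂ ^ 2 + p ^ 8 * y₀ ^ 2 * y₁ ^ 2 * y₂ +
        p ^ 9 * y₀ ^ 2 * y₁ * y₂ ^ 2 + p ^ 10 * y₀ * y₁ ^ 2 * y₂ ^ 2 := by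
  simp [rankStep]
  ring

/-- In terms of the weights, `xᵢ` is `p ^ i` times the weight `y` of index `i - 1`. Then all
coefficients are integral and the identity holds over every commutative ring, in particular over
polynomials in `v`. -/
theorem spinor_identity {A : Type*} [CommRing A] (p a y₀ y₁ y₂ v T T₁ T₂ B : A)
    (hT : T = a * ((1 + p ^ 3 * y₂) * ((1 + p ^ 2 * y₁) * (1 + p * y₀))))
    (hT₁ : T₁ = a ^ 2 * ((p ^ 2 - 1) * y₀ * y₁ + p * (p ^ 2 - 1) * y₀ * y₂ +
      p ^ 2 * (p ^ 2 - 1) * y₁ * y₂ +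
        p ^ 2 * (3 * p ^ 3 - p ^ 2 - p - 1) * y₀ * y₁ * y₂ +
        p ^ 4 * (p ^ 2 - 1) * y₀ ^ 2 * y₁ * y₂ + p ^ 5 * (p ^ 2 - 1) * y₀ * y₁ ^ 2 * y₂ +
        p ^ 6 * (p ^ 2 - 1) * y₀ * y₁ * y₂ ^ 2 + y₀ + p * y₁ + p ^ 2 * y₂ +
        p ^ 3 * y₀ ^ 2 * y₁ + p ^ 4 * y₀ * y₁ ^ 2 + p ^ 4 * y₀ ^ 2 * y₂ + p ^ 6 * y₀ * y₂ ^ 2 +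
        p ^ 6 * y₁ ^ 2 * y₂ + p ^ 7 * y₁ * y₂ ^ 2 + p ^ 8 * y₀ ^ 2 * y₁ ^ 2 * y₂ +
        p ^ 9 * y₀ ^ 2 * y₁ * y₂ ^ 2 + p ^ 10 * y₀ * y₁ ^ 2 * y₂ ^ 2))
    (hT₂ : T₂ = a ^ 2 * (p * y₀ * y₂ + p ^ 2 * y₁ * y₂ + (p ^ 3 - 1) * y₀ * y₁ * y₂ +
      p ^ 4 * y₀ ^ 2 * y₁ * y₂ + p ^ 5 * y₀ * y₁ ^ 2 * y₂ + p ^ 6 * y₀ * y₁ * y₂ ^ 2 + y₀ * y₁))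
    (hB : B = a ^ 2 * (y₀ * y₁ * y₂)) :
    1 - T * v + p * (T₁ + (p ^ 2 + 1) * T₂ + (p ^ 2 + 1) ^ 2 * B) * v ^ 2
      - p ^ 3 * T * (T₂ + B) * v ^ 3
      + p ^ 6 * (-2 * p * T₁ * B + T₂ ^ 2 - 2 * (p - 1) * T₂ * B
          - (p ^ 2 + 2 * p - 1) * (p ^ 2 - p + 1) * (p ^ 2 + p + 1) * B ^ 2 + B * T ^ 2) * v ^ 4
      - p ^ 9 * B * T * (T₂ + B) * v ^ 5
      + p ^ 13 * B ^ 2 * (T₁ + (p ^ 2 + 1) * T₂ + (p ^ 2 + 1) ^ 2 * B) * v ^ 6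
      - p ^ 18 * B ^ 3 * T * v ^ 7 + p ^ 24 * B ^ 4 * v ^ 8 =
    (1 - a * v) * (1 - a * (p * y₀) * v) * (1 - a * (p ^ 2 * y₁) * v) *
      (1 - a * (p ^ 3 * y₂) * v) * (1 - a * ((p * y₀) * (p ^ 2 * y₁)) * v) *
      (1 - a * ((p * y₀) * (p ^ 3 * y₂)) * v) * (1 - a * ((p ^ 2 * y₁) * (p ^ 3 * y₂)) * v) *
      (1 - a * ((p * y₀) * ((p ^ 2 * y₁) * (p ^ 3 * y₂))) * v) := by
  subst hT hT₁ hT₂ hB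
  ring

theorem spinor_three : spinor 3 =
    (1 - C (x 3 0) * X) * (1 - C (x 3 0 * x 3 1) * X) * (1 - C (x 3 0 * x 3 2) * X) *
      (1 - C (x 3 0 * x 3 3) * X) * (1 - C (x 3 0 * (x 3 1 * x 3 2)) * X) *
      (1 - C (x 3 0 * (x 3 1 * x 3 3)) * X) * (1 - C (x 3 0 * (x 3 2 * x 3 3)) * X) *
      (1 - C (x 3 0 * (x 3 1 * (x 3 2 * x 3 3))) * X) := by
  have h : (Finset.univ : Finset (Finset (Fin 3))) =
      {∅, {0}, {1}, {2}, {0, 1}, {0, 2}, {1, 2}, {0, 1, 2}} := by decide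
  have e0 : (0 : Fin 3).succ = 1 := rfl
  have e1 : (1 : Fin 3).succ = 2 := rfl
  have e2 : (2 : Fin 3).succ = 3 := rfl
  rw [spinor, h]
  repeat rw [Finset.prod_insert (by decide)]
  simp only [Finset.prod_singleton]
  rw [Finset.prod_insert (show (0 : Fin 3) ∉ ({1, 2} : Finset _) by decide),
    Finset.prod_pair (show (1 : Fin 3) ≠ 2 by decide)]
  simp only [Finset.prod_empty, e0, e1, e2, mul_one, mul_assoc]

theorem natDegree_one_sub_C_mul_X {A : Type*} [CommRing A] [Nontrivial A] {u : A} (hu : u ≠ 0) :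
    (1 - C u * X).natDegree = 1 := by
  have h : (1 - C u * X : A[X]) = C (-u) * X + C 1 := by
    rw [C_neg, C_1]
    ring
  rw [h, natDegree_linear (neg_ne_zero.2 hu)]

theorem natDegree_spinor : (spinor 3).natDegree = 8 := by
  have hx : ∀ i, x 3 i ≠ 0 := fun i => by
    rw [x, Ne, AddMonoidAlgebra.single_eq_zero]
    exact one_ne_zero
  have hne : ∀ I : Finset (Fin 3), x 3 0 * ∏ i ∈ I, x 3 i.succ ≠ 0 := fun I =>
    mul_ne_zero (hx 0) (Finset.prod_ne_zero_iff.2 fun i _ => hx _)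
  rw [spinor, natDegree_prod]
  · rw [Finset.sum_congr rfl fun I _ => natDegree_one_sub_C_mul_X (hne I)]
    simp
  · intro I _ h
    have := natDegree_one_sub_C_mul_X (hne I)
    rw [h, natDegree_zero] at this
    omega

/-- The polynomial `1 - T v + ⋯ + p ^ 24 B ^ 4 v ^ 8`. -/
noncomputable def heckePoly {A : Type*} [Ring A] (p : ℕ) (T T₁ T₂ B : A) : A[X] :=
  1 - C T * X
        + C (p * (T₁ + (p ^ 2 + 1) * T₂ + (p ^ 2 + 1) ^ 2 * B)) * X ^ 2
        - C (p ^ 3 * T * (T₂ + B)) * X ^ 3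
        + C (p ^ 6 * (-2 * p * T₁ * B + T₂ ^ 2 - 2 * (p - 1) * T₂ * B
            - (p ^ 2 + 2 * p - 1) * (p ^ 2 - p + 1) * (p ^ 2 + p + 1) * B ^ 2
            + B * T ^ 2)) * X ^ 4
        - C (p ^ 9 * B * T * (T₂ + B)) * X ^ 5
        + C (p ^ 13 * B ^ 2 * (T₁ + (p ^ 2 + 1) * T₂ + (p ^ 2 + 1) ^ 2 * B)) * X ^ 6
        - C (p ^ 18 * B ^ 3 * T) * X ^ 7
        + C (p ^ 24 * B ^ 4) * X ^ 8

/-- This is applied to the spherical homomorphism and to the inclusion of the integral Hecke ring;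
hence the general rings, with the order of factors respected. -/
theorem map_heckePoly {A A' : Type*} [Ring A] [Ring A'] (f : A →+* A') (p : ℕ) (T T₁ T₂ B : A) :
    (heckePoly p T T₁ T₂ B).map f = heckePoly p (f T) (f T₁) (f T₂) (f B) := by
  simp only [heckePoly, Polynomial.map_add, Polynomial.map_sub, Polynomial.map_mul,
    Polynomial.map_pow, Polynomial.map_one, map_C, map_X]
  simp only [map_mul, map_add, map_sub, map_pow, map_one, map_neg, map_natCast, map_ofNat]

variable {p : ℕ} [hp : Fact p.Prime]

theorem heckePoly_Omega : heckePoly p (Omega 3 p (heckeT 3 p)) (Omega 3 p (heckeTi 3 p 1))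
    (Omega 3 p (heckeTi 3 p 2)) (Omega 3 p (heckeTi 3 p 3)) = spinor 3 := by
  have hx1 : x 3 1 = (p : Laurent 3) * wt p 0 := by simpa using x_succ (p := p) 0
  have hx2 : x 3 2 = (p : Laurent 3) ^ 2 * wt p 1 := by simpa using x_succ (p := p) 1
  have hx3 : x 3 3 = (p : Laurent 3) ^ 3 * wt p 2 := by simpa using x_succ (p := p) 2
  have eT := Omega_heckeT (p := p)
  have eT₁ := Omega_heckeTi (p := p) (i := 1) (by norm_num) (by norm_num)
  have eT₂ := Omega_heckeTi (p := p) (i := 2) (by norm_num) (by norm_num)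
  have eB := Omega_heckeTi (p := p) (i := 3) (by norm_num) (by norm_num)
  rw [rankStep_rank_two] at eT₁
  rw [rankStep_rank_one] at eT₂
  rw [rankStep_rank_zero] at eB
  rw [spinor_three, hx1, hx2, hx3]
  generalize Omega 3 p (heckeT 3 p) = T at *
  generalize Omega 3 p (heckeTi 3 p 1) = T₁ at *
  generalize Omega 3 p (heckeTi 3 p 2) = T₂ at *
  generalize Omega 3 p (heckeTi 3 p 3) = B at *
  generalize x 3 0 = a at *
  generalize wt p 0 = y₀ at *
  generalize wt p 1 = y₁ at *
  generalize wt p 2 = y₂ at *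
  -- The identity is used inside the polynomial ring, with constants for the weights and `X` for
  -- `v`.
  have key := spinor_identity (C (p : Laurent 3)) (C a) (C y₀) (C y₁) (C y₂) X (C T) (C T₁) (C T₂)
    (C B)
    (by rw [eT]; simp only [map_mul, map_add, map_pow, map_one])
    (by rw [eT₁]; simp only [map_mul, map_add, map_sub, map_pow, map_one, map_ofNat])
    (by rw [eT₂]; simp only [map_mul, map_add, map_sub, map_pow, map_one])
    (by rw [eB]; simp only [map_mul, map_pow])
  rw [heckePoly]
  simp only [map_mul, map_add, map_sub, map_pow, map_one, map_neg, map_ofNat] at key ⊢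
  exact key

end Spinor

end SpHecke

/-! ### Conclusion: uniqueness, integrality and degree. -/

open SpHecke in
theorem theorem2 (p : ℕ) [Fact p.Prime] (T T₁ T₂ B : SpHecke.LocalHecke 3 p)
    (hT : T = SpHecke.heckeT 3 p) (hT₁ : T₁ = SpHecke.heckeTi 3 p 1)
    (hT₂ : T₂ = SpHecke.heckeTi 3 p 2) (hB : B = SpHecke.bracket 3 p)
    (Q₃ : (SpHecke.LocalHecke 3 p)[X])
    (hQ₃ : Q₃ =
      1 - C T * X
        + C (p * (T₁ + (p ^ 2 + 1) * T₂ + (p ^ 2 + 1) ^ 2 * B)) * X ^ 2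
        - C (p ^ 3 * T * (T₂ + B)) * X ^ 3
        + C (p ^ 6 * (-2 * p * T₁ * B + T₂ ^ 2 - 2 * (p - 1) * T₂ * B
            - (p ^ 2 + 2 * p - 1) * (p ^ 2 - p + 1) * (p ^ 2 + p + 1) * B ^ 2
            + B * T ^ 2)) * X ^ 4
        - C (p ^ 9 * B * T * (T₂ + B)) * X ^ 5
        + C (p ^ 13 * B ^ 2 * (T₁ + (p ^ 2 + 1) * T₂ + (p ^ 2 + 1) ^ 2 * B)) * X ^ 6
        - C (p ^ 18 * B ^ 3 * T) * X ^ 7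
        + C (p ^ 24 * B ^ 4) * X ^ 8) :
    -- `Q₃` is the one and only polynomial whose image under `Ω` is the spinor polynomial
    (∀ Q : (SpHecke.LocalHecke 3 p)[X],
      (∀ j : ℕ, SpHecke.Omega 3 p (Q.coeff j) = (SpHecke.spinor 3).coeff j) ↔ Q = Q₃) ∧
    (∀ j : ℕ, Q₃.coeff j ∈ SpHecke.integralHecke 3 p) ∧
    Q₃.natDegree = 8 := by
  replace hB := hB.trans bracket_eq_heckeTi
  change Q₃ = heckePoly p T T₁ T₂ B at hQ₃
  have hmap : Q₃.map (OmegaHom p) = spinor 3 := by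
    rw [hQ₃, map_heckePoly, hT, hT₁, hT₂, hB]
    exact heckePoly_Omega
  have hcoeff : ∀ j, Omega 3 p (Q₃.coeff j) = (spinor 3).coeff j := fun j => by
    rw [← hmap, coeff_map]
    rfl
  refine ⟨fun Q => ⟨fun h => ?_, ?_⟩, fun j => ?_, ?_⟩
  · ext j
    exact Omega_injective ((h j).trans (hcoeff j).symm)
  · intro h
    rw [h]
    exact hcoeff
  · have mT : T ∈ integralHecke 3 p := hT ▸ Subring.subset_closure (Or.inl rfl)
    have mT₁ : T₁ ∈ integralHecke 3 p :=
      hT₁ ▸ Subring.subset_closure (Or.inr ⟨1, by norm_num, by norm_num, rfl⟩)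
    have mT₂ : T₂ ∈ integralHecke 3 p :=
      hT₂ ▸ Subring.subset_closure (Or.inr ⟨2, by norm_num, by norm_num, rfl⟩)
    have mB : B ∈ integralHecke 3 p :=
      hB ▸ Subring.subset_closure (Or.inr ⟨3, by norm_num, by norm_num, rfl⟩)
    -- The same polynomial formed over the integral subring maps to `Q₃`, so all coefficients lie in
    -- the subring.
    have h : (heckePoly p (⟨T, mT⟩ : integralHecke 3 p) ⟨T₁, mT₁⟩ ⟨T₂, mT₂⟩ ⟨B, mB⟩).map
        (integralHecke 3 p).subtype = Q₃ := by
      rw [map_heckePoly, hQ₃]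
      rfl
    rw [← h, coeff_map]
    exact Subtype.property _
  · rw [← natDegree_map_eq_of_injective (f := OmegaHom p) Omega_injective, hmap, natDegree_spinor]
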